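/- **Setting.** Let $n\ge 1$ and let $\mathbb R^{n+1}_+=\{x_{n+1}>0\}$ carry the Lorentz metric $x_{n+1}^{-2}(dx_1^2+\dots+dx_n^2-dx_{n+1}^2)$ (half space model of the steady state space $\mathcal H^{n+1}$). Let $K=\{\lambda\in\mathbb R^n:\lambda_i>0 \ \forall i\}$ and let $f\in C^1(K)\cap C^0(\overline K)$ be symmetric, with $f_i=\partial f/\partial\lambda_i>0$ in $K$, $f$ and $f^*(\lambda)=f(1/\lambda_1,\dots,1/\lambda_n)^{-1}$ concave in $K$, $f>0$ in $K$, $f=0$ on $\partial K$, $f(1,\dots,1)=1$, and $f$ homogeneous of degree one. Let $\sigma>1$ be a constant and let $\Omega\subset\mathbb R^n$ be open and nonempty. For a function $u>0$ with $|\nabla u|<1$ put $\Sigma=\{(x,u(x)):x\in\Omega\}$; let $g_{ij}$, $\nabla$ be its induced metric and Levi-Civita connection, $\nu=(\nabla u,1)/\sqrt{1-|\nabla u|^2}$ its upward Minkowski unit normal, so that $\nu^{n+1}=1/\sqrt{1-|\nabla u|^2}$, $h_{ij}=\langle D_iX_j,\mathbf n\rangle$ its second fundamental form with respect to the unit normal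 $\mathbf n=u\nu$, where $X_j$ are the coordinate tangent fields of the graph and $D$ is the Levi-Civita connection of $\mathcal H^{n+1}$, and $\kappa=(\kappa_1,\dots,\kappa_n)$ its principal curvatures, the eigenvalues of $g^{ik}h_{kj}$. Assume that $u$ is smooth in $\Omega$, that all $\kappa_i>0$ (strict local convexity), and that $f(\kappa)=\sigma$ on $\Sigma$. For a symmetric matrix $A$ with eigenvalues $\lambda(A)$ let $F(A)=f(\lambda(A))$ and $F^{ij}=\partial F/\partial a_{ij}$ (with respect to symmetric matrices), evaluated at $A=(h_{ij})$ in a $g$-orthonormal frame. **(a)** In every orthonormal frame, at every point of $\Sigma$, $$F^{ij}\nabla_{ij}\frac{\sigma-\nu^{n+1}}{u}=\frac{\sigma}{u}\Big(1-\sum f_i(\kappa)\Big)+\frac{\nu^{n+1}}{u}\Big(\sigma^2-\sum f_i(\kappa)\kappa_i^2\Big)\le 0 .$$ **(b)** If $\Omega$ is bounded and $u$ is smooth, positive and spacelike ($|\nabla u|<1$) up to the boundary, i.e. on $\overline\Omega$, then $\frac{\sigma-\nu^{n+1}}{u}\ge\inf_{\partial\Sigma}\frac{\sigma-\nu^{n+1}}{u}$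 on $\Sigma$, and the infimum is attained on $\partial\Sigma=\{(x,u(x)):x\in\partial\Omega\}$. **(c)** Let $\Omega$ be bounded with smooth boundary, and let $r_1\in(0,\infty)$, $r_2\in(0,\infty]$ be the maximal radii of interior and exterior spheres to $\partial\Omega$: the largest $r$ such that every $x_0\in\partial\Omega$ lies on the boundary of an open ball of radius $r$ contained in $\Omega$, respectively disjoint from $\Omega$ ($r_2=\infty$ if all $r$ are possible). These exist, and there is $\epsilon_0>0$, $\epsilon_0<\min(r_1,r_2)$, depending only on $\Omega$, such that for every $0<\epsilon\le\epsilon_0$ and every $f,\sigma,u$ as above, with $u$ smooth, positive and spacelike up to the boundary and $u=\epsilon$ on $\partial\Omega$, $$\frac{r_1\sqrt{\sigma^2-1}}{r_1^2-\epsilon^2}+\frac{\epsilon(\sigma-1)}{r_1^2-\epsilon^2}>\frac{\sigma-\nu^{n+1}}{u}>-\frac{r_2\sqrt{\sigma^2-1}}{r_2^2-\epsilon^2}-\frac{\epsilon(1+\sigma)}{r_2^2-\epsilon^2}\quad\text{on }\partial\Sigma,$$ where the right-hand side is read as $0$ if $r_2=\infty$. In particular $\nu^{n+1}\to\sigma$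 on $\partial\Sigma$ as $\epsilon\to0$: for each $\sigma>1$ and $\eta>0$ there is $\delta>0$, depending only on $\Omega,\sigma,\eta$, such that $|\nu^{n+1}-\sigma|<\eta$ on $\partial\Sigma$ for all such $f$ and $u$ with $0<\epsilon<\delta$. -/

import Mathlib

open scoped ContDiff

noncomputable section

namespace SteadyState

/-! ### Calculus in coordinates -/

/-- The partial derivative `∂φ/∂x_i` at `x`, for a function of the coordinates `x ∈ ℝ^ι`. -/
def pd {ι : Type} [Fintype ι] [DecidableEq ι] {V : Type} [NormedAddCommGroup V] [NormedSpace ℝ V]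
    (i : ι) (φ : EuclideanSpace ℝ ι → V) (x : EuclideanSpace ℝ ι) : V :=
  fderiv ℝ φ x (EuclideanSpace.single i 1)

/-- Christoffel symbols `Γ^k_{ij}` of the Levi-Civita connection of a (semi-Riemannian) metric
given by its matrix field `G` in coordinates. -/
def christoffel {ι : Type} [Fintype ι] [DecidableEq ι]
    (G : EuclideanSpace ℝ ι → Matrix ι ι ℝ) (x : EuclideanSpace ℝ ι) (k i j : ι) : ℝ :=
  (1 / 2) * ∑ l, (G x)⁻¹ k l *
    (pd i (fun y => G y j l) x + pd j (fun y => G y i l) x - pd l (fun y => G y i j) x)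

/-- The covariant Hessian `∇_{ij} φ = ∂_i ∂_j φ - Γ^k_{ij} ∂_k φ` of a function. -/
def hessian {ι : Type} [Fintype ι] [DecidableEq ι]
    (G : EuclideanSpace ℝ ι → Matrix ι ι ℝ) (φ : EuclideanSpace ℝ ι → ℝ)
    (x : EuclideanSpace ℝ ι) : Matrix ι ι ℝ :=
  Matrix.of fun i j => pd i (pd j φ) x - ∑ k, christoffel G x k i j * pd k φ x

/-! ### The half space model of the steady state space -/

/-- The Lorentz metric `x_{n+1}^{-2} (dx_1² + ⋯ + dx_n² - dx_{n+1}²)`; the last coordinate is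
`x_{n+1}`. -/
def ambientMetric (n : ℕ) (p : EuclideanSpace ℝ (Fin (n + 1))) :
    Matrix (Fin (n + 1)) (Fin (n + 1)) ℝ :=
  Matrix.diagonal fun a =>
    if a = Fin.last n then -1 / (p (Fin.last n)) ^ 2 else 1 / (p (Fin.last n)) ^ 2

/-- The product `⟨v, w⟩_D` of two tangent vectors at `p`. -/
def ambientInner {n : ℕ} (p v w : EuclideanSpace ℝ (Fin (n + 1))) : ℝ :=
  ∑ a, ∑ b, ambientMetric n p a b * v a * w b

/-! ### Geometry of the graph of `u` -/

section Graph

variable {n : ℕ}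

/-- The parametrisation `x ↦ (x, u(x))` of the graph of `u`. -/
def graphMap (u : EuclideanSpace ℝ (Fin n) → ℝ) (x : EuclideanSpace ℝ (Fin n)) :
    EuclideanSpace ℝ (Fin (n + 1)) :=
  WithLp.toLp 2 (Fin.snoc (α := fun _ => ℝ) (fun i => x i) (u x))

/-- `|∇u|²` (Euclidean). -/
def gradSq (u : EuclideanSpace ℝ (Fin n) → ℝ) (x : EuclideanSpace ℝ (Fin n)) : ℝ :=
  ∑ i, (pd i u x) ^ 2

/-- The upward unit normal `ν = (∇u, 1) / √(1 - |∇u|²)` with respect to the Minkowski metric. -/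
def minkowskiNormal (u : EuclideanSpace ℝ (Fin n) → ℝ) (x : EuclideanSpace ℝ (Fin n)) :
    EuclideanSpace ℝ (Fin (n + 1)) :=
  WithLp.toLp 2 (fun a => Fin.snoc (α := fun _ => ℝ) (fun i => pd i u x) 1 a /
    Real.sqrt (1 - gradSq u x))

/-- The unit normal `n = u ν` with respect to the steady state metric. -/
def unitNormal (u : EuclideanSpace ℝ (Fin n) → ℝ) (x : EuclideanSpace ℝ (Fin n)) :
    EuclideanSpace ℝ (Fin (n + 1)) :=
  u x • minkowskiNormal u x

/-- The vertical component `ν^{n+1}` of the Minkowski unit normal. -/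
def nuVert (u : EuclideanSpace ℝ (Fin n) → ℝ) (x : EuclideanSpace ℝ (Fin n)) : ℝ :=
  minkowskiNormal u x (Fin.last n)

/-- The induced metric `g_{ij} = ⟨X_i, X_j⟩_D`, where `X_i` are the coordinate vector fields. -/
def inducedMetric (u : EuclideanSpace ℝ (Fin n) → ℝ) (x : EuclideanSpace ℝ (Fin n)) :
    Matrix (Fin n) (Fin n) ℝ :=
  Matrix.of fun i j => ambientInner (graphMap u x) (pd i (graphMap u) x) (pd j (graphMap u) x)

/-- The ambient covariant derivative `D_{X_i} X_j`. -/
def covDeriv (u : EuclideanSpace ℝ (Fin n) → ℝ) (x : EuclideanSpace ℝ (Fin n)) (i j : Fin n) :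
    EuclideanSpace ℝ (Fin (n + 1)) :=
  WithLp.toLp 2 fun c => pd i (fun y => pd j (graphMap u) y c) x +
    ∑ a, ∑ b, christoffel (ambientMetric n) (graphMap u x) c a b *
      pd i (graphMap u) x a * pd j (graphMap u) x b

/-- The second fundamental form `h_{ij} = ⟨D_{X_i} X_j, n⟩_D`. -/
def secondFundForm (u : EuclideanSpace ℝ (Fin n) → ℝ) (x : EuclideanSpace ℝ (Fin n)) :
    Matrix (Fin n) (Fin n) ℝ :=
  Matrix.of fun i j => ambientInner (graphMap u x) (covDeriv u x i j) (unitNormal u x)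

/-- `κ` lists the principal curvatures of the graph at `(x, u(x))`: the eigenvalues of
`g^{ik} h_{kj}`, with multiplicity, in some order. -/
def IsPrincipalCurvatures (u : EuclideanSpace ℝ (Fin n) → ℝ) (x : EuclideanSpace ℝ (Fin n))
    (κ : Fin n → ℝ) : Prop :=
  ((inducedMetric u x)⁻¹ * secondFundForm u x).charpoly =
    ∏ i, (Polynomial.X - Polynomial.C (κ i))

/-- The columns of `P` are the coefficients, in the basis `X_1, …, X_n`, of a `g`-orthonormal frame
`τ_1, …, τ_n` of the tangent space of the graph at `(x, u(x))`. -/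
def IsOrthonormalFrame (u : EuclideanSpace ℝ (Fin n) → ℝ) (x : EuclideanSpace ℝ (Fin n))
    (P : Matrix (Fin n) (Fin n) ℝ) : Prop :=
  P.transpose * inducedMetric u x * P = 1

/-- The function `(σ - ν^{n+1}) / u`. -/
def angleQuotient (σ : ℝ) (u : EuclideanSpace ℝ (Fin n) → ℝ) (x : EuclideanSpace ℝ (Fin n)) : ℝ :=
  (σ - nuVert u x) / u x

end Graph

/-! ### Curvature functions -/

section Curvature

variable {n : ℕ}

/-- The open positive cone `K_n^+`. -/
def posCone (n : ℕ) : Set (Fin n → ℝ) := {l | ∀ i, 0 < l i}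

/-- The partial derivative `f_i = ∂f/∂λ_i`. -/
def fPartial (f : (Fin n → ℝ) → ℝ) (i : Fin n) (l : Fin n → ℝ) : ℝ :=
  fderiv ℝ f l (Pi.single i 1)

/-- The structure conditions on a curvature function in the positive cone. -/
structure IsCurvatureFunction (f : (Fin n → ℝ) → ℝ) : Prop where
  contDiffOn : ContDiffOn ℝ 1 f (posCone n)
  continuousOn : ContinuousOn f (closure (posCone n))
  symmetric : ∀ l ∈ posCone n, ∀ π : Equiv.Perm (Fin n), f (fun i => l (π i)) = f l
  partial_pos : ∀ l ∈ posCone n, ∀ i, 0 < fPartial f i l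
  concave : ConcaveOn ℝ (posCone n) f
  dual_concave : ConcaveOn ℝ (posCone n) fun l => (f fun i => (l i)⁻¹)⁻¹
  pos : ∀ l ∈ posCone n, 0 < f l
  zero_boundary : ∀ l ∈ frontier (posCone n), f l = 0
  normalized : f (fun _ => 1) = 1
  homogeneous : ∀ l ∈ posCone n, ∀ t : ℝ, 0 < t → f (t • l) = t * f l

/-- `F(A) = f(λ(A))` for a real symmetric matrix `A` with eigenvalues `λ(A)` (`0` for all other
matrices, a value that is never used). -/
def spectralFn (f : (Fin n → ℝ) → ℝ) (A : Matrix (Fin n) (Fin n) ℝ) : ℝ :=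
  open scoped Classical in
  if hA : A.IsHermitian then f hA.eigenvalues else 0

/-- `F^{ij} = ∂F/∂a_{ij}` on the space of symmetric matrices: the derivative of `F` at `A` in the
direction `(E_{ij} + E_{ji}) / 2`, so that `dF_A(S) = ∑ F^{ij} S_{ij}` for symmetric `S`. -/
def spectralPartial (f : (Fin n → ℝ) → ℝ) (A : Matrix (Fin n) (Fin n) ℝ) (i j : Fin n) : ℝ :=
  lineDeriv ℝ (spectralFn f) A
    ((1 / 2 : ℝ) • (Matrix.single i j (1 : ℝ) + Matrix.single j i (1 : ℝ)))

/-- `F^{ij} ∇_{ij} φ` at the point `(x, u(x))` of the graph, computed in the orthonormal frame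
given by `P`: in this frame `A[Σ] = (h(τ_i, τ_j))` and `∇_{ij} φ = ∇²φ(τ_i, τ_j)`. -/
def linearizedOp (f : (Fin n → ℝ) → ℝ) (u : EuclideanSpace ℝ (Fin n) → ℝ)
    (P : Matrix (Fin n) (Fin n) ℝ) (φ : EuclideanSpace ℝ (Fin n) → ℝ)
    (x : EuclideanSpace ℝ (Fin n)) : ℝ :=
  ∑ i, ∑ j, spectralPartial f (P.transpose * secondFundForm u x * P) i j *
    (P.transpose * hessian (inducedMetric u) φ x * P) i j

/-- The graph of `u` over the open set `Ω` is a smooth spacelike strictly locally convex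
hypersurface of the steady state space with `f(κ) = σ`. -/
structure IsSolution (f : (Fin n → ℝ) → ℝ) (σ : ℝ) (Ω : Set (EuclideanSpace ℝ (Fin n)))
    (u : EuclideanSpace ℝ (Fin n) → ℝ) : Prop where
  smooth : ContDiffOn ℝ ∞ u Ω
  pos : ∀ x ∈ Ω, 0 < u x
  spacelike : ∀ x ∈ Ω, gradSq u x < 1
  curvature : ∀ x ∈ Ω, ∃ κ : Fin n → ℝ,
    IsPrincipalCurvatures u x κ ∧ (∀ i, 0 < κ i) ∧ f κ = σ

/-- As `IsSolution`, and `u` is smooth, positive and spacelike up to the boundary. (Smooth up to the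
boundary: near each boundary point `u` is smooth on a full neighbourhood; only the values of `u` on
`closure Ω` enter the theorem, since they determine `∇u` there.) -/
structure IsSolutionUpToBoundary (f : (Fin n → ℝ) → ℝ) (σ : ℝ)
    (Ω : Set (EuclideanSpace ℝ (Fin n))) (u : EuclideanSpace ℝ (Fin n) → ℝ) : Prop
    extends IsSolution f σ Ω u where
  smooth_closure : ∀ x ∈ closure Ω, ContDiffAt ℝ ∞ u x
  pos_closure : ∀ x ∈ closure Ω, 0 < u x
  spacelike_closure : ∀ x ∈ closure Ω, gradSq u x < 1

end Curvature

/-! ### Domains -/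

section Domain

variable {n : ℕ}

/-- `∂Ω` is smooth: near each boundary point, `Ω` is the sublevel set of a smooth function without
critical points. -/
def HasSmoothBoundary (Ω : Set (EuclideanSpace ℝ (Fin n))) : Prop :=
  ∀ x ∈ frontier Ω, ∃ (U : Set (EuclideanSpace ℝ (Fin n))) (ρ : EuclideanSpace ℝ (Fin n) → ℝ),
    IsOpen U ∧ x ∈ U ∧ ContDiffOn ℝ ∞ ρ U ∧ (∀ y ∈ U, fderiv ℝ ρ y ≠ 0) ∧
      Ω ∩ U = {y ∈ U | ρ y < 0}

/-- The radii `r > 0` such that every boundary point lies on an interior sphere of radius `r`. -/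
def interiorRadii (Ω : Set (EuclideanSpace ℝ (Fin n))) : Set ℝ :=
  {r | 0 < r ∧ ∀ x ∈ frontier Ω, ∃ c, dist x c = r ∧ Metric.ball c r ⊆ Ω}

/-- The radii `r > 0` such that every boundary point lies on an exterior sphere of radius `r`. -/
def exteriorRadii (Ω : Set (EuclideanSpace ℝ (Fin n))) : Set ℝ :=
  {r | 0 < r ∧ ∀ x ∈ frontier Ω, ∃ c, dist x c = r ∧ Disjoint (Metric.ball c r) Ω}

end Domain

end SteadyState

end

namespace SteadyState
open Matrix

/-! ### Concave functions and curvature functions -/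

/-! The differential identity. Write N = ν^{n+1}/u. On the graph, ∇²(1/u) = -(1/u) g + N h. In a
principal direction with curvature κ_k, ∇²N equals -κ_k/u + N κ_k² plus a multiple of a directional
derivative of h - κ_k g (`hessian_inv`, `hessian_nuQuot_principal`). Contracting with f_k removes
this last term, because it is the derivative of the equation f(κ) = σ
(`IsSolution.sum_fPartial_mul_pd`), and Euler's relation ∑ f_k κ_k = σ does the rest. The sign comes
from two supporting hyperplanes evaluated at (1,…,1): that of f gives ∑ f_i ≥ 1, that of f* gives ∑
f_i κ_i² ≥ σ² (`one_le_sum_fPartial`, `sq_le_sum_fPartial_mul_sq`).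

Since f is only C¹, nothing is differentiated through the spectrum. By Birkhoff's theorem a
symmetric concave f satisfies a tangent inequality for matrices (`le_add_sum_of_concave_symmetric`).
Along the solution it makes a linear combination of diagonal entries of h attain a local minimum,
whose critical point equation is the differentiated equation. The derivative F^{ij} is found by
squeezing F between this bound for f and the reciprocal of the one for f*.

Minimum principle. Subtracting ε/u from (σ - ν^{n+1})/u makes the inequality strict, which excludes
interior minima (`IsSolution.not_isLocalMin`); then ε tends to 0.

Boundary estimate. The umbilic barriers are the hyperboloids s x_{n+1} = τR - √(R² + |x-c|²) with s
= ±1, all of whose principal curvatures are τ. For fixed τ > 1 they are strictly ordered by R, so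
`coneRadius` records which one passes through a given point. An interior minimum of this radius
along the graph is a tangency, and comparing second derivatives forces σ ≤ τ for s = 1 and τ ≤ σ for
s = -1. Hence u lies above caps with τ < σ over interior balls and below those with τ > σ attached
to exterior balls. Comparing normal derivatives at a common boundary point and letting τ tend to σ
gives the bound through 1/R.

If exterior spheres of arbitrarily large radius exist, Ω lies on one side of each tangent plane. The
tilted plane with ν^{n+1} = σ is then the natural barrier, but gives only ν^{n+1} ≤ σ. Strictness
needs a Hopf type argument (`nuVert_lt`): the plane is bent down exponentially, and ellipticity is
uniform because f vanishes on the boundary of the cone. -/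

theorem _root_.ConcaveOn.le_add_fderiv {E : Type*} [NormedAddCommGroup E] [NormedSpace ℝ E]
    {s : Set E} {f : E → ℝ} (hf : ConcaveOn ℝ s f) {x y : E} (hx : x ∈ s) (hy : y ∈ s)
    (hd : DifferentiableAt ℝ f x) : f y ≤ f x + fderiv ℝ f x (y - x) := by
  have h1 : HasDerivAt (fun t : ℝ => f (x + t • (y - x))) (fderiv ℝ f x (y - x)) 0 := by
    have h2 : HasDerivAt (fun t : ℝ => x + t • (y - x)) (y - x) 0 := by
      simpa using ((hasDerivAt_id (0 : ℝ)).smul_const (y - x)).const_add x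
    have h3 : HasFDerivAt f (fderiv ℝ f x) (x + (0 : ℝ) • (y - x)) := by
      simpa using hd.hasFDerivAt
    exact h3.comp_hasDerivAt (0 : ℝ) h2
  have h2 := h1.tendsto_slope_zero_right
  have h3 : f y - f x ≤ fderiv ℝ f x (y - x) := by
    refine ge_of_tendsto h2 ?_
    have : Set.Ioo (0 : ℝ) 1 ∈ nhdsWithin 0 (Set.Ioi 0) := Ioo_mem_nhdsGT one_pos
    filter_upwards [this] with t ht
    have h4 := hf.2 hx hy (sub_nonneg.2 ht.2.le) ht.1.le (by ring)
    have h5 : (1 - t) • x + t • y = x + t • (y - x) := by module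
    rw [h5] at h4
    simp only [smul_eq_mul, zero_add, zero_smul, add_zero] at h4 ⊢
    rw [← div_eq_inv_mul, le_div_iff₀ ht.1]
    linarith
  linarith

variable {n : ℕ}

theorem isOpen_posCone : IsOpen (posCone n) := by
  have : posCone n = ⋂ i, {l : Fin n → ℝ | 0 < l i} := by ext; simp [posCone]
  rw [this]
  exact isOpen_iInter_of_finite fun i => isOpen_lt continuous_const (continuous_apply i)

theorem one_mem_posCone : (fun _ => 1 : Fin n → ℝ) ∈ posCone n := fun _ => one_pos

theorem inv_mem_posCone {l : Fin n → ℝ} (h : l ∈ posCone n) :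
    (fun i => (l i)⁻¹) ∈ posCone n := fun i => inv_pos.2 (h i)

theorem fderiv_eq_sum_fPartial (f : (Fin n → ℝ) → ℝ) (l v : Fin n → ℝ) :
    fderiv ℝ f l v = ∑ i, fPartial f i l * v i := by
  conv_lhs => rw [pi_eq_sum_univ' v]
  simp [fPartial, mul_comm, Pi.single]

/-- Supporting hyperplanes of homogeneous symmetric concave functions on matrices, expressed through
eigenvalues: `A = U diag(l) Uᵀ`, `B = V diag(m) Vᵀ`. -/
theorem le_add_sum_of_concave_symmetric {f : (Fin n → ℝ) → ℝ}
    (hf : ConcaveOn ℝ (posCone n) f)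
    (hs : ∀ l ∈ posCone n, ∀ π : Equiv.Perm (Fin n), f (fun i => l (π i)) = f l)
    {l m : Fin n → ℝ} (hl : l ∈ posCone n) (hm : m ∈ posCone n)
    (hd : DifferentiableAt ℝ f l) {U V B : Matrix (Fin n) (Fin n) ℝ}
    (hU : Uᵀ * U = 1) (hV : Vᵀ * V = 1) (hB : B = V * diagonal m * Vᵀ) :
    f m ≤ f l + ∑ i, fPartial f i l * ((Uᵀ * B * U) i i - l i) := by
  set W := Uᵀ * V with hW
  have hW1 : Wᵀ * W = 1 := by
    rw [hW, transpose_mul, transpose_transpose, Matrix.mul_assoc, ← Matrix.mul_assoc U,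
      mul_eq_one_comm.1 hU, Matrix.one_mul, hV]
  have hW2 : W * Wᵀ = 1 := mul_eq_one_comm.1 hW1
  -- The squared entries of an orthogonal matrix form a doubly stochastic matrix, and it sends the
  -- eigenvalues of B to the diagonal of B in the basis U. By Birkhoff this diagonal is a convex
  -- combination of permutations of m, where symmetry and concavity apply.
  set M : Matrix (Fin n) (Fin n) ℝ := Matrix.of fun i j => W i j ^ 2 with hM
  have hMd : M ∈ doublyStochastic ℝ (Fin n) := by
    rw [mem_doublyStochastic_iff_sum]
    refine ⟨fun i j => by simp only [hM, of_apply]; positivity, fun i => ?_, fun j => ?_⟩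
    · have := congrFun (congrFun hW2 i) i
      simpa [hM, mul_apply, pow_two] using this
    · have := congrFun (congrFun hW1 j) j
      simpa [hM, mul_apply, pow_two] using this
  have hdiag : ∀ i, (Uᵀ * B * U) i i = (M *ᵥ m) i := by
    intro i
    have : Uᵀ * B * U = W * diagonal m * Wᵀ := by
      rw [hB, hW, transpose_mul, transpose_transpose]; simp only [Matrix.mul_assoc]
    rw [this, mul_apply]
    simp only [mul_diagonal, transpose_apply, mulVec, dotProduct, hM, of_apply]
    exact Finset.sum_congr rfl fun j _ => by ring
  obtain ⟨w, hw0, hw1, hw2⟩ := exists_eq_sum_perm_of_mem_doublyStochastic hMd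
  have hd' : M *ᵥ m = ∑ π, w π • fun i => m (π i) := by
    rw [← hw2]
    ext i
    simp [Matrix.sum_mulVec, Matrix.smul_mulVec, Finset.sum_apply,
      Equiv.Perm.permMatrix, PEquiv.toMatrix_toPEquiv_mulVec]
  have hp : ∀ π : Equiv.Perm (Fin n), (fun i => m (π i)) ∈ posCone n := fun π i => hm (π i)
  have hmem : M *ᵥ m ∈ posCone n := by
    rw [hd']
    exact hf.1.sum_mem (fun π _ => hw0 π) hw1 (fun π _ => hp π)
  have h1 : f m ≤ f (M *ᵥ m) := by
    have h2 := hf.le_map_sum (t := Finset.univ) (w := w) (p := fun π => fun i => m (π i))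
      (fun π _ => hw0 π) hw1 (fun π _ => hp π)
    rw [← hd'] at h2
    refine le_trans (le_of_eq ?_) h2
    simp only [smul_eq_mul, hs m hm, ← Finset.sum_mul, hw1, one_mul]
  have h2 := hf.le_add_fderiv hl hmem hd
  rw [fderiv_eq_sum_fPartial] at h2
  simp only [hdiag]
  exact h1.trans h2

/-- Equal root multisets mean that corresponding fibres of the two lists have the same size;
bijections of the fibres glue to a permutation. -/
theorem exists_perm_of_prod_X_sub_C_eq {l m : Fin n → ℝ}
    (h : (∏ i, (Polynomial.X - Polynomial.C (l i))) = ∏ i, (Polynomial.X - Polynomial.C (m i))) :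
    ∃ π : Equiv.Perm (Fin n), l = m ∘ π := by
  have h1 := congrArg Polynomial.roots h
  rw [Polynomial.roots_prod _ _ (Finset.prod_ne_zero_iff.2 fun i _ => Polynomial.X_sub_C_ne_zero _),
    Polynomial.roots_prod _ _ (Finset.prod_ne_zero_iff.2 fun i _ => Polynomial.X_sub_C_ne_zero _)]
    at h1
  simp only [Polynomial.roots_X_sub_C, Multiset.bind_singleton] at h1
  have h4 : ∀ c, Nonempty ({i // l i = c} ≃ {i // m i = c}) := by
    intro c
    have h5 := congrArg (Multiset.count c) h1
    rw [Multiset.count_map, Multiset.count_map] at h5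
    refine ⟨Fintype.equivOfCardEq ?_⟩
    rw [Fintype.card_subtype, Fintype.card_subtype]
    simpa [Finset.card, Finset.filter, eq_comm] using h5
  let π : Equiv.Perm (Fin n) := Equiv.ofFiberEquiv fun c => (h4 c).some
  exact ⟨π, funext fun i => (Equiv.ofFiberEquiv_map _ i).symm⟩

namespace IsCurvatureFunction

variable {f : (Fin n → ℝ) → ℝ} (hf : IsCurvatureFunction f)

include hf

theorem differentiableAt {l : Fin n → ℝ} (hl : l ∈ posCone n) : DifferentiableAt ℝ f l :=
  (hf.contDiffOn.contDiffAt (isOpen_posCone.mem_nhds hl)).differentiableAt (by simp)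

theorem sum_fPartial_mul_self {l : Fin n → ℝ} (hl : l ∈ posCone n) :
    ∑ i, fPartial f i l * l i = f l := by
  rw [← fderiv_eq_sum_fPartial]
  have h1 : HasDerivAt (fun t : ℝ => f (t • l)) (fderiv ℝ f l l) 1 := by
    have h2 : HasDerivAt (fun t : ℝ => t • l) l 1 := by
      simpa using (hasDerivAt_id (1 : ℝ)).smul_const l
    have h3 : HasFDerivAt f (fderiv ℝ f l) ((1 : ℝ) • l) := by
      simpa using (hf.differentiableAt hl).hasFDerivAt
    exact h3.comp_hasDerivAt (1 : ℝ) h2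
  have h2 : HasDerivAt (fun t : ℝ => f (t • l)) (f l) 1 := by
    have h3 : HasDerivAt (fun t : ℝ => t * f l) (f l) 1 := by
      simpa using (hasDerivAt_id (1 : ℝ)).mul_const (f l)
    refine h3.congr_of_eventuallyEq ?_
    filter_upwards [lt_mem_nhds (zero_lt_one : (0 : ℝ) < 1)] with t ht
    exact hf.homogeneous l hl t ht
  exact h1.unique h2

/-- The tangent plane of f at l, evaluated at (1,…,1); by Euler's relation its constant term
cancels. -/
theorem one_le_sum_fPartial {l : Fin n → ℝ} (hl : l ∈ posCone n) :
    1 ≤ ∑ i, fPartial f i l := by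
  have h := hf.concave.le_add_fderiv hl one_mem_posCone (hf.differentiableAt hl)
  rw [hf.normalized, fderiv_eq_sum_fPartial] at h
  simp only [Pi.sub_apply, mul_sub, mul_one, Finset.sum_sub_distrib,
    hf.sum_fPartial_mul_self hl] at h
  linarith

theorem const_eq {t : ℝ} (ht : 0 < t) : f (fun _ => t) = t := by
  have := hf.homogeneous _ one_mem_posCone t ht
  rw [hf.normalized] at this
  rw [mul_one] at this
  rw [← this]
  congr 1
  ext
  simp [this]

/-- Tangent plane at the constant vector (t,…,t), where f = t and all partial derivatives are
positive. -/
theorem le_of_forall_le {l : Fin n → ℝ} (hl : l ∈ posCone n) {t : ℝ} (ht : 0 < t)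
    (h : ∀ i, l i ≤ t) : f l ≤ t := by
  have ht' : (fun _ => t : Fin n → ℝ) ∈ posCone n := fun _ => ht
  have h1 := hf.concave.le_add_fderiv ht' hl (hf.differentiableAt ht')
  rw [hf.const_eq ht, fderiv_eq_sum_fPartial] at h1
  simp only [Pi.sub_apply] at h1
  have : ∑ i, fPartial f i (fun _ => t) * (l i - t) ≤ 0 :=
    Finset.sum_nonpos fun i _ =>
      mul_nonpos_of_nonneg_of_nonpos (hf.partial_pos _ ht' i).le (sub_nonpos.2 (h i))
  linarith

theorem hasFDerivAt_dual {l : Fin n → ℝ} (hl : l ∈ posCone n) :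
    ∃ L : (Fin n → ℝ) →L[ℝ] ℝ,
      HasFDerivAt (fun m : Fin n → ℝ => (f fun i => (m i)⁻¹)⁻¹) L l ∧
      ∀ v, L v = (f fun i => (l i)⁻¹)⁻¹ ^ 2 *
        ∑ i, fPartial f i (fun i => (l i)⁻¹) * ((l i)⁻¹ ^ 2 * v i) := by
  have hi : HasFDerivAt (fun m : Fin n → ℝ => fun i => (m i)⁻¹)
      (ContinuousLinearMap.pi fun i =>
        (-(l i ^ 2)⁻¹) • ContinuousLinearMap.proj (R := ℝ) (φ := fun _ : Fin n => ℝ) i) l := by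
    rw [hasFDerivAt_pi]
    intro i
    exact (hasDerivAt_inv (hl i).ne').comp_hasFDerivAt l (hasFDerivAt_apply i l)
  have h1 := (hf.differentiableAt (inv_mem_posCone hl)).hasFDerivAt.comp l hi
  have hpos := hf.pos _ (inv_mem_posCone hl)
  have h2 := (hasDerivAt_inv hpos.ne').comp_hasFDerivAt l h1
  refine ⟨_, h2, fun v => ?_⟩
  simp only [_root_.smul_apply, ContinuousLinearMap.comp_apply,
    fderiv_eq_sum_fPartial, smul_eq_mul, ContinuousLinearMap.pi_apply,
    ContinuousLinearMap.proj_apply, Finset.mul_sum]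
  refine Finset.sum_congr rfl fun i _ => ?_
  rw [inv_pow, inv_pow]
  ring

/-- The tangent plane of the dual function at 1/l, evaluated at (1,…,1). There the dual equals
1/f(l), and Euler's relation cancels its value against the first order part. -/
theorem sq_le_sum_fPartial_mul_sq {l : Fin n → ℝ} (hl : l ∈ posCone n) :
    f l ^ 2 ≤ ∑ i, fPartial f i l * l i ^ 2 := by
  have hl' := inv_mem_posCone hl
  obtain ⟨L, hL, hLv⟩ := hf.hasFDerivAt_dual hl'
  have h := hf.dual_concave.le_add_fderiv hl' one_mem_posCone hL.differentiableAt
  rw [hL.fderiv, hLv] at h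
  simp only [inv_inv, inv_one, hf.normalized, Pi.sub_apply] at h
  have hp := hf.pos l hl
  have h1 : ∑ i, fPartial f i l * (l i ^ 2 * (1 - (l i)⁻¹)) =
      ∑ i, fPartial f i l * l i ^ 2 - f l := by
    rw [← hf.sum_fPartial_mul_self hl, ← Finset.sum_sub_distrib]
    refine Finset.sum_congr rfl fun i _ => ?_
    have := (hl i).ne'
    field_simp
  rw [h1] at h
  have h2 : (f l)⁻¹ + (f l)⁻¹ ^ 2 * (∑ i, fPartial f i l * l i ^ 2 - f l) =
      (∑ i, fPartial f i l * l i ^ 2) / f l ^ 2 := by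
    field_simp
    ring
  rw [h2, le_div_iff₀ (by positivity)] at h
  linarith

theorem dual_symmetric : ∀ l ∈ posCone n, ∀ π : Equiv.Perm (Fin n),
    (fun m : Fin n → ℝ => (f fun i => (m i)⁻¹)⁻¹) (fun i => l (π i)) =
      (fun m : Fin n → ℝ => (f fun i => (m i)⁻¹)⁻¹) l := fun l hl π => by
  simpa using hf.symmetric _ (inv_mem_posCone hl) π

theorem eq_of_charpoly_eq {l m : Fin n → ℝ} (hl : l ∈ posCone n)
    (h : (∏ i, (Polynomial.X - Polynomial.C (l i))) = ∏ i, (Polynomial.X - Polynomial.C (m i))) :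
    m ∈ posCone n ∧ f m = f l := by
  obtain ⟨π, h2⟩ := exists_perm_of_prod_X_sub_C_eq h
  have h3 : m = fun i => l (π.symm i) := by rw [h2]; ext; simp
  rw [h3]
  exact ⟨fun i => hl _, hf.symmetric l hl π.symm⟩

end IsCurvatureFunction


/-! ### Derivatives of functions of the eigenvalues -/

/-- The difference of the two bounds has a minimum at the contact point, so their derivatives agree
there; the error of the middle function is then bounded by the two outer errors. -/
theorem _root_.HasDerivAt.of_squeeze {l g r : ℝ → ℝ} {x d : ℝ} (hr : HasDerivAt r d x)
    (hl : DifferentiableAt ℝ l x) (hlg : ∀ᶠ t in nhds x, l t ≤ g t)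
    (hgr : ∀ᶠ t in nhds x, g t ≤ r t) (h : l x = r x) : HasDerivAt g d x := by
  have hlx := hlg.self_of_nhds
  have hrx := hgr.self_of_nhds
  have hgx : g x = r x := le_antisymm hrx (h ▸ hlx)
  have hmin : IsLocalMin (fun t => r t - l t) x := by
    filter_upwards [hlg, hgr] with t h1 h2
    linarith
  have hd := hmin.hasDerivAt_eq_zero (hr.sub hl.hasDerivAt)
  have hl' : HasDerivAt l d x := by
    have h1 := hl.hasDerivAt
    rwa [← sub_eq_zero.1 hd] at h1
  rw [hasDerivAt_iff_isLittleO] at hl' hr ⊢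
  have hsum := hl'.norm_left.add hr.norm_left
  refine Asymptotics.IsBigO.trans_isLittleO ?_ hsum
  refine Asymptotics.IsBigO.of_bound 1 ?_
  filter_upwards [hlg, hgr] with t h1 h2
  simp only [Real.norm_eq_abs, one_mul]
  refine le_trans ?_ (le_abs_self _)
  rw [abs_le]
  have h3 := neg_abs_le (l t - l x - (t - x) • d)
  have h4 := le_abs_self (r t - r x - (t - x) • d)
  have h5 := abs_nonneg (l t - l x - (t - x) • d)
  have h6 := abs_nonneg (r t - r x - (t - x) • d)
  constructor <;> linarith

section Differentiability

variable {E : Type*} [NormedAddCommGroup E] [NormedSpace ℝ E] {ι : Type*} [Fintype ι]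
  [DecidableEq ι] {M : E → Matrix ι ι ℝ} {x : E}

theorem differentiableAt_det (hM : ∀ i j, DifferentiableAt ℝ (fun y => M y i j) x) :
    DifferentiableAt ℝ (fun y => (M y).det) x := by
  simp only [det_apply]
  refine DifferentiableAt.fun_sum fun π _ => DifferentiableAt.fun_const_smul ?_ _
  exact (HasFDerivAt.finsetProd fun i _ => (hM (π i) i).hasFDerivAt).differentiableAt

theorem differentiableAt_inv_apply (hM : ∀ i j, DifferentiableAt ℝ (fun y => M y i j) x)
    (h : (M x).det ≠ 0) (i j : ι) : DifferentiableAt ℝ (fun y => (M y)⁻¹ i j) x := by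
  have h0 : ∀ y, (M y)⁻¹ i j = (M y).det⁻¹ * ((M y).updateRow j (Pi.single i 1)).det := fun y => by
    rw [inv_def, Matrix.smul_apply, Ring.inverse_eq_inv', smul_eq_mul, adjugate_apply]
  simp only [h0]
  refine ((differentiableAt_det hM).inv h).mul (differentiableAt_det fun k l => ?_)
  by_cases hk : k = j
  · subst hk; simp
  · simpa [updateRow_ne hk] using hM k l

end Differentiability

variable {n : ℕ}

theorem exists_orthogonal_diagonalization {A : Matrix (Fin n) (Fin n) ℝ} (hA : A.IsHermitian) :
    ∃ V : Matrix (Fin n) (Fin n) ℝ, Vᵀ * V = 1 ∧ A = V * diagonal hA.eigenvalues * Vᵀ := by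
  refine ⟨hA.eigenvectorUnitary, ?_, ?_⟩
  · have := (mem_unitaryGroup_iff').1 hA.eigenvectorUnitary.2
    simpa [star_eq_conjTranspose] using this
  · have := hA.spectral_theorem
    simpa [Unitary.conjStarAlgAut_apply, star_eq_conjTranspose, Function.comp_def] using this

theorem exists_pos_forall_le {l : Fin n → ℝ} (hl : l ∈ posCone n) : ∃ δ > 0, ∀ i, δ ≤ l i := by
  have h0 : ∀ i, 0 ≤ (l i)⁻¹ := fun i => (inv_pos.2 (hl i)).le
  have h1 : 0 ≤ ∑ i, (l i)⁻¹ := Finset.sum_nonneg fun i _ => h0 i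
  refine ⟨(1 + ∑ i, (l i)⁻¹)⁻¹, by positivity, fun i => ?_⟩
  rw [inv_le_comm₀ (by positivity) (hl i)]
  have := Finset.single_le_sum (fun i _ => h0 i) (Finset.mem_univ i)
  linarith

theorem abs_le_one_of_orthogonal {V : Matrix (Fin n) (Fin n) ℝ} (hV : Vᵀ * V = 1) (i j : Fin n) :
    |V i j| ≤ 1 := by
  have h : ∑ k, V k j * V k j = 1 := by
    have := congrFun (congrFun hV j) j
    simpa [mul_apply] using this
  have h1 := Finset.single_le_sum (fun k _ => mul_self_nonneg (V k j)) (Finset.mem_univ i)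
  rw [h] at h1
  rw [← sq_le_one_iff_abs_le_one]
  nlinarith

theorem diagonal_eq_of_orthogonal {U A : Matrix (Fin n) (Fin n) ℝ} {l : Fin n → ℝ}
    (hU : Uᵀ * U = 1) (hA : A = U * diagonal l * Uᵀ) : Uᵀ * A * U = diagonal l := by
  rw [hA]
  calc Uᵀ * (U * diagonal l * Uᵀ) * U = (Uᵀ * U) * diagonal l * (Uᵀ * U) := by
        simp only [Matrix.mul_assoc]
    _ = _ := by rw [hU, Matrix.one_mul, Matrix.mul_one]

/-- Small symmetric perturbations of positive matrices are positive. -/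
theorem eventually_eigenvalues_mem_posCone {U A S : Matrix (Fin n) (Fin n) ℝ} {l : Fin n → ℝ}
    (hl : l ∈ posCone n) (hU : Uᵀ * U = 1) (hA : A = U * diagonal l * Uᵀ) :
    ∀ᶠ t : ℝ in nhds 0, ∀ (m : Fin n → ℝ) (V : Matrix (Fin n) (Fin n) ℝ), Vᵀ * V = 1 →
      A + t • S = V * diagonal m * Vᵀ → m ∈ posCone n := by
  obtain ⟨δ, hδ, hδl⟩ := exists_pos_forall_le hl
  set C := ∑ i, ∑ k, |S i k| with hC
  have hC0 : 0 ≤ C := Finset.sum_nonneg fun i _ => Finset.sum_nonneg fun k _ => abs_nonneg _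
  have hsmall : ∀ᶠ t : ℝ in nhds 0, |t| * C < δ := by
    have : Filter.Tendsto (fun t : ℝ => |t| * C) (nhds 0) (nhds (|0| * C)) :=
      (continuous_abs.mul continuous_const).tendsto 0
    rw [abs_zero, zero_mul] at this
    exact this.eventually_lt_const hδ
  filter_upwards [hsmall] with t ht m V hV hB j
  have h1 := diagonal_eq_of_orthogonal hV hB
  have h2 : m j = (Vᵀ * A * V) j j + t * (Vᵀ * S * V) j j := by
    have := congrFun (congrFun h1 j) j
    rw [diagonal_apply_eq] at this
    rw [← this, Matrix.mul_add, Matrix.add_mul, Matrix.add_apply, Matrix.mul_smul, Matrix.smul_mul,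
      Matrix.smul_apply, smul_eq_mul]
  have h3 : δ ≤ (Vᵀ * A * V) j j := by
    set W := Uᵀ * V with hW
    have hW1 : Wᵀ * W = 1 := by
      rw [hW, transpose_mul, transpose_transpose, Matrix.mul_assoc, ← Matrix.mul_assoc U,
        mul_eq_one_comm.1 hU, Matrix.one_mul, hV]
    have h4 : Vᵀ * A * V = Wᵀ * diagonal l * W := by
      rw [hA, hW, transpose_mul, transpose_transpose]; simp only [Matrix.mul_assoc]
    have h5 : ∑ k, W k j * W k j = 1 := by
      have := congrFun (congrFun hW1 j) j
      simpa [mul_apply] using this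
    rw [h4, mul_apply]
    simp only [mul_diagonal, transpose_apply]
    calc δ = ∑ k, (W k j * W k j) * δ := by rw [← Finset.sum_mul, h5, one_mul]
      _ ≤ ∑ k, W k j * l k * W k j := Finset.sum_le_sum fun k _ => by
        nlinarith [mul_le_mul_of_nonneg_left (hδl k) (mul_self_nonneg (W k j))]
  have h4 : |(Vᵀ * S * V) j j| ≤ C := by
    simp only [mul_apply, transpose_apply, Finset.sum_mul]
    rw [Finset.sum_comm]
    refine (Finset.abs_sum_le_sum_abs _ _).trans (Finset.sum_le_sum fun i _ => ?_)
    refine (Finset.abs_sum_le_sum_abs _ _).trans (Finset.sum_le_sum fun k _ => ?_)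
    rw [abs_mul, abs_mul]
    have h6 := abs_le_one_of_orthogonal hV i j
    have h7 := abs_le_one_of_orthogonal hV k j
    calc |V i j| * |S i k| * |V k j| ≤ 1 * |S i k| * 1 := by gcongr
      _ = _ := by ring
  have h5 : |t * (Vᵀ * S * V) j j| < δ := by
    rw [abs_mul]
    exact (mul_le_mul_of_nonneg_left h4 (abs_nonneg t)).trans_lt ht
  rw [h2]
  have := (abs_lt.1 h5).1
  linarith

theorem charpoly_of_orthogonal {U A : Matrix (Fin n) (Fin n) ℝ} {l : Fin n → ℝ}
    (hU : Uᵀ * U = 1) (hA : A = U * diagonal l * Uᵀ) :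
    A.charpoly = ∏ i, (Polynomial.X - Polynomial.C (l i)) := by
  rw [hA, charpoly_mul_comm, ← Matrix.mul_assoc, hU, Matrix.one_mul, charpoly_diagonal]

theorem isHermitian_of_orthogonal {U A : Matrix (Fin n) (Fin n) ℝ} {l : Fin n → ℝ}
    (hA : A = U * diagonal l * Uᵀ) : A.IsHermitian := by
  rw [hA, IsHermitian, conjTranspose_eq_transpose_of_trivial]
  simp [transpose_mul, Matrix.mul_assoc]

theorem inv_of_orthogonal {V B : Matrix (Fin n) (Fin n) ℝ} {m : Fin n → ℝ} (hm : m ∈ posCone n)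
    (hV : Vᵀ * V = 1) (hB : B = V * diagonal m * Vᵀ) :
    B⁻¹ = V * diagonal (fun i => (m i)⁻¹) * Vᵀ := by
  refine inv_eq_right_inv ?_
  rw [hB]
  calc V * diagonal m * Vᵀ * (V * diagonal (fun i => (m i)⁻¹) * Vᵀ)
      = V * diagonal m * (Vᵀ * V) * (diagonal (fun i => (m i)⁻¹) * Vᵀ) := by
        simp only [Matrix.mul_assoc]
    _ = V * (diagonal m * diagonal (fun i => (m i)⁻¹)) * Vᵀ := by
        rw [hV, Matrix.mul_one]; simp only [Matrix.mul_assoc]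
    _ = 1 := by
        rw [diagonal_mul_diagonal]
        have : (fun i => m i * (m i)⁻¹) = fun _ => 1 :=
          funext fun i => mul_inv_cancel₀ (hm i).ne'
        rw [this, diagonal_one, Matrix.mul_one, mul_eq_one_comm.1 hV]

namespace IsCurvatureFunction

variable {f : (Fin n → ℝ) → ℝ} (hf : IsCurvatureFunction f)

include hf

/-- Concavity of f bounds F(A + tS) above by an affine function of t; concavity of the dual, applied
to the inverse matrix, bounds it below by a differentiable function. Both bounds touch at t = 0, so
no regularity of eigenvalues or eigenvectors is needed. -/
theorem hasDerivAt_spectralFn {U A S : Matrix (Fin n) (Fin n) ℝ} {l : Fin n → ℝ}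
    (hl : l ∈ posCone n) (hU : Uᵀ * U = 1) (hA : A = U * diagonal l * Uᵀ) (hS : S.IsHermitian) :
    HasDerivAt (fun t : ℝ => spectralFn f (A + t • S))
      (∑ i, fPartial f i l * (Uᵀ * S * U) i i) 0 := by
  have hAH := isHermitian_of_orthogonal hA
  have hH : ∀ t : ℝ, (A + t • S).IsHermitian := fun t => by
    have : (t • S).IsHermitian := by
      rw [IsHermitian, conjTranspose_smul, hS.eq]; simp
    exact hAH.add this
  have hdiag := diagonal_eq_of_orthogonal hU hA
  have hl' := inv_mem_posCone hl
  have hfl := hf.pos l hl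
  have hev := eventually_eigenvalues_mem_posCone (S := S) hl hU hA
  set f' : (Fin n → ℝ) → ℝ := fun m => (f fun i => (m i)⁻¹)⁻¹ with hf'
  set l' : Fin n → ℝ := fun i => (l i)⁻¹ with hl'def
  -- The upper tangent bound for the dual function at the inverse matrix; its reciprocal is the
  -- lower bound for F.
  set D : ℝ → ℝ := fun t =>
    f' l' + ∑ i, fPartial f' i l' * ((Uᵀ * (A + t • S)⁻¹ * U) i i - l' i) with hD
  have hAinv : A⁻¹ = U * diagonal l' * Uᵀ := inv_of_orthogonal hl hU hA
  have hD0 : D 0 = (f l)⁻¹ := by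
    have : Uᵀ * A⁻¹ * U = diagonal l' := diagonal_eq_of_orthogonal hU hAinv
    simp [hD, this, hf', hl'def]
  have hdet : A.det ≠ 0 := by
    rw [hA, det_mul, det_mul, det_diagonal, mul_right_comm, ← det_mul, mul_eq_one_comm.1 hU,
      det_one, one_mul]
    exact Finset.prod_ne_zero_iff.2 fun i _ => (hl i).ne'
  have hDd : DifferentiableAt ℝ D 0 := by
    have h1 : ∀ i j, DifferentiableAt ℝ (fun t : ℝ => (A + t • S)⁻¹ i j) 0 := fun i j =>
      differentiableAt_inv_apply (M := fun t : ℝ => A + t • S)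
        (fun i j => by simp only [Matrix.add_apply, Matrix.smul_apply, smul_eq_mul]; fun_prop)
        (by simpa using hdet) i j
    simp only [hD, mul_apply, Finset.sum_mul]
    refine DifferentiableAt.const_add _ (DifferentiableAt.fun_sum fun i _ =>
      DifferentiableAt.const_mul (DifferentiableAt.sub_const (DifferentiableAt.fun_sum fun j _ =>
        DifferentiableAt.fun_sum fun k _ => ((h1 k j).const_mul _).mul_const _) _) _)
  refine HasDerivAt.of_squeeze (l := fun t => (D t)⁻¹)
    (r := fun t => f l + t * ∑ i, fPartial f i l * (Uᵀ * S * U) i i) ?_ ?_ ?_ ?_ ?_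
  · simpa using ((hasDerivAt_id (0 : ℝ)).mul_const
      (∑ i, fPartial f i l * (Uᵀ * S * U) i i)).const_add (f l)
  · exact hDd.inv (by rw [hD0]; positivity)
  · filter_upwards [hev] with t ht
    obtain ⟨V, hV, hB⟩ := exists_orthogonal_diagonalization (hH t)
    have hm := ht _ V hV hB
    have h1 := le_add_sum_of_concave_symmetric hf.dual_concave hf.dual_symmetric hl'
      (inv_mem_posCone hm) (hf.hasFDerivAt_dual hl').choose_spec.1.differentiableAt hU hV
      (inv_of_orthogonal hm hV hB)
    simp only [inv_inv] at h1
    rw [spectralFn, dif_pos (hH t)]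
    have hp := hf.pos _ hm
    exact inv_le_of_inv_le₀ hp h1
  · filter_upwards [hev] with t ht
    obtain ⟨V, hV, hB⟩ := exists_orthogonal_diagonalization (hH t)
    have hm := ht _ V hV hB
    have h1 := le_add_sum_of_concave_symmetric hf.concave hf.symmetric hl hm
      (hf.differentiableAt hl) hU hV hB
    rw [spectralFn, dif_pos (hH t)]
    refine h1.trans (le_of_eq ?_)
    rw [Finset.mul_sum]
    congr 1
    refine Finset.sum_congr rfl fun i _ => ?_
    rw [Matrix.mul_add, Matrix.add_mul, Matrix.add_apply, hdiag, Matrix.mul_smul, Matrix.smul_mul,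
      Matrix.smul_apply, smul_eq_mul, diagonal_apply_eq]
    ring
  · simp [hD0]

theorem spectralPartial_eq {U A : Matrix (Fin n) (Fin n) ℝ} {l : Fin n → ℝ}
    (hl : l ∈ posCone n) (hU : Uᵀ * U = 1) (hA : A = U * diagonal l * Uᵀ) (i j : Fin n) :
    spectralPartial f A i j = ∑ k, fPartial f k l * (U i k * U j k) := by
  have hS : ((1 / 2 : ℝ) • (single i j (1 : ℝ) + single j i (1 : ℝ))).IsHermitian := by
    rw [IsHermitian, conjTranspose_eq_transpose_of_trivial, transpose_smul, transpose_add,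
      transpose_single, transpose_single, add_comm]
  have h := (hf.hasDerivAt_spectralFn hl hU hA hS).deriv
  rw [spectralPartial, lineDeriv, h]
  refine Finset.sum_congr rfl fun k _ => ?_
  congr 1
  rw [Matrix.mul_smul, Matrix.smul_mul, Matrix.smul_apply, smul_eq_mul, Matrix.mul_add, Matrix.add_mul,
    Matrix.add_apply]
  have h1 : ∀ a b : Fin n, (Uᵀ * single a b (1 : ℝ) * U) k k = U a k * U b k := by
    intro a b
    rw [mul_apply, Finset.sum_eq_single b]
    · rw [mul_single_apply_same]; simp
    · intro c _ hc
      rw [mul_single_apply_of_ne _ _ _ _ _ hc, zero_mul]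
    · simp
  rw [h1, h1]
  ring

end IsCurvatureFunction


/-! ### The graph in coordinates -/

/-- The signature `(1, …, 1, -1)` of the ambient metric. -/
def signature (n : ℕ) (a : Fin (n + 1)) : ℝ := if a = Fin.last n then -1 else 1

section Ambient

variable {n : ℕ}

theorem signature_mul_self (a : Fin (n + 1)) : signature n a * signature n a = 1 := by
  unfold signature; split_ifs <;> norm_num

theorem ambientMetric_eq (p : EuclideanSpace ℝ (Fin (n + 1))) :
    ambientMetric n p = diagonal fun a => signature n a / (p (Fin.last n)) ^ 2 := by
  unfold ambientMetric signature
  congr 1; ext a; split_ifs <;> rfl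

theorem ambientMetric_inv {p : EuclideanSpace ℝ (Fin (n + 1))} (hp : p (Fin.last n) ≠ 0) :
    (ambientMetric n p)⁻¹ = diagonal fun a => signature n a * (p (Fin.last n)) ^ 2 := by
  refine inv_eq_right_inv ?_
  rw [ambientMetric_eq, diagonal_mul_diagonal, ← diagonal_one]
  congr 1; ext a
  field_simp
  rw [pow_two, signature_mul_self]

theorem pd_ambientMetric {p : EuclideanSpace ℝ (Fin (n + 1))} (hp : p (Fin.last n) ≠ 0)
    (c a b : Fin (n + 1)) :
    pd c (fun y => ambientMetric n y a b) p =
      diagonal (signature n) a b * (-2 / (p (Fin.last n)) ^ 3) *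
        (if c = Fin.last n then 1 else 0) := by
  have h1 : (fun y : EuclideanSpace ℝ (Fin (n + 1)) => ambientMetric n y a b) =
      fun y => diagonal (signature n) a b * ((y (Fin.last n)) ^ 2)⁻¹ := by
    ext y
    rw [ambientMetric_eq]
    by_cases h : a = b
    · subst h; simp [div_eq_mul_inv]
    · simp [h]
  have h2 : HasFDerivAt (fun y : EuclideanSpace ℝ (Fin (n + 1)) => y (Fin.last n))
      (EuclideanSpace.proj (Fin.last n) : EuclideanSpace ℝ (Fin (n + 1)) →L[ℝ] ℝ) p :=
    (EuclideanSpace.proj (Fin.last n) : EuclideanSpace ℝ (Fin (n + 1)) →L[ℝ] ℝ).hasFDerivAt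
  have h3 := ((hasDerivAt_pow 2 (p (Fin.last n))).inv (pow_ne_zero 2 hp)).comp_hasFDerivAt p h2
  have h4 := h3.const_mul (diagonal (signature n) a b)
  rw [pd, h1]
  erw [h4.fderiv]
  by_cases hc : c = Fin.last n
  · subst hc
    simp
    left
    field_simp
  · simp [hc, Ne.symm hc]

/-- The ambient metric is conformal to the flat one with factor depending only on the last
coordinate, so its connection is the flat one plus terms in d log x_{n+1}. -/
theorem sum_christoffel_ambientMetric {p : EuclideanSpace ℝ (Fin (n + 1))}
    (hp : p (Fin.last n) ≠ 0) (v w : EuclideanSpace ℝ (Fin (n + 1))) (c : Fin (n + 1)) :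
    ∑ a, ∑ b, christoffel (ambientMetric n) p c a b * v a * w b =
      -(1 / p (Fin.last n)) * (v (Fin.last n) * w c + v c * w (Fin.last n) -
        if c = Fin.last n then signature n c * ∑ a, signature n a * v a * w a else 0) := by
  set t := p (Fin.last n) with ht
  have h1 : ∀ a b, christoffel (ambientMetric n) p c a b =
      -(1 / t) * signature n c * (diagonal (signature n) b c * (if a = Fin.last n then 1 else 0) +
        diagonal (signature n) a c * (if b = Fin.last n then 1 else 0) -
        diagonal (signature n) a b * (if c = Fin.last n then 1 else 0)) := by
    intro a b
    rw [christoffel, ambientMetric_inv hp, Finset.sum_eq_single c]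
    · simp only [pd_ambientMetric hp, ← ht, diagonal_apply_eq]
      field_simp
      ring
    · intro l _ hl
      rw [diagonal_apply_ne' _ hl, zero_mul]
    · simp
  have h2 : ∀ a b, christoffel (ambientMetric n) p c a b * v a * w b =
      -(1 / t) * ((signature n c * (if a = Fin.last n then v a else 0)) *
          (diagonal (signature n) b c * w b) +
        (signature n c * (diagonal (signature n) a c * v a)) *
          (if b = Fin.last n then w b else 0) -
        (if c = Fin.last n then signature n c * (v a * (diagonal (signature n) a b * w b))
          else 0)) := by
    intro a b
    rw [h1]
    split_ifs <;> ring
  have h3 : ∀ x : Fin (n + 1), ∑ b, diagonal (signature n) b x * w b = signature n x * w x := by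
    intro x
    rw [Finset.sum_eq_single x] <;> simp +contextual [diagonal_apply_ne]
  have h3' : ∀ x : Fin (n + 1), ∑ b, diagonal (signature n) b x * v b = signature n x * v x := by
    intro x
    rw [Finset.sum_eq_single x] <;> simp +contextual [diagonal_apply_ne]
  have h4 : ∀ x : Fin (n + 1), ∑ b, diagonal (signature n) x b * w b = signature n x * w x := by
    intro x
    rw [Finset.sum_eq_single x] <;> simp +contextual [diagonal_apply_ne']
  simp only [h2, ← Finset.mul_sum, Finset.sum_sub_distrib, Finset.sum_add_distrib, h3,
    Finset.sum_ite_eq', Finset.mem_univ, if_true, ← Finset.sum_mul, h3']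
  have e1 := signature_mul_self (n := n) c
  congr 1
  have h5 : ∑ a, ∑ b, (if c = Fin.last n then
      signature n c * (v a * (diagonal (signature n) a b * w b)) else 0) =
      if c = Fin.last n then signature n c * ∑ a, signature n a * v a * w a else 0 := by
    split_ifs
    · simp only [← Finset.mul_sum, h4]
      congr 1
      exact Finset.sum_congr rfl fun a _ => by ring
    · simp
  rw [h5]
  linear_combination (v (Fin.last n) * w c + v c * w (Fin.last n)) * e1

theorem ambientInner_eq (p v w : EuclideanSpace ℝ (Fin (n + 1))) :
    ambientInner p v w =
      (∑ k : Fin n, v k.castSucc * w k.castSucc - v (Fin.last n) * w (Fin.last n)) /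
        (p (Fin.last n)) ^ 2 := by
  have h1 : ambientInner p v w = ∑ a, signature n a / (p (Fin.last n)) ^ 2 * v a * w a := by
    refine Finset.sum_congr rfl fun a _ => ?_
    rw [ambientMetric_eq, Finset.sum_eq_single a] <;> simp +contextual [diagonal_apply_ne']
  rw [h1, Fin.sum_univ_castSucc, sub_div, Finset.sum_div, sub_eq_add_neg]
  congr 1
  · refine Finset.sum_congr rfl fun k _ => ?_
    simp [signature]
    ring
  · simp [signature]
    ring

end Ambient

section Graph

variable {n : ℕ} {u : EuclideanSpace ℝ (Fin n) → ℝ} {x : EuclideanSpace ℝ (Fin n)}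

@[simp] theorem graphMap_castSucc (u : EuclideanSpace ℝ (Fin n) → ℝ)
    (x : EuclideanSpace ℝ (Fin n)) (k : Fin n) : graphMap u x k.castSucc = x k := by
  simp [graphMap]

@[simp] theorem graphMap_last (u : EuclideanSpace ℝ (Fin n) → ℝ)
    (x : EuclideanSpace ℝ (Fin n)) : graphMap u x (Fin.last n) = u x := by
  simp [graphMap]

theorem fderiv_eq_sum_pd (φ : EuclideanSpace ℝ (Fin n) → ℝ) (x v : EuclideanSpace ℝ (Fin n)) :
    fderiv ℝ φ x v = ∑ i, v i * pd i φ x := by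
  have h : v = ∑ i, v i • EuclideanSpace.single i (1 : ℝ) := by
    ext j
    simp [Pi.single_apply]
  conv_lhs => rw [h]
  simp [pd]

theorem hasFDerivAt_coord (k : Fin n) (x : EuclideanSpace ℝ (Fin n)) :
    HasFDerivAt (fun y : EuclideanSpace ℝ (Fin n) => y k)
      (EuclideanSpace.proj k : EuclideanSpace ℝ (Fin n) →L[ℝ] ℝ) x :=
  (EuclideanSpace.proj k : EuclideanSpace ℝ (Fin n) →L[ℝ] ℝ).hasFDerivAt

theorem pd_coord (i k : Fin n) (x : EuclideanSpace ℝ (Fin n)) :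
    pd i (fun y : EuclideanSpace ℝ (Fin n) => y k) x = if k = i then 1 else 0 := by
  rw [pd, (hasFDerivAt_coord k x).fderiv]
  simp

theorem pd_graphMap_apply (hu : DifferentiableAt ℝ u x) (i : Fin n) (c : Fin (n + 1)) :
    pd i (graphMap u) x c = pd i (fun y => graphMap u y c) x := by
  have hd : DifferentiableAt ℝ (graphMap u) x := by
    rw [differentiableAt_euclidean]
    intro c
    refine Fin.lastCases ?_ (fun k => ?_) c
    · simpa using hu
    · simpa using (hasFDerivAt_coord k x).differentiableAt
  have h := ((EuclideanSpace.proj c : EuclideanSpace ℝ (Fin (n + 1)) →L[ℝ] ℝ).hasFDerivAt).comp x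
    hd.hasFDerivAt
  rw [pd, pd]
  erw [h.fderiv]
  rfl

theorem pd_graphMap_castSucc (hu : DifferentiableAt ℝ u x) (i k : Fin n) :
    pd i (graphMap u) x k.castSucc = if k = i then 1 else 0 := by
  rw [pd_graphMap_apply hu]
  simp only [graphMap_castSucc, pd_coord]

theorem pd_graphMap_last (hu : DifferentiableAt ℝ u x) (i : Fin n) :
    pd i (graphMap u) x (Fin.last n) = pd i u x := by
  rw [pd_graphMap_apply hu]
  simp only [graphMap_last]

theorem inducedMetric_apply (hu : DifferentiableAt ℝ u x) (i j : Fin n) :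
    inducedMetric u x i j = ((if i = j then 1 else 0) - pd i u x * pd j u x) / u x ^ 2 := by
  simp only [inducedMetric, of_apply, ambientInner_eq, pd_graphMap_castSucc hu,
    pd_graphMap_last hu, graphMap_last]
  simp [eq_comm]

theorem nuVert_eq (u : EuclideanSpace ℝ (Fin n) → ℝ) (x : EuclideanSpace ℝ (Fin n)) :
    nuVert u x = 1 / Real.sqrt (1 - gradSq u x) := by
  simp [nuVert, minkowskiNormal]

theorem secondFundForm_apply (hu : ∀ᶠ y in nhds x, DifferentiableAt ℝ u y) (hpos : 0 < u x)
    (i j : Fin n) :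
    secondFundForm u x i j =
      ((if i = j then 1 else 0) - pd i u x * pd j u x - u x * pd i (pd j u) x) /
        (u x ^ 2 * Real.sqrt (1 - gradSq u x)) := by
  have hux := hu.self_of_nhds
  have hlast : graphMap u x (Fin.last n) ≠ 0 := by simpa using hpos.ne'
  have hc : ∀ k : Fin n, covDeriv u x i j k.castSucc =
      -(1 / u x) * (pd i u x * (if k = j then 1 else 0) + (if k = i then 1 else 0) * pd j u x) := by
    intro k
    have h1 : pd i (fun y => pd j (graphMap u) y k.castSucc) x = 0 := by
      have : (fun y => pd j (graphMap u) y k.castSucc) =ᶠ[nhds x]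
          fun _ => (if k = j then (1 : ℝ) else 0) := by
        filter_upwards [hu] with y hy using pd_graphMap_castSucc hy j k
      rw [pd, this.fderiv_eq]
      simp
    simp only [covDeriv]
    rw [h1, sum_christoffel_ambientMetric hlast]
    simp only [pd_graphMap_castSucc hux, pd_graphMap_last hux, graphMap_last,
      if_neg (Fin.castSucc_lt_last k).ne]
    ring
  have hl : covDeriv u x i j (Fin.last n) = pd i (pd j u) x -
      (1 / u x) * (pd i u x * pd j u x + if i = j then 1 else 0) := by
    have h1 : pd i (fun y => pd j (graphMap u) y (Fin.last n)) x = pd i (pd j u) x := by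
      have : (fun y => pd j (graphMap u) y (Fin.last n)) =ᶠ[nhds x] pd j u := by
        filter_upwards [hu] with y hy using pd_graphMap_last hy j
      rw [pd, this.fderiv_eq]
      rfl
    simp only [covDeriv]
    rw [h1, sum_christoffel_ambientMetric hlast, Fin.sum_univ_castSucc]
    simp only [pd_graphMap_castSucc hux, pd_graphMap_last hux, graphMap_last,
      signature, if_neg (Fin.castSucc_lt_last _).ne, if_true]
    simp [eq_comm]
    ring
  have hn : ∀ k : Fin n, unitNormal u x k.castSucc =
      u x * (pd k u x / Real.sqrt (1 - gradSq u x)) := fun k => by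
    simp [unitNormal, minkowskiNormal]
  have hnl : unitNormal u x (Fin.last n) = u x * (1 / Real.sqrt (1 - gradSq u x)) := by
    simp [unitNormal, minkowskiNormal]
  simp only [secondFundForm, of_apply, ambientInner_eq, hc, hl, hn, hnl, graphMap_last]
  have hsum : ∑ k : Fin n, -(1 / u x) * (pd i u x * (if k = j then 1 else 0) +
      (if k = i then 1 else 0) * pd j u x) * (u x * (pd k u x / Real.sqrt (1 - gradSq u x))) =
      -2 * (pd i u x * pd j u x) / Real.sqrt (1 - gradSq u x) := by
    have : ∀ k : Fin n, -(1 / u x) * (pd i u x * (if k = j then 1 else 0) +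
      (if k = i then 1 else 0) * pd j u x) * (u x * (pd k u x / Real.sqrt (1 - gradSq u x))) =
      (if k = j then -(pd i u x * pd k u x) / Real.sqrt (1 - gradSq u x) else 0) +
      (if k = i then -(pd j u x * pd k u x) / Real.sqrt (1 - gradSq u x) else 0) := by
      intro k
      have := hpos.ne'
      split_ifs <;> field_simp <;> ring
    simp only [this, Finset.sum_add_distrib, Finset.sum_ite_eq', Finset.mem_univ, if_true]
    ring
  rw [hsum]
  -- Where the root vanishes, division by zero makes both sides 0.
  by_cases hw : Real.sqrt (1 - gradSq u x) = 0
  · simp [hw]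
  · have := hpos.ne'
    field_simp
    ring

end Graph


/-! ### Partial derivatives -/

section PartialDerivatives

variable {n : ℕ} {φ χ : EuclideanSpace ℝ (Fin n) → ℝ} {x : EuclideanSpace ℝ (Fin n)} {i : Fin n}

theorem pd_congr (h : φ =ᶠ[nhds x] χ) : pd i φ x = pd i χ x := by
  rw [pd, pd, h.fderiv_eq]

@[simp] theorem pd_const (c : ℝ) : pd i (fun _ => c) x = 0 := by simp [pd]

theorem pd_sub (h : DifferentiableAt ℝ φ x) (h' : DifferentiableAt ℝ χ x) :
    pd i (fun y => φ y - χ y) x = pd i φ x - pd i χ x := by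
  simp [pd, fderiv_fun_sub h h']

theorem pd_mul (h : DifferentiableAt ℝ φ x) (h' : DifferentiableAt ℝ χ x) :
    pd i (fun y => φ y * χ y) x = pd i φ x * χ x + φ x * pd i χ x := by
  simp [pd, fderiv_fun_mul h h']
  ring

theorem pd_const_mul (c : ℝ) (h : DifferentiableAt ℝ φ x) :
    pd i (fun y => c * φ y) x = c * pd i φ x := by
  simp [pd, fderiv_const_mul h]

theorem pd_sum {ι : Type*} {s : Finset ι} {φ : ι → EuclideanSpace ℝ (Fin n) → ℝ}
    (h : ∀ k ∈ s, DifferentiableAt ℝ (φ k) x) :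
    pd i (fun y => ∑ k ∈ s, φ k y) x = ∑ k ∈ s, pd i (φ k) x := by
  simp [pd, fderiv_fun_sum h]

theorem pd_comp {F : ℝ → ℝ} {d : ℝ} (hF : HasDerivAt F d (φ x)) (h : DifferentiableAt ℝ φ x) :
    pd i (fun y => F (φ y)) x = d * pd i φ x := by
  have := (hF.comp_hasFDerivAt x h.hasFDerivAt).fderiv
  simp only [pd]
  rw [show (fun y => F (φ y)) = F ∘ φ from rfl, this]
  simp

theorem contDiffAt_pd (h : ContDiffAt ℝ ∞ φ x) : ContDiffAt ℝ ∞ (pd i φ) x :=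
  (h.fderiv_right (m := ∞) (by simp)).clm_apply contDiffAt_const

theorem pd_comm (h : ContDiffAt ℝ ∞ φ x) (i j : Fin n) :
    pd i (pd j φ) x = pd j (pd i φ) x := by
  have hd : DifferentiableAt ℝ (fderiv ℝ φ) x :=
    (h.fderiv_right (m := ∞) (by simp)).differentiableAt (by simp)
  have h1 : ∀ i j, pd i (pd j φ) x =
      fderiv ℝ (fderiv ℝ φ) x (EuclideanSpace.single i 1) (EuclideanSpace.single j 1) := by
    intro i j
    have h2 := hd.hasFDerivAt.clm_apply
      (hasFDerivAt_const (EuclideanSpace.single j (1 : ℝ)) x)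
    have h3 : pd j φ = fun y => fderiv ℝ φ y (EuclideanSpace.single j 1) := rfl
    rw [pd, h3, h2.fderiv]
    simp
  rw [h1, h1]
  exact (h.isSymmSndFDerivAt (by simp only [minSmoothness_of_isRCLikeNormedField]; exact WithTop.coe_le_coe.2 (le_top (a := (2 : ℕ∞))))).eq _ _

end PartialDerivatives

/-! ### Frames -/

section Frames

variable {n : ℕ} {u : EuclideanSpace ℝ (Fin n) → ℝ} {x : EuclideanSpace ℝ (Fin n)}

/-- `u` is smooth, positive and spacelike near `x`. -/
structure RegularNear (u : EuclideanSpace ℝ (Fin n) → ℝ) (x : EuclideanSpace ℝ (Fin n)) :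
    Prop where
  smooth : ∀ᶠ y in nhds x, ContDiffAt ℝ ∞ u y
  pos : ∀ᶠ y in nhds x, 0 < u y
  spacelike : ∀ᶠ y in nhds x, gradSq u y < 1

theorem IsSolution.regularNear {f : (Fin n → ℝ) → ℝ} {σ : ℝ} {Ω : Set (EuclideanSpace ℝ (Fin n))}
    (h : IsSolution f σ Ω u) (hΩ : IsOpen Ω) (hx : x ∈ Ω) : RegularNear u x where
  smooth := by
    filter_upwards [hΩ.mem_nhds hx] with y hy using h.smooth.contDiffAt (hΩ.mem_nhds hy)
  pos := by filter_upwards [hΩ.mem_nhds hx] with y hy using h.pos y hy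
  spacelike := by filter_upwards [hΩ.mem_nhds hx] with y hy using h.spacelike y hy

namespace RegularNear

theorem eventually (h : RegularNear u x) : ∀ᶠ y in nhds x, RegularNear u y := by
  filter_upwards [h.smooth.eventually_nhds, h.pos.eventually_nhds, h.spacelike.eventually_nhds]
    with y h1 h2 h3 using ⟨h1, h2, h3⟩

variable (h : RegularNear u x)

include h

theorem contDiffAt : ContDiffAt ℝ ∞ u x := h.smooth.self_of_nhds

theorem eventually_differentiableAt : ∀ᶠ y in nhds x, DifferentiableAt ℝ u y :=
  h.smooth.mono fun _ hy => hy.differentiableAt (by simp)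

theorem differentiableAt : DifferentiableAt ℝ u x := h.eventually_differentiableAt.self_of_nhds

theorem pos_self : 0 < u x := h.pos.self_of_nhds

theorem spacelike_self : gradSq u x < 1 := h.spacelike.self_of_nhds

theorem contDiffAt_gradSq : ContDiffAt ℝ ∞ (gradSq u) x := by
  unfold gradSq
  exact ContDiffAt.sum fun i _ => (contDiffAt_pd h.contDiffAt).pow 2

theorem sqrt_pos : 0 < Real.sqrt (1 - gradSq u x) :=
  Real.sqrt_pos.2 (sub_pos.2 h.spacelike_self)

theorem contDiffAt_sqrt : ContDiffAt ℝ ∞ (fun y => Real.sqrt (1 - gradSq u y)) x :=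
  (contDiffAt_const.sub h.contDiffAt_gradSq).sqrt (sub_pos.2 h.spacelike_self).ne'

theorem inducedMetric_apply (i j : Fin n) :
    inducedMetric u x i j = ((if i = j then 1 else 0) - pd i u x * pd j u x) / u x ^ 2 :=
  SteadyState.inducedMetric_apply h.differentiableAt i j

theorem secondFundForm_apply (i j : Fin n) :
    secondFundForm u x i j =
      ((if i = j then 1 else 0) - pd i u x * pd j u x - u x * pd i (pd j u) x) /
        (u x ^ 2 * Real.sqrt (1 - gradSq u x)) :=
  SteadyState.secondFundForm_apply h.eventually_differentiableAt h.pos_self i j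

theorem transpose_inducedMetric : (inducedMetric u x)ᵀ = inducedMetric u x := by
  ext i j
  simp only [transpose_apply, h.inducedMetric_apply, eq_comm (a := i), mul_comm]

theorem transpose_secondFundForm : (secondFundForm u x)ᵀ = secondFundForm u x := by
  ext i j
  simp only [transpose_apply, h.secondFundForm_apply, eq_comm (a := i),
    pd_comm h.contDiffAt i j, mul_comm (pd i u x)]

theorem differentiableAt_inducedMetric (i j : Fin n) :
    DifferentiableAt ℝ (fun y => inducedMetric u y i j) x := by
  have h1 : (fun y => inducedMetric u y i j) =ᶠ[nhds x] fun y =>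
      ((if i = j then 1 else 0) - pd i u y * pd j u y) / u y ^ 2 := by
    filter_upwards [h.eventually] with y hy using hy.inducedMetric_apply i j
  refine DifferentiableAt.congr_of_eventuallyEq ?_ h1
  refine ContDiffAt.differentiableAt (n := ∞) ?_ (by simp)
  exact (contDiffAt_const.sub ((contDiffAt_pd h.contDiffAt).mul (contDiffAt_pd h.contDiffAt))).div
    (h.contDiffAt.pow 2) (pow_ne_zero 2 h.pos_self.ne')

theorem differentiableAt_secondFundForm (i j : Fin n) :
    DifferentiableAt ℝ (fun y => secondFundForm u y i j) x := by
  have h1 : (fun y => secondFundForm u y i j) =ᶠ[nhds x] fun y =>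
      ((if i = j then 1 else 0) - pd i u y * pd j u y - u y * pd i (pd j u) y) /
        (u y ^ 2 * Real.sqrt (1 - gradSq u y)) := by
    filter_upwards [h.eventually] with y hy using hy.secondFundForm_apply i j
  refine DifferentiableAt.congr_of_eventuallyEq ?_ h1
  refine ContDiffAt.differentiableAt (n := ∞) ?_ (by simp)
  refine ContDiffAt.div ?_ ((h.contDiffAt.pow 2).mul h.contDiffAt_sqrt)
    (mul_pos (pow_pos h.pos_self 2) h.sqrt_pos).ne'
  exact (contDiffAt_const.sub ((contDiffAt_pd h.contDiffAt).mul
    (contDiffAt_pd h.contDiffAt))).sub (h.contDiffAt.mul (contDiffAt_pd (contDiffAt_pd h.contDiffAt)))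

end RegularNear

/-- A smooth orthonormal frame of the graph: `u` times the inverse square root of
`1 - ∇u ⊗ ∇u`. -/
noncomputable def orthFrame (u : EuclideanSpace ℝ (Fin n) → ℝ) (x : EuclideanSpace ℝ (Fin n)) :
    Matrix (Fin n) (Fin n) ℝ :=
  Matrix.of fun i j => u x * ((if i = j then 1 else 0) + pd i u x * pd j u x /
    (Real.sqrt (1 - gradSq u x) * (1 + Real.sqrt (1 - gradSq u x))))

namespace RegularNear

variable (h : RegularNear u x)

include h

/-- With X = ∇u ⊗ ∇u and w² = 1 - |∇u|² one has X² = (1 - w²) X, so 1 + cX squares to the inverse of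
1 - X exactly when c = 1/(w(1 + w)). The explicit formula makes the frame visibly smooth in the base
point. -/
theorem isOrthonormalFrame_orthFrame : IsOrthonormalFrame u x (orthFrame u x) := by
  set w := Real.sqrt (1 - gradSq u x) with hw
  have hw0 : 0 < w := h.sqrt_pos
  have hw2 : w ^ 2 = 1 - gradSq u x := Real.sq_sqrt (sub_nonneg.2 h.spacelike_self.le)
  have hu := h.pos_self.ne'
  set p : Fin n → ℝ := fun i => pd i u x with hp
  set c : ℝ := 1 / (w * (1 + w)) with hc
  set X := vecMulVec p p with hX
  have hG : inducedMetric u x = (u x ^ 2)⁻¹ • (1 - X) := by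
    ext i j
    rw [h.inducedMetric_apply]
    simp [hX, hp, vecMulVec_apply, one_apply, div_eq_inv_mul]
  have hP : orthFrame u x = u x • (1 + c • X) := by
    ext i j
    simp [orthFrame, hX, hp, vecMulVec_apply, one_apply, hc, ← hw]
    left
    field_simp
  have hXX : X * X = (1 - w ^ 2) • X := by
    rw [hX, vecMulVec_mul_vecMulVec, hw2]
    simp [gradSq, dotProduct, hp, pow_two]
  have hXt : Xᵀ = X := by rw [hX, transpose_vecMulVec]
  rw [IsOrthonormalFrame, hG, hP, transpose_smul, transpose_add, transpose_smul, hXt,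
    transpose_one]
  have h1 : (1 + c • X) * (1 - X) * (1 + c • X) =
      1 + (2 * c - 1 + (1 - w ^ 2) * (c ^ 2 - 2 * c) - (1 - w ^ 2) ^ 2 * c ^ 2) • X := by
    simp only [Matrix.mul_add, Matrix.mul_sub, Matrix.add_mul, Matrix.sub_mul, Matrix.mul_one,
      Matrix.one_mul, Matrix.smul_mul, Matrix.mul_smul, hXX]
    module
  have h2 : 2 * c - 1 + (1 - w ^ 2) * (c ^ 2 - 2 * c) - (1 - w ^ 2) ^ 2 * c ^ 2 = 0 := by
    rw [hc]
    field_simp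
    ring
  rw [h2, zero_smul, add_zero] at h1
  simp only [Matrix.smul_mul, Matrix.mul_smul, smul_smul, h1]
  have : u x * ((u x ^ 2)⁻¹ * u x) = 1 := by field_simp
  rw [this, one_smul]

theorem differentiableAt_orthFrame (i j : Fin n) :
    DifferentiableAt ℝ (fun y => orthFrame u y i j) x := by
  refine ContDiffAt.differentiableAt (n := ∞) ?_ (by simp)
  simp only [orthFrame, of_apply]
  refine h.contDiffAt.mul (contDiffAt_const.add (ContDiffAt.div
    ((contDiffAt_pd h.contDiffAt).mul (contDiffAt_pd h.contDiffAt))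
    (h.contDiffAt_sqrt.mul (contDiffAt_const.add h.contDiffAt_sqrt)) ?_))
  have := h.sqrt_pos
  positivity

/-- Orthonormality gives g⁻¹ = P Pᵀ, so the matrix of h in the frame has the characteristic
polynomial of g⁻¹h. This fixes the eigenvalues only up to order; permuting the eigenvector columns
produces the prescribed list. -/
theorem exists_orthogonal_diagonalization {P : Matrix (Fin n) (Fin n) ℝ} {κ : Fin n → ℝ}
    (hP : IsOrthonormalFrame u x P) (hκ : IsPrincipalCurvatures u x κ) :
    ∃ U : Matrix (Fin n) (Fin n) ℝ, Uᵀ * U = 1 ∧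
      Pᵀ * secondFundForm u x * P = U * diagonal κ * Uᵀ := by
  have hA : (Pᵀ * secondFundForm u x * P).IsHermitian := by
    rw [IsHermitian, conjTranspose_eq_transpose_of_trivial, transpose_mul, transpose_mul,
      h.transpose_secondFundForm, transpose_transpose, Matrix.mul_assoc]
  obtain ⟨V, hV, hAV⟩ := SteadyState.exists_orthogonal_diagonalization hA
  have hinv : (inducedMetric u x)⁻¹ = P * Pᵀ := by
    refine inv_eq_left_inv ?_
    rw [Matrix.mul_assoc]
    exact mul_eq_one_comm.1 hP
  have hchar := charpoly_of_orthogonal hV hAV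
  have hchar' : (Pᵀ * secondFundForm u x * P).charpoly =
      ∏ i, (Polynomial.X - Polynomial.C (κ i)) := by
    rw [charpoly_mul_comm, ← Matrix.mul_assoc, ← hinv]
    exact hκ
  obtain ⟨π, hπ⟩ := exists_perm_of_prod_X_sub_C_eq (hchar.symm.trans hchar')
  refine ⟨V.submatrix id π.symm, ?_, ?_⟩
  · ext i j
    have := congrFun (congrFun hV (π.symm i)) (π.symm j)
    simpa [mul_apply, one_apply] using this
  · rw [hAV]
    ext i j
    rw [mul_apply, mul_apply, ← Equiv.sum_comp π.symm]
    refine Finset.sum_congr rfl fun k _ => ?_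
    rw [mul_diagonal, mul_diagonal, hπ]
    simp

end RegularNear

/-- The columns of `Q` form an orthonormal frame of principal directions with principal
curvatures `κ`. -/
structure IsPrincipalFrame (u : EuclideanSpace ℝ (Fin n) → ℝ) (x : EuclideanSpace ℝ (Fin n))
    (Q : Matrix (Fin n) (Fin n) ℝ) (κ : Fin n → ℝ) : Prop where
  orthonormal : Qᵀ * inducedMetric u x * Q = 1
  diagonal : Qᵀ * secondFundForm u x * Q = diagonal κ

theorem IsOrthonormalFrame.mul_orthogonal {P U : Matrix (Fin n) (Fin n) ℝ}
    (hP : IsOrthonormalFrame u x P) (hU : Uᵀ * U = 1) : IsOrthonormalFrame u x (P * U) := by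
  rw [IsOrthonormalFrame, transpose_mul]
  calc Uᵀ * Pᵀ * inducedMetric u x * (P * U) = Uᵀ * (Pᵀ * inducedMetric u x * P) * U := by
        simp only [Matrix.mul_assoc]
    _ = 1 := by rw [hP, Matrix.mul_one, hU]

theorem isPrincipalFrame_mul {P U : Matrix (Fin n) (Fin n) ℝ} {κ : Fin n → ℝ}
    (hP : IsOrthonormalFrame u x P) (hU : Uᵀ * U = 1)
    (hA : Pᵀ * secondFundForm u x * P = U * Matrix.diagonal κ * Uᵀ) :
    IsPrincipalFrame u x (P * U) κ := by
  refine ⟨hP.mul_orthogonal hU, ?_⟩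
  rw [← diagonal_eq_of_orthogonal hU hA, transpose_mul]
  simp only [Matrix.mul_assoc]

theorem RegularNear.exists_isPrincipalFrame (h : RegularNear u x) {κ : Fin n → ℝ}
    (hκ : IsPrincipalCurvatures u x κ) : ∃ Q, IsPrincipalFrame u x Q κ := by
  obtain ⟨U, hU, hA⟩ := h.exists_orthogonal_diagonalization h.isOrthonormalFrame_orthFrame hκ
  exact ⟨_, isPrincipalFrame_mul h.isOrthonormalFrame_orthFrame hU hA⟩

theorem IsSolution.curvature_of_isPrincipalCurvatures {f : (Fin n → ℝ) → ℝ} {σ : ℝ}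
    {Ω : Set (EuclideanSpace ℝ (Fin n))} (hf : IsCurvatureFunction f) (h : IsSolution f σ Ω u)
    (hx : x ∈ Ω) {κ : Fin n → ℝ} (hκ : IsPrincipalCurvatures u x κ) :
    κ ∈ posCone n ∧ f κ = σ := by
  obtain ⟨l, hl, hlp, hlσ⟩ := h.curvature x hx
  have := hf.eq_of_charpoly_eq hlp (hl.symm.trans hκ)
  exact ⟨this.1, this.2.trans hlσ⟩

namespace IsPrincipalFrame

variable {Q : Matrix (Fin n) (Fin n) ℝ} {κ : Fin n → ℝ} (hQ : IsPrincipalFrame u x Q κ)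

include hQ

theorem secondFundForm_mul :
    secondFundForm u x * Q = inducedMetric u x * Q * Matrix.diagonal κ := by
  have h1 : Q * (Qᵀ * inducedMetric u x) = 1 := mul_eq_one_comm.1 hQ.orthonormal
  have h2 : inducedMetric u x * Q * Qᵀ = 1 := by
    rw [Matrix.mul_assoc]
    have h3 : (Q * Qᵀ) * inducedMetric u x = 1 := by rw [Matrix.mul_assoc, h1]
    exact mul_eq_one_comm.1 h3
  calc secondFundForm u x * Q = inducedMetric u x * Q * Qᵀ * (secondFundForm u x * Q) := by
        rw [h2, Matrix.one_mul]
    _ = inducedMetric u x * Q * (Qᵀ * secondFundForm u x * Q) := by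
        simp only [Matrix.mul_assoc]
    _ = _ := by rw [hQ.diagonal]

theorem sum_secondFundForm_mul (i k : Fin n) :
    ∑ j, secondFundForm u x i j * Q j k = κ k * ∑ j, inducedMetric u x i j * Q j k := by
  have h := congrFun (congrFun hQ.secondFundForm_mul i) k
  rw [mul_apply, mul_diagonal, mul_apply] at h
  rw [h, mul_comm]

end IsPrincipalFrame

/-- The differentiated equation `f(κ) = σ`. -/
theorem IsSolution.sum_fPartial_mul_pd {f : (Fin n → ℝ) → ℝ} {σ : ℝ}
    {Ω : Set (EuclideanSpace ℝ (Fin n))} (hf : IsCurvatureFunction f) (h : IsSolution f σ Ω u)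
    (hΩ : IsOpen Ω) (hx : x ∈ Ω) {Q : Matrix (Fin n) (Fin n) ℝ} {κ : Fin n → ℝ}
    (hκ : IsPrincipalCurvatures u x κ) (hQ : IsPrincipalFrame u x Q κ) (l : Fin n) :
    ∑ k, fPartial f k κ * (∑ i, ∑ j, Q i k * pd l (fun y => secondFundForm u y i j) x * Q j k -
      κ k * ∑ i, ∑ j, Q i k * pd l (fun y => inducedMetric u y i j) x * Q j k) = 0 := by
  have hr := h.regularNear hΩ hx
  obtain ⟨hκ0, hκσ⟩ := h.curvature_of_isPrincipalCurvatures hf hx hκ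
  -- A constant rotation R of the smooth frame yields an orthonormal frame near x that equals the
  -- principal frame Q at x.
  set R := (orthFrame u x)⁻¹ * Q with hR
  have hPx := hr.isOrthonormalFrame_orthFrame
  have hPR : orthFrame u x * R = Q := by
    have hdet : IsUnit (orthFrame u x).det := by
      have := congrArg Matrix.det hPx
      rw [det_mul, det_one] at this
      exact IsUnit.of_mul_eq_one_right _ this
    rw [hR, ← Matrix.mul_assoc, mul_nonsing_inv _ hdet, Matrix.one_mul]
  have hRR : Rᵀ * R = 1 := by
    have h1 := hQ.orthonormal
    rw [← hPR, transpose_mul] at h1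
    calc Rᵀ * R = Rᵀ * ((orthFrame u x)ᵀ * inducedMetric u x * orthFrame u x) * R := by
          rw [hPx, Matrix.mul_one]
      _ = 1 := by rw [← h1]; simp only [Matrix.mul_assoc]
  set P : EuclideanSpace ℝ (Fin n) → Matrix (Fin n) (Fin n) ℝ := fun y => orthFrame u y * R
    with hP
  have hPd : ∀ i j, DifferentiableAt ℝ (fun y => P y i j) x := fun i j => by
    simp only [hP, mul_apply]
    exact DifferentiableAt.fun_sum fun k _ => (hr.differentiableAt_orthFrame i k).mul_const _
  have hPQ : P x = Q := hPR
  have hexp : ∀ (M : EuclideanSpace ℝ (Fin n) → Matrix (Fin n) (Fin n) ℝ) (y) (k : Fin n),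
      ((P y)ᵀ * M y * P y) k k = ∑ i, ∑ j, P y i k * M y i j * P y j k := by
    intro M y k
    simp only [mul_apply, transpose_apply, Finset.sum_mul]
    rw [Finset.sum_comm]
  have hder : ∀ (M : EuclideanSpace ℝ (Fin n) → Matrix (Fin n) (Fin n) ℝ)
      (_ : ∀ i j, DifferentiableAt ℝ (fun y => M y i j) x) (k : Fin n),
      DifferentiableAt ℝ (fun y => ((P y)ᵀ * M y * P y) k k) x ∧
      ((M x)ᵀ = M x → pd l (fun y => ((P y)ᵀ * M y * P y) k k) x =
        ∑ i, ∑ j, Q i k * pd l (fun y => M y i j) x * Q j k +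
          2 * ∑ i, pd l (fun y => P y i k) x * ∑ j, M x i j * Q j k) := by
    intro M hM k
    simp only [hexp]
    have hd1 : ∀ i j, DifferentiableAt ℝ (fun y => P y i k * M y i j * P y j k) x :=
      fun i j => ((hPd i k).mul (hM i j)).mul (hPd j k)
    refine ⟨DifferentiableAt.fun_sum fun i _ => DifferentiableAt.fun_sum fun j _ => hd1 i j,
      fun hsymm => ?_⟩
    rw [pd_sum fun i _ => DifferentiableAt.fun_sum fun j _ => hd1 i j]
    have h1 : ∀ i j, pd l (fun y => P y i k * M y i j * P y j k) x =
        Q i k * pd l (fun y => M y i j) x * Q j k +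
        (pd l (fun y => P y i k) x * (M x i j * Q j k) +
          pd l (fun y => P y j k) x * (M x j i * Q i k)) := by
      intro i j
      have hs : M x j i = M x i j := congrFun (congrFun hsymm i) j
      rw [pd_mul (φ := fun y => P y i k * M y i j) ((hPd i k).mul (hM i j)) (hPd j k), pd_mul (hPd i k) (hM i j), hPQ, hs]
      ring
    simp only [pd_sum fun j _ => hd1 _ j, h1, Finset.sum_add_distrib]
    congr 1
    have h2 : ∑ i, ∑ j, pd l (fun y => P y j k) x * (M x j i * Q i k) =
        ∑ i, ∑ j, pd l (fun y => P y i k) x * (M x i j * Q j k) := Finset.sum_comm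
    rw [h2]
    simp only [← Finset.mul_sum]
    ring
  have hg := hder (inducedMetric u) hr.differentiableAt_inducedMetric
  have hh := hder (secondFundForm u) hr.differentiableAt_secondFundForm
  have hg0 : ∀ k, pd l (fun y => ((P y)ᵀ * inducedMetric u y * P y) k k) x = 0 := by
    intro k
    have : (fun y => ((P y)ᵀ * inducedMetric u y * P y) k k) =ᶠ[nhds x] fun _ => 1 := by
      filter_upwards [hr.eventually] with y hy
      rw [hP, hy.isOrthonormalFrame_orthFrame.mul_orthogonal hRR, one_apply_eq]
    rw [pd_congr this, pd_const]
  -- The matrix tangent inequality at κ, with σ on both sides, says that the weighted diagonal of h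
  -- is smallest at x. Its gradient therefore vanishes, which replaces differentiating f along the
  -- eigenvalues.
  have hmin : IsLocalMin
      (fun y => ∑ k, fPartial f k κ * ((P y)ᵀ * secondFundForm u y * P y) k k) x := by
    filter_upwards [hr.eventually, hΩ.mem_nhds hx] with y hy hyΩ
    obtain ⟨m, hm, -⟩ := h.curvature y hyΩ
    obtain ⟨hm0, hmσ⟩ := h.curvature_of_isPrincipalCurvatures hf hyΩ hm
    obtain ⟨V, hV, hA⟩ := hy.exists_orthogonal_diagonalization
      (hy.isOrthonormalFrame_orthFrame.mul_orthogonal hRR) hm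
    have h1 := le_add_sum_of_concave_symmetric hf.concave hf.symmetric hκ0 hm0
      (hf.differentiableAt hκ0) (U := 1) (by simp) hV hA
    rw [hmσ, hκσ] at h1
    simp only [transpose_one, Matrix.one_mul, Matrix.mul_one, mul_sub,
      Finset.sum_sub_distrib] at h1
    rw [hPQ, hQ.diagonal]
    simp only [diagonal_apply_eq]
    simp only [hP]
    linarith
  have h0 : pd l (fun y => ∑ k, fPartial f k κ * ((P y)ᵀ * secondFundForm u y * P y) k k) x = 0 := by
    rw [pd, hmin.fderiv_eq_zero]
    rfl
  rw [pd_sum fun k _ => (hh k).1.const_mul _] at h0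
  rw [← h0]
  refine Finset.sum_congr rfl fun k _ => ?_
  have h3 := hg0 k
  rw [(hg k).2 hr.transpose_inducedMetric] at h3
  rw [pd_const_mul _ (hh k).1, (hh k).2 hr.transpose_secondFundForm]
  congr 1
  simp only [hQ.sum_secondFundForm_mul]
  have h4 : ∑ i, pd l (fun y => P y i k) x * (κ k * ∑ j, inducedMetric u x i j * Q j k) =
      κ k * ∑ i, pd l (fun y => P y i k) x * ∑ j, inducedMetric u x i j * Q j k := by
    rw [Finset.mul_sum]
    exact Finset.sum_congr rfl fun i _ => by ring
  rw [h4]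
  -- Derivatives of the frame enter paired with hQ = gQ diag(κ); differentiating the normalization
  -- PᵀgP = 1 trades them for derivatives of g.
  linear_combination -κ k * h3

end Frames


/-! ### The linearized operator on `ν^{n+1}/u` and `1/u` -/

section Hessians

variable {n : ℕ} {u : EuclideanSpace ℝ (Fin n) → ℝ} {x : EuclideanSpace ℝ (Fin n)}

/-- The gradient of `u² / 2`. -/
noncomputable def halfSqGrad (u : EuclideanSpace ℝ (Fin n) → ℝ) (x : EuclideanSpace ℝ (Fin n))
    (i : Fin n) : ℝ := pd i (fun y => u y ^ 2 / 2) x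

/-- The Hessian of `(|x|² - u²) / 2`. -/
noncomputable def coneHess (u : EuclideanSpace ℝ (Fin n) → ℝ) (x : EuclideanSpace ℝ (Fin n)) :
    Matrix (Fin n) (Fin n) ℝ :=
  Matrix.of fun i j => (if i = j then 1 else 0) - pd i (fun y => halfSqGrad u y j) x

/-- `ν^{n+1} / u`. -/
noncomputable def nuQuot (u : EuclideanSpace ℝ (Fin n) → ℝ) (x : EuclideanSpace ℝ (Fin n)) : ℝ :=
  nuVert u x / u x

theorem angleQuotient_eq (σ : ℝ) (u : EuclideanSpace ℝ (Fin n) → ℝ)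
    (x : EuclideanSpace ℝ (Fin n)) : angleQuotient σ u x = σ * (u x)⁻¹ - nuQuot u x := by
  rw [angleQuotient, nuQuot]; ring

theorem hessian_const_mul_sub {G : EuclideanSpace ℝ (Fin n) → Matrix (Fin n) (Fin n) ℝ}
    {φ χ : EuclideanSpace ℝ (Fin n) → ℝ} (a b : ℝ) (hφ : ∀ᶠ y in nhds x, ContDiffAt ℝ ∞ φ y)
    (hχ : ∀ᶠ y in nhds x, ContDiffAt ℝ ∞ χ y) :
    hessian G (fun y => a * φ y - b * χ y) x = a • hessian G φ x - b • hessian G χ x := by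
  have hd : ∀ {φ : EuclideanSpace ℝ (Fin n) → ℝ} {y}, ContDiffAt ℝ ∞ φ y →
      DifferentiableAt ℝ φ y := fun h => h.differentiableAt (by simp)
  have h1 : ∀ j, ∀ᶠ y in nhds x, pd j (fun y => a * φ y - b * χ y) y =
      a * pd j φ y - b * pd j χ y := by
    intro j
    filter_upwards [hφ, hχ] with y h1 h2
    rw [pd_sub ((hd h1).const_mul a) ((hd h2).const_mul b), pd_const_mul _ (hd h1),
      pd_const_mul _ (hd h2)]
  ext i j
  have hφ' := hφ.self_of_nhds
  have hχ' := hχ.self_of_nhds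
  have h2 : pd i (pd j fun y => a * φ y - b * χ y) x =
      a * pd i (pd j φ) x - b * pd i (pd j χ) x := by
    rw [pd_congr (h1 j), pd_sub ((hd (contDiffAt_pd hφ')).const_mul a)
      ((hd (contDiffAt_pd hχ')).const_mul b), pd_const_mul _ (hd (contDiffAt_pd hφ')),
      pd_const_mul _ (hd (contDiffAt_pd hχ'))]
  simp only [hessian, of_apply, h2, Matrix.sub_apply, Matrix.smul_apply, smul_eq_mul,
    (h1 _).self_of_nhds, mul_sub, Finset.mul_sum]
  have h3 : ∑ k, (christoffel G x k i j * (a * pd k φ x) - christoffel G x k i j * (b * pd k χ x)) =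
      ∑ k, a * (christoffel G x k i j * pd k φ x) - ∑ k, b * (christoffel G x k i j * pd k χ x) := by
    rw [← Finset.sum_sub_distrib]
    exact Finset.sum_congr rfl fun k _ => by ring
  rw [h3]
  ring

theorem pd_halfSqGrad (i j : Fin n) :
    pd i (fun y => halfSqGrad u y j) x = (if i = j then 1 else 0) - coneHess u x i j := by
  simp [coneHess]

namespace RegularNear

variable (h : RegularNear u x)

include h

theorem halfSqGrad_eq (i : Fin n) : halfSqGrad u x i = u x * pd i u x := by
  have h1 : (fun y => u y ^ 2 / 2) = fun y => (1 / 2) * (u y * u y) := by ext; ring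
  rw [halfSqGrad, h1, pd_const_mul _ (h.differentiableAt.fun_mul h.differentiableAt),
    pd_mul h.differentiableAt h.differentiableAt]
  ring

theorem contDiffAt_halfSqGrad (i : Fin n) : ContDiffAt ℝ ∞ (fun y => halfSqGrad u y i) x :=
  contDiffAt_pd ((h.contDiffAt.pow 2).div_const 2)

theorem contDiffAt_coneHess (i j : Fin n) : ContDiffAt ℝ ∞ (fun y => coneHess u y i j) x :=
  contDiffAt_const.sub (contDiffAt_pd (h.contDiffAt_halfSqGrad j))

theorem contDiffAt_inv : ContDiffAt ℝ ∞ (fun y => (u y)⁻¹) x :=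
  h.contDiffAt.inv h.pos_self.ne'

theorem contDiffAt_nuVert : ContDiffAt ℝ ∞ (nuVert u) x := by
  have : nuVert u = fun y => 1 / Real.sqrt (1 - gradSq u y) := funext (nuVert_eq u)
  rw [this]
  exact contDiffAt_const.div h.contDiffAt_sqrt h.sqrt_pos.ne'

theorem contDiffAt_nuQuot : ContDiffAt ℝ ∞ (nuQuot u) x :=
  h.contDiffAt_nuVert.div h.contDiffAt h.pos_self.ne'

theorem coneHess_eq (i j : Fin n) :
    coneHess u x i j = (if i = j then 1 else 0) - pd i u x * pd j u x - u x * pd i (pd j u) x := by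
  have h1 : (fun y => halfSqGrad u y j) =ᶠ[nhds x] fun y => u y * pd j u y := by
    filter_upwards [h.eventually] with y hy using hy.halfSqGrad_eq j
  rw [coneHess, of_apply, pd_congr h1, pd_mul h.differentiableAt
    ((contDiffAt_pd h.contDiffAt).differentiableAt (by simp))]
  ring

theorem transpose_coneHess : (coneHess u x)ᵀ = coneHess u x := by
  ext i j
  simp only [transpose_apply, h.coneHess_eq, eq_comm (a := i),
    pd_comm h.contDiffAt i j, mul_comm (pd i u x)]

/-- The third derivatives of `u²` are symmetric. -/
theorem pd_coneHess_symm (i j k : Fin n) :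
    pd i (fun y => coneHess u y j k) x = pd k (fun y => coneHess u y i j) x := by
  have hc : ∀ l, ContDiffAt ℝ ∞ (fun y => halfSqGrad u y l) x := h.contDiffAt_halfSqGrad
  have h1 : ∀ a b c, pd a (fun y => coneHess u y b c) x =
      -pd a (pd b fun y => halfSqGrad u y c) x := by
    intro a b c
    simp only [coneHess, of_apply]
    rw [pd_sub (differentiableAt_const _)
      ((contDiffAt_pd (hc c)).differentiableAt (by simp)), pd_const]
    ring
  have h2 : ∀ a b, (pd a fun y => halfSqGrad u y b) =ᶠ[nhds x] (pd b fun y => halfSqGrad u y a) := by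
    intro a b
    filter_upwards [h.smooth] with y hy
    exact pd_comm ((hy.pow 2).div_const 2) a b
  rw [h1, h1, pd_congr (h2 j k), pd_comm (hc j)]

theorem nuQuot_eq : nuQuot u x = (u x * Real.sqrt (1 - gradSq u x))⁻¹ := by
  rw [nuQuot, nuVert_eq]
  have := h.sqrt_pos.ne'
  have := h.pos_self.ne'
  field_simp

theorem nuQuot_pos : 0 < nuQuot u x := by
  rw [h.nuQuot_eq]
  exact inv_pos.2 (mul_pos h.pos_self h.sqrt_pos)

/-- With p the gradient of u²/2 and q = `coneHess`, the metric, h and N are simple: g is rational in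
u and p, h = (N/u) q and N⁻² = u² - |p|². As q is a Hessian, its derivatives are totally symmetric;
this plays the part of the Codazzi equation. -/
theorem one_div_nuQuot_sq :
    (nuQuot u x ^ 2)⁻¹ = u x ^ 2 - halfSqGrad u x ⬝ᵥ halfSqGrad u x := by
  rw [h.nuQuot_eq, inv_pow, inv_inv, mul_pow, Real.sq_sqrt (sub_nonneg.2 h.spacelike_self.le)]
  simp only [dotProduct, h.halfSqGrad_eq, gradSq]
  have : ∑ i, u x * pd i u x * (u x * pd i u x) = u x ^ 2 * ∑ i, pd i u x ^ 2 := by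
    rw [Finset.mul_sum]
    exact Finset.sum_congr rfl fun i _ => by ring
  rw [this]
  ring

theorem pd_inv (i : Fin n) : pd i (fun y => (u y)⁻¹) x = -(u x)⁻¹ ^ 3 * halfSqGrad u x i := by
  rw [pd_comp (hasDerivAt_inv h.pos_self.ne') h.differentiableAt, h.halfSqGrad_eq]
  have := h.pos_self.ne'
  field_simp

theorem pd_nuQuot (i : Fin n) :
    pd i (nuQuot u) x = -nuQuot u x ^ 3 * (coneHess u x *ᵥ halfSqGrad u x) i := by
  have hd : ∀ j, DifferentiableAt ℝ (fun y => halfSqGrad u y j) x := fun j =>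
    (h.contDiffAt_halfSqGrad j).differentiableAt (by simp)
  have h1 : nuQuot u =ᶠ[nhds x] fun y =>
      (Real.sqrt (u y ^ 2 - ∑ j, halfSqGrad u y j * halfSqGrad u y j))⁻¹ := by
    filter_upwards [h.eventually] with y hy
    have := hy.one_div_nuQuot_sq
    rw [dotProduct] at this
    rw [← this, Real.sqrt_inv, inv_inv, Real.sqrt_sq hy.nuQuot_pos.le]
  set D := u x ^ 2 - ∑ j, halfSqGrad u x j * halfSqGrad u x j with hD
  have hDN : (nuQuot u x ^ 2)⁻¹ = D := h.one_div_nuQuot_sq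
  have hN := h.nuQuot_pos
  have hD0 : 0 < D := by rw [← hDN]; positivity
  have hs : Real.sqrt D = (nuQuot u x)⁻¹ := by
    rw [← hDN, Real.sqrt_inv, Real.sqrt_sq hN.le]
  have hu2 : DifferentiableAt ℝ (fun y => u y ^ 2) x := h.differentiableAt.pow 2
  have h2 : DifferentiableAt ℝ
      (fun y => u y ^ 2 - ∑ j, halfSqGrad u y j * halfSqGrad u y j) x :=
    hu2.sub (DifferentiableAt.fun_sum fun j _ => (hd j).fun_mul (hd j))
  have h3 := (Real.hasDerivAt_sqrt hD0.ne').inv (Real.sqrt_pos.2 hD0).ne'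
  rw [pd_congr h1, pd_comp (F := fun t => (Real.sqrt t)⁻¹) h3 h2, pd_sub hu2
    (DifferentiableAt.fun_sum fun j _ => (hd j).fun_mul (hd j)), pd_sum fun j _ => (hd j).fun_mul (hd j)]
  have h4 : pd i (fun y => u y ^ 2) x = 2 * halfSqGrad u x i := by
    have : (fun y => u y ^ 2) = fun y => u y * u y := by ext; ring
    rw [this, pd_mul h.differentiableAt h.differentiableAt, h.halfSqGrad_eq]
    ring
  have h5 : ∑ j, pd i (fun y => halfSqGrad u y j * halfSqGrad u y j) x =
      2 * halfSqGrad u x i - 2 * (coneHess u x *ᵥ halfSqGrad u x) i := by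
    have : ∀ j, pd i (fun y => halfSqGrad u y j * halfSqGrad u y j) x =
        2 * ((if i = j then halfSqGrad u x j else 0) - coneHess u x i j * halfSqGrad u x j) := by
      intro j
      rw [pd_mul (hd j) (hd j), pd_halfSqGrad]
      split_ifs <;> ring
    simp only [this, ← Finset.mul_sum, Finset.sum_sub_distrib, Finset.sum_ite_eq,
      Finset.mem_univ, if_true, mulVec, dotProduct]
    ring
  rw [h4, h5, hs]
  field_simp
  ring

theorem inducedMetric_eq : inducedMetric u x =
    ((u x)⁻¹ ^ 2) • (1 : Matrix (Fin n) (Fin n) ℝ) -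
      ((u x)⁻¹ ^ 4) • vecMulVec (halfSqGrad u x) (halfSqGrad u x) := by
  ext i j
  rw [h.inducedMetric_apply]
  simp only [Matrix.sub_apply, Matrix.smul_apply, one_apply, vecMulVec_apply, h.halfSqGrad_eq,
    smul_eq_mul]
  have := h.pos_self.ne'
  field_simp

theorem secondFundForm_eq : secondFundForm u x = ((u x)⁻¹ * nuQuot u x) • coneHess u x := by
  ext i j
  rw [h.secondFundForm_apply, Matrix.smul_apply, h.coneHess_eq, h.nuQuot_eq, smul_eq_mul]
  have := h.pos_self.ne'
  have := h.sqrt_pos.ne'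
  field_simp

theorem inducedMetric_inv : (inducedMetric u x)⁻¹ =
    (u x ^ 2) • ((1 : Matrix (Fin n) (Fin n) ℝ) +
      (nuQuot u x ^ 2) • vecMulVec (halfSqGrad u x) (halfSqGrad u x)) := by
  refine inv_eq_right_inv ?_
  set X := vecMulVec (halfSqGrad u x) (halfSqGrad u x) with hX
  have hXX : X * X = (u x ^ 2 - (nuQuot u x ^ 2)⁻¹) • X := by
    rw [hX, vecMulVec_mul_vecMulVec, h.one_div_nuQuot_sq]
    simp
  have hu := h.pos_self.ne'
  have hN := h.nuQuot_pos.ne'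
  rw [h.inducedMetric_eq, ← hX]
  simp only [Matrix.mul_add, Matrix.sub_mul, Matrix.mul_one, Matrix.one_mul, Matrix.smul_mul,
    Matrix.mul_smul, hXX]
  ext i j
  simp only [Matrix.add_apply, Matrix.sub_apply, Matrix.smul_apply, smul_eq_mul]
  field_simp
  ring

theorem pd_inducedMetric (l i j : Fin n) : pd l (fun y => inducedMetric u y i j) x =
    -2 * (u x)⁻¹ ^ 4 * halfSqGrad u x l * (if i = j then 1 else 0) +
      4 * (u x)⁻¹ ^ 6 * halfSqGrad u x l * (halfSqGrad u x i * halfSqGrad u x j) -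
      (u x)⁻¹ ^ 4 * (((if l = i then 1 else 0) - coneHess u x l i) * halfSqGrad u x j +
        halfSqGrad u x i * ((if l = j then 1 else 0) - coneHess u x l j)) := by
  have hd : ∀ j, DifferentiableAt ℝ (fun y => halfSqGrad u y j) x := fun j =>
    (h.contDiffAt_halfSqGrad j).differentiableAt (by simp)
  have hψ := h.contDiffAt_inv.differentiableAt (by simp)
  have hψ2 : DifferentiableAt ℝ (fun y => (u y)⁻¹ ^ 2) x := hψ.pow 2
  have hψ4 : DifferentiableAt ℝ (fun y => (u y)⁻¹ ^ 4) x := hψ.pow 4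
  have h1 : (fun y => inducedMetric u y i j) =ᶠ[nhds x] fun y =>
      (if i = j then 1 else 0) * (u y)⁻¹ ^ 2 -
        (u y)⁻¹ ^ 4 * (halfSqGrad u y i * halfSqGrad u y j) := by
    filter_upwards [h.eventually] with y hy
    rw [hy.inducedMetric_eq]
    simp only [Matrix.sub_apply, Matrix.smul_apply, one_apply, vecMulVec_apply, smul_eq_mul]
    ring
  rw [pd_congr h1, pd_sub (hψ2.const_mul _) (hψ4.fun_mul ((hd i).fun_mul (hd j))), pd_const_mul _ hψ2,
    pd_mul hψ4 ((hd i).fun_mul (hd j)), pd_mul (hd i) (hd j),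
    pd_comp (F := fun t => t ^ 2) (hasDerivAt_pow 2 _) hψ,
    pd_comp (F := fun t => t ^ 4) (hasDerivAt_pow 4 _) hψ, h.pd_inv, pd_halfSqGrad,
    pd_halfSqGrad]
  push_cast
  ring

theorem christoffel_inducedMetric (k i j : Fin n) : christoffel (inducedMetric u) x k i j =
    -(u x)⁻¹ ^ 2 * (halfSqGrad u x i * (if j = k then 1 else 0) +
        halfSqGrad u x j * (if i = k then 1 else 0)) +
      nuQuot u x ^ 2 * halfSqGrad u x k * coneHess u x i j := by
  set p := halfSqGrad u x with hp
  set q := coneHess u x with hq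
  have hqs : ∀ a b, q a b = q b a := fun a b => (congrFun (congrFun h.transpose_coneHess a) b).symm
  have h1 : ∀ l, pd i (fun y => inducedMetric u y j l) x + pd j (fun y => inducedMetric u y i l) x -
      pd l (fun y => inducedMetric u y i j) x =
      -2 * (u x)⁻¹ ^ 4 * (p i * (if j = l then 1 else 0) + p j * (if i = l then 1 else 0) -
        p l * (if i = j then 1 else 0)) + 4 * (u x)⁻¹ ^ 6 * (p i * p j * p l) -
        2 * (u x)⁻¹ ^ 4 * ((if i = j then 1 else 0) - q i j) * p l := by
    intro l
    simp only [h.pd_inducedMetric, ← hp, ← hq, hqs j i, hqs l i, hqs l j, eq_comm (a := j) (b := i),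
      eq_comm (a := l)]
    ring
  have h2 : ∀ l, (inducedMetric u x)⁻¹ k l =
      u x ^ 2 * ((if k = l then 1 else 0) + nuQuot u x ^ 2 * (p k * p l)) := by
    intro l
    rw [h.inducedMetric_inv]
    simp [one_apply, vecMulVec_apply, hp]
  have hm : p ⬝ᵥ p = u x ^ 2 - (nuQuot u x ^ 2)⁻¹ := by rw [h.one_div_nuQuot_sq]; ring
  have h3 : ∀ l, (inducedMetric u x)⁻¹ k l *
      (pd i (fun y => inducedMetric u y j l) x + pd j (fun y => inducedMetric u y i l) x -
        pd l (fun y => inducedMetric u y i j) x) =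
      (if k = l then u x ^ 2 * (-2 * (u x)⁻¹ ^ 4 * (p i * (if j = k then 1 else 0) +
        p j * (if i = k then 1 else 0) -
        p k * (if i = j then 1 else 0)) + 4 * (u x)⁻¹ ^ 6 * (p i * p j * p k) -
        2 * (u x)⁻¹ ^ 4 * ((if i = j then 1 else 0) - q i j) * p k) else 0) +
      (u x ^ 2 * nuQuot u x ^ 2 * p k) * (-2 * (u x)⁻¹ ^ 4 * ((if j = l then p i * p j else 0) +
        (if i = l then p i * p j else 0))) +
      (u x ^ 2 * nuQuot u x ^ 2 * p k) * (2 * (u x)⁻¹ ^ 4 * q i j + 4 * (u x)⁻¹ ^ 6 * (p i * p j)) *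
        (p l * p l) := by
    intro l
    rw [h1, h2]
    by_cases hk : k = l
    · subst hk
      split_ifs <;> subst_vars <;> ring
    · split_ifs <;> subst_vars <;> ring
  rw [christoffel]
  simp only [h3, Finset.sum_add_distrib, ← Finset.mul_sum, Finset.sum_ite_eq, Finset.mem_univ,
    if_true]
  rw [show ∑ l, p l * p l = u x ^ 2 - (nuQuot u x ^ 2)⁻¹ from hm]
  have := h.pos_self.ne'
  have := h.nuQuot_pos.ne'
  field_simp
  split_ifs <;> ring

/-- Conceptually, the ambient Hessian of 1/x_{n+1} is -1/x_{n+1} times the metric, and restriction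
to the graph adds the normal derivative times h. The proof checks this in coordinates. -/
theorem hessian_inv : hessian (inducedMetric u) (fun y => (u y)⁻¹) x =
    -(u x)⁻¹ • inducedMetric u x + nuQuot u x • secondFundForm u x := by
  have hd : ∀ j, DifferentiableAt ℝ (fun y => halfSqGrad u y j) x := fun j =>
    (h.contDiffAt_halfSqGrad j).differentiableAt (by simp)
  have hψ := h.contDiffAt_inv.differentiableAt (by simp)
  have hψ3 : DifferentiableAt ℝ (fun y => -(u y)⁻¹ ^ 3) x := (hψ.pow 3).neg
  have hm : ∑ k, halfSqGrad u x k * halfSqGrad u x k = u x ^ 2 - (nuQuot u x ^ 2)⁻¹ := by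
    rw [h.one_div_nuQuot_sq, dotProduct]; ring
  ext i j
  have h1 : pd j (fun y => (u y)⁻¹) =ᶠ[nhds x] fun y => -(u y)⁻¹ ^ 3 * halfSqGrad u y j := by
    filter_upwards [h.eventually] with y hy using hy.pd_inv j
  have h2 : ∀ k, christoffel (inducedMetric u) x k i j * (-(u x)⁻¹ ^ 3 * halfSqGrad u x k) =
      (u x)⁻¹ ^ 5 * ((if j = k then halfSqGrad u x i * halfSqGrad u x j else 0) +
        (if i = k then halfSqGrad u x i * halfSqGrad u x j else 0)) +
      (-(u x)⁻¹ ^ 3 * nuQuot u x ^ 2 * coneHess u x i j) *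
        (halfSqGrad u x k * halfSqGrad u x k) := by
    intro k
    rw [h.christoffel_inducedMetric]
    split_ifs <;> subst_vars <;> ring
  simp only [hessian, of_apply, h.pd_inv, h2]
  rw [pd_congr h1, pd_mul hψ3 (hd j), pd_halfSqGrad,
    pd_comp (F := fun t => -t ^ 3) (hasDerivAt_pow 3 _).neg hψ, h.pd_inv,
    Finset.sum_add_distrib, ← Finset.mul_sum, ← Finset.mul_sum, hm, Finset.sum_add_distrib,
    h.inducedMetric_eq, h.secondFundForm_eq]
  simp only [Finset.sum_ite_eq, Finset.mem_univ, if_true, Matrix.add_apply, Matrix.sub_apply,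
    Matrix.smul_apply, one_apply, vecMulVec_apply, smul_eq_mul]
  have := h.pos_self.ne'
  have := h.nuQuot_pos.ne'
  push_cast
  field_simp
  ring

/-- The gradient of N is -N³ q p. On differentiating once more, the symmetry of the derivatives of q
turns the third order term into the derivative of q in the direction p, the form in which the
differentiated equation can be used. -/
theorem hessian_nuQuot : hessian (inducedMetric u) (nuQuot u) x =
    (3 * nuQuot u x ^ 5) • vecMulVec (coneHess u x *ᵥ halfSqGrad u x)
        (coneHess u x *ᵥ halfSqGrad u x) -
      (nuQuot u x ^ 3) • ((Matrix.of fun i j => ∑ k, halfSqGrad u x k *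
        pd k (fun y => coneHess u y i j) x) + (coneHess u x - coneHess u x * coneHess u x)) -
      ((u x)⁻¹ ^ 2 * nuQuot u x ^ 3) •
        (vecMulVec (halfSqGrad u x) (coneHess u x *ᵥ halfSqGrad u x) +
          vecMulVec (coneHess u x *ᵥ halfSqGrad u x) (halfSqGrad u x)) +
      (nuQuot u x ^ 5 * (halfSqGrad u x ⬝ᵥ (coneHess u x *ᵥ halfSqGrad u x))) •
        coneHess u x := by
  have hd : ∀ j, DifferentiableAt ℝ (fun y => halfSqGrad u y j) x := fun j =>
    (h.contDiffAt_halfSqGrad j).differentiableAt (by simp)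
  have hq : ∀ i j, DifferentiableAt ℝ (fun y => coneHess u y i j) x := fun i j =>
    (h.contDiffAt_coneHess i j).differentiableAt (by simp)
  have hN := h.contDiffAt_nuQuot.differentiableAt (by simp)
  have hN3 : DifferentiableAt ℝ (fun y => -nuQuot u y ^ 3) x := (hN.pow 3).neg
  ext i j
  have h1 : pd j (nuQuot u) =ᶠ[nhds x] fun y =>
      -nuQuot u y ^ 3 * ∑ k, coneHess u y j k * halfSqGrad u y k := by
    filter_upwards [h.eventually] with y hy using hy.pd_nuQuot j
  have h2 : ∀ k, christoffel (inducedMetric u) x k i j *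
      (-nuQuot u x ^ 3 * (coneHess u x *ᵥ halfSqGrad u x) k) =
      ((u x)⁻¹ ^ 2 * nuQuot u x ^ 3) *
        ((if j = k then halfSqGrad u x i * (coneHess u x *ᵥ halfSqGrad u x) j else 0) +
        (if i = k then (coneHess u x *ᵥ halfSqGrad u x) i * halfSqGrad u x j else 0)) +
      (-nuQuot u x ^ 5 * coneHess u x i j) *
        (halfSqGrad u x k * (coneHess u x *ᵥ halfSqGrad u x) k) := by
    intro k
    rw [h.christoffel_inducedMetric]
    split_ifs <;> subst_vars <;> ring
  have hS : DifferentiableAt ℝ (fun y => ∑ k, coneHess u y j k * halfSqGrad u y k) x :=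
    DifferentiableAt.fun_sum fun k _ => (hq j k).fun_mul (hd k)
  have hqs : ∀ a b, coneHess u x a b = coneHess u x b a :=
    fun a b => (congrFun (congrFun h.transpose_coneHess a) b).symm
  have h3 : pd i (fun y => ∑ k, coneHess u y j k * halfSqGrad u y k) x =
      (∑ k, halfSqGrad u x k * pd k (fun y => coneHess u y i j) x) +
        (coneHess u x i j - (coneHess u x * coneHess u x) i j) := by
    have : ∀ k, pd i (fun y => coneHess u y j k * halfSqGrad u y k) x =
        halfSqGrad u x k * pd k (fun y => coneHess u y i j) x +
        ((if i = k then coneHess u x i j else 0) - coneHess u x i k * coneHess u x k j) := by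
      intro k
      rw [pd_mul (hq j k) (hd k), pd_halfSqGrad, h.pd_coneHess_symm i j k, hqs j k]
      split_ifs with hik
      · subst hik; ring
      · ring
    rw [pd_sum fun k _ => (hq j k).fun_mul (hd k)]
    simp only [this, Finset.sum_add_distrib, Finset.sum_sub_distrib, Finset.sum_ite_eq,
      Finset.mem_univ, if_true, mul_apply]
  simp only [hessian, of_apply, h.pd_nuQuot, h2]
  rw [pd_congr h1, pd_mul hN3 hS, h3,
    pd_comp (F := fun t => -t ^ 3) (hasDerivAt_pow 3 _).neg hN, h.pd_nuQuot,
    Finset.sum_add_distrib, ← Finset.mul_sum, ← Finset.mul_sum, Finset.sum_add_distrib]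
  simp only [Finset.sum_ite_eq, Finset.mem_univ, if_true, Matrix.add_apply, Matrix.sub_apply,
    Matrix.smul_apply, vecMulVec_apply, smul_eq_mul, of_apply]
  rw [show ∑ k, coneHess u x j k * halfSqGrad u x k = (coneHess u x *ᵥ halfSqGrad u x) j from rfl,
    show ∑ k, halfSqGrad u x k * (coneHess u x *ᵥ halfSqGrad u x) k =
      halfSqGrad u x ⬝ᵥ (coneHess u x *ᵥ halfSqGrad u x) from rfl]
  push_cast
  ring

end RegularNear

end Hessians


/-! ### The linearized operator in principal directions. -/

section LinearizedOperator

variable {n : ℕ} {u : EuclideanSpace ℝ (Fin n) → ℝ} {x : EuclideanSpace ℝ (Fin n)}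

theorem transpose_mul_mul_apply (Q M : Matrix (Fin n) (Fin n) ℝ) (k : Fin n) :
    (Qᵀ * M * Q) k k = (fun i => Q i k) ⬝ᵥ (M *ᵥ fun i => Q i k) := by
  simp only [mul_apply, transpose_apply, dotProduct, mulVec, Finset.sum_mul, Finset.mul_sum]
  rw [Finset.sum_comm]
  exact Finset.sum_congr rfl fun i _ => Finset.sum_congr rfl fun j _ => by ring

theorem dotProduct_vecMulVec_mulVec (a b ξ : Fin n → ℝ) :
    ξ ⬝ᵥ (vecMulVec a b *ᵥ ξ) = (a ⬝ᵥ ξ) * (b ⬝ᵥ ξ) := by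
  rw [vecMulVec_mulVec]
  simp [dotProduct_comm ξ a, mul_comm]

theorem sum_mul_sum_eq_dotProduct (p ξ : Fin n → ℝ) (M : Fin n → Fin n → Fin n → ℝ) :
    ∑ l, p l * ∑ i, ∑ j, ξ i * M l i j * ξ j =
      ξ ⬝ᵥ ((Matrix.of fun i j => ∑ l, p l * M l i j) *ᵥ ξ) := by
  simp only [dotProduct, mulVec, of_apply, Finset.mul_sum, Finset.sum_mul]
  rw [Finset.sum_comm]
  refine Finset.sum_congr rfl fun i _ => ?_
  rw [Finset.sum_comm]
  exact Finset.sum_congr rfl fun j _ => Finset.sum_congr rfl fun l _ => by ring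

namespace RegularNear

variable (h : RegularNear u x)

include h

theorem pd_secondFundForm (l i j : Fin n) : pd l (fun y => secondFundForm u y i j) x =
    (u x)⁻¹ * nuQuot u x * pd l (fun y => coneHess u y i j) x +
      (-(u x)⁻¹ ^ 3 * halfSqGrad u x l * nuQuot u x -
        (u x)⁻¹ * (nuQuot u x ^ 3 * (coneHess u x *ᵥ halfSqGrad u x) l)) * coneHess u x i j := by
  have hq : DifferentiableAt ℝ (fun y => coneHess u y i j) x :=
    (h.contDiffAt_coneHess i j).differentiableAt (by simp)
  have hN := h.contDiffAt_nuQuot.differentiableAt (by simp)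
  have hψ := h.contDiffAt_inv.differentiableAt (by simp)
  have h1 : (fun y => secondFundForm u y i j) =ᶠ[nhds x] fun y =>
      (u y)⁻¹ * nuQuot u y * coneHess u y i j := by
    filter_upwards [h.eventually] with y hy
    rw [hy.secondFundForm_eq]; rfl
  rw [pd_congr h1, pd_mul (hψ.fun_mul hN) hq, pd_mul hψ hN, h.pd_inv, h.pd_nuQuot]
  ring

/-- Since h = (N/u) q, the only third order term -N³ p·∂q is -N²u p·∂h up to lower order. The
eigenvector equation, the normalization of the direction and N⁻² = u² - |p|² then reduce the
remaining terms to κ_k, u and N. -/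
theorem hessian_nuQuot_principal {Q : Matrix (Fin n) (Fin n) ℝ} {κ : Fin n → ℝ}
    (hQ : IsPrincipalFrame u x Q κ) (k : Fin n) :
    (Qᵀ * hessian (inducedMetric u) (nuQuot u) x * Q) k k =
      -(u x)⁻¹ * κ k + nuQuot u x * κ k ^ 2 - nuQuot u x ^ 2 * u x *
        ∑ l, halfSqGrad u x l *
          (∑ i, ∑ j, Q i k * pd l (fun y => secondFundForm u y i j) x * Q j k -
            κ k * ∑ i, ∑ j, Q i k * pd l (fun y => inducedMetric u y i j) x * Q j k) := by
  set p := halfSqGrad u x with hp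
  set q := coneHess u x with hq
  set N := nuQuot u x with hN
  set ξ : Fin n → ℝ := fun i => Q i k with hξ
  set r := q *ᵥ p with hr
  set T : Matrix (Fin n) (Fin n) ℝ :=
    Matrix.of fun i j => ∑ l, p l * pd l (fun y => coneHess u y i j) x with hT
  have hu := h.pos_self
  have hN0 : 0 < N := h.nuQuot_pos
  have hqt : qᵀ = q := h.transpose_coneHess
  have hm : p ⬝ᵥ p = u x ^ 2 - (N ^ 2)⁻¹ := by rw [hN, h.one_div_nuQuot_sq]; ring
  have hsym : ∀ a b : Fin n → ℝ, (q *ᵥ a) ⬝ᵥ b = a ⬝ᵥ (q *ᵥ b) := by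
    intro a b
    rw [dotProduct_mulVec, ← mulVec_transpose, hqt]
  -- the principal direction
  have hy : q *ᵥ ξ = (κ k / (u x * N)) • (ξ - ((u x)⁻¹ ^ 2 * (p ⬝ᵥ ξ)) • p) := by
    ext i
    have h1 := hQ.sum_secondFundForm_mul i k
    rw [h.secondFundForm_eq, h.inducedMetric_eq] at h1
    have h2 : ∑ j, (((u x)⁻¹ * N) • q) i j * Q j k = (u x)⁻¹ * N * (q *ᵥ ξ) i := by
      simp only [Matrix.smul_apply, smul_eq_mul, mulVec, dotProduct, Finset.mul_sum]
      exact Finset.sum_congr rfl fun j _ => by ring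
    have h3 : ∑ j, (((u x)⁻¹ ^ 2) • (1 : Matrix (Fin n) (Fin n) ℝ) -
        ((u x)⁻¹ ^ 4) • vecMulVec p p) i j * Q j k =
        (u x)⁻¹ ^ 2 * ξ i - (u x)⁻¹ ^ 4 * (p i * (p ⬝ᵥ ξ)) := by
      have : ∀ j, (((u x)⁻¹ ^ 2) • (1 : Matrix (Fin n) (Fin n) ℝ) -
        ((u x)⁻¹ ^ 4) • vecMulVec p p) i j * Q j k =
        (if i = j then (u x)⁻¹ ^ 2 * Q j k else 0) - (u x)⁻¹ ^ 4 * (p i * (p j * Q j k)) := by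
        intro j
        simp only [Matrix.sub_apply, Matrix.smul_apply, one_apply, vecMulVec_apply, smul_eq_mul]
        split_ifs <;> ring
      simp only [this, Finset.sum_sub_distrib, Finset.sum_ite_eq, Finset.mem_univ, if_true,
        ← Finset.mul_sum, dotProduct, hξ]
    rw [h2, h3] at h1
    have h4 : (q *ᵥ ξ) i = u x / N * ((u x)⁻¹ * N * (q *ᵥ ξ) i) := by field_simp
    rw [h4, h1]
    simp only [Pi.smul_apply, Pi.sub_apply, smul_eq_mul]
    field_simp
  have hg : (u x)⁻¹ ^ 2 * (ξ ⬝ᵥ ξ) - (u x)⁻¹ ^ 4 * (p ⬝ᵥ ξ) ^ 2 = 1 := by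
    have h1 := congrFun (congrFun hQ.orthonormal k) k
    rw [transpose_mul_mul_apply, h.inducedMetric_eq, one_apply_eq, sub_mulVec, smul_mulVec,
      smul_mulVec, one_mulVec, dotProduct_sub, dotProduct_smul, dotProduct_smul,
      dotProduct_vecMulVec_mulVec] at h1
    rw [← h1]
    simp only [smul_eq_mul]
    ring
  have hX : ξ ⬝ᵥ ξ = u x ^ 2 + (u x)⁻¹ ^ 2 * (p ⬝ᵥ ξ) ^ 2 := by
    have : ξ ⬝ᵥ ξ = u x ^ 2 * ((u x)⁻¹ ^ 2 * (ξ ⬝ᵥ ξ)) := by field_simp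
    rw [this, eq_add_of_sub_eq hg]
    field_simp
  have hqq : ξ ⬝ᵥ (q *ᵥ ξ) =
      κ k / (u x * N) * (ξ ⬝ᵥ ξ - (u x)⁻¹ ^ 2 * (p ⬝ᵥ ξ) ^ 2) := by
    rw [hy, dotProduct_smul, dotProduct_sub, dotProduct_smul, dotProduct_comm ξ p]
    simp only [smul_eq_mul]; ring
  have hs : r ⬝ᵥ ξ = κ k / (u x * N) * (p ⬝ᵥ ξ - (u x)⁻¹ ^ 2 * (p ⬝ᵥ ξ) * (p ⬝ᵥ p)) := by
    rw [hr, hsym, hy, dotProduct_smul, dotProduct_sub, dotProduct_smul]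
    simp only [smul_eq_mul]
  have hyy : (q *ᵥ ξ) ⬝ᵥ (q *ᵥ ξ) = (κ k / (u x * N)) ^ 2 * (ξ ⬝ᵥ ξ -
      2 * (u x)⁻¹ ^ 2 * (p ⬝ᵥ ξ) ^ 2 + (u x)⁻¹ ^ 4 * (p ⬝ᵥ ξ) ^ 2 * (p ⬝ᵥ p)) := by
    rw [hy]
    simp only [smul_dotProduct, dotProduct_smul, dotProduct_sub, sub_dotProduct,
      dotProduct_comm ξ p, smul_eq_mul]
    ring
  -- the contracted derivatives of the fundamental forms
  have hH : ∑ l, p l * ∑ i, ∑ j, Q i k * pd l (fun y => secondFundForm u y i j) x * Q j k =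
      (u x)⁻¹ * N * (ξ ⬝ᵥ (T *ᵥ ξ)) -
        ((u x)⁻¹ ^ 3 * N * (p ⬝ᵥ p) + (u x)⁻¹ * N ^ 3 * (p ⬝ᵥ r)) * (ξ ⬝ᵥ (q *ᵥ ξ)) := by
    have h1 : (Matrix.of fun i j => ∑ l, p l * pd l (fun y => secondFundForm u y i j) x) =
        ((u x)⁻¹ * N) • T -
          ((u x)⁻¹ ^ 3 * N * (p ⬝ᵥ p) + (u x)⁻¹ * N ^ 3 * (p ⬝ᵥ r)) • q := by
      ext i j
      have : ∀ l, p l * pd l (fun y => secondFundForm u y i j) x =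
          (u x)⁻¹ * N * (p l * pd l (fun y => coneHess u y i j) x) -
          ((u x)⁻¹ ^ 3 * N * q i j) * (p l * p l) - ((u x)⁻¹ * N ^ 3 * q i j) * (p l * r l) := by
        intro l
        rw [h.pd_secondFundForm]; ring
      simp only [of_apply, this, Finset.sum_sub_distrib, ← Finset.mul_sum, Matrix.sub_apply,
        Matrix.smul_apply, smul_eq_mul, hT, dotProduct]
      ring
    rw [sum_mul_sum_eq_dotProduct p ξ, h1, sub_mulVec, smul_mulVec, smul_mulVec, dotProduct_sub,
      dotProduct_smul, dotProduct_smul]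
    simp only [smul_eq_mul]
  have hG : ∑ l, p l * ∑ i, ∑ j, Q i k * pd l (fun y => inducedMetric u y i j) x * Q j k =
      -2 * (u x)⁻¹ ^ 4 * (p ⬝ᵥ p) * (ξ ⬝ᵥ ξ) + 4 * (u x)⁻¹ ^ 6 * (p ⬝ᵥ p) * (p ⬝ᵥ ξ) ^ 2 -
        2 * (u x)⁻¹ ^ 4 * (p ⬝ᵥ ξ) * (p ⬝ᵥ ξ - r ⬝ᵥ ξ) := by
    have h1 : (Matrix.of fun i j => ∑ l, p l * pd l (fun y => inducedMetric u y i j) x) =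
        (-2 * (u x)⁻¹ ^ 4 * (p ⬝ᵥ p)) • (1 : Matrix (Fin n) (Fin n) ℝ) +
          (4 * (u x)⁻¹ ^ 6 * (p ⬝ᵥ p)) • vecMulVec p p -
          ((u x)⁻¹ ^ 4) • (vecMulVec (p - r) p + vecMulVec p (p - r)) := by
      ext i j
      have hqs : ∀ l m, q l m = q m l := fun l m => (congrFun (congrFun hqt l) m).symm
      have : ∀ l, p l * pd l (fun y => inducedMetric u y i j) x =
          (-2 * (u x)⁻¹ ^ 4 * (if i = j then 1 else 0) + 4 * (u x)⁻¹ ^ 6 * (p i * p j)) *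
            (p l * p l) -
          (u x)⁻¹ ^ 4 * ((if l = i then p l * p j else 0) - p j * (q i l * p l) +
            ((if l = j then p i * p l else 0) - p i * (q j l * p l))) := by
        intro l
        rw [h.pd_inducedMetric, ← hp, ← hq, hqs l i, hqs l j]
        split_ifs <;> ring
      have hr' : ∀ i, ∑ l, q i l * p l = r i := fun i => rfl
      simp only [of_apply, this, Finset.sum_sub_distrib, Finset.sum_add_distrib, ← Finset.mul_sum,
        Finset.sum_ite_eq', Finset.mem_univ, if_true, hr', Matrix.sub_apply, Matrix.add_apply,
        Matrix.smul_apply, smul_eq_mul, one_apply, vecMulVec_apply, Pi.sub_apply, dotProduct]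
      split_ifs <;> ring
    rw [sum_mul_sum_eq_dotProduct p ξ, h1]
    simp only [sub_mulVec, add_mulVec, smul_mulVec, one_mulVec, dotProduct_sub, dotProduct_add,
      dotProduct_smul, dotProduct_vecMulVec_mulVec, sub_dotProduct, smul_eq_mul]
    ring
  have hHess : (Qᵀ * hessian (inducedMetric u) (nuQuot u) x * Q) k k =
      3 * N ^ 5 * (r ⬝ᵥ ξ) ^ 2 - N ^ 3 * (ξ ⬝ᵥ (T *ᵥ ξ) + (ξ ⬝ᵥ (q *ᵥ ξ) -
        (q *ᵥ ξ) ⬝ᵥ (q *ᵥ ξ))) - 2 * (u x)⁻¹ ^ 2 * N ^ 3 * ((p ⬝ᵥ ξ) * (r ⬝ᵥ ξ)) +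
        N ^ 5 * (p ⬝ᵥ r) * (ξ ⬝ᵥ (q *ᵥ ξ)) := by
    rw [transpose_mul_mul_apply, h.hessian_nuQuot]
    simp only [← hp, ← hq, ← hN, ← hr, ← hξ, ← hT]
    simp only [sub_mulVec, add_mulVec, smul_mulVec, dotProduct_sub, dotProduct_add,
      dotProduct_smul, dotProduct_vecMulVec_mulVec, smul_eq_mul, ← mulVec_mulVec, hsym]
    ring
  have hsplit : ∑ l, p l *
        (∑ i, ∑ j, Q i k * pd l (fun y => secondFundForm u y i j) x * Q j k -
          κ k * ∑ i, ∑ j, Q i k * pd l (fun y => inducedMetric u y i j) x * Q j k) =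
      ∑ l, p l * ∑ i, ∑ j, Q i k * pd l (fun y => secondFundForm u y i j) x * Q j k -
      κ k * ∑ l, p l * ∑ i, ∑ j, Q i k * pd l (fun y => inducedMetric u y i j) x * Q j k := by
    rw [Finset.mul_sum, ← Finset.sum_sub_distrib]
    exact Finset.sum_congr rfl fun l _ => by ring
  rw [hsplit, hH, hG, hHess, hyy, hs, hqq, hX, hm]
  field_simp
  ring

end RegularNear

/-- The linearized operator in a principal frame. -/
theorem linearizedOp_eq_sum {f : (Fin n → ℝ) → ℝ} (hf : IsCurvatureFunction f)
    {P U : Matrix (Fin n) (Fin n) ℝ} {κ : Fin n → ℝ} (hκ : κ ∈ posCone n) (hU : Uᵀ * U = 1)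
    (hA : Pᵀ * secondFundForm u x * P = U * diagonal κ * Uᵀ)
    (φ : EuclideanSpace ℝ (Fin n) → ℝ) :
    linearizedOp f u P φ x =
      ∑ k, fPartial f k κ * ((P * U)ᵀ * hessian (inducedMetric u) φ x * (P * U)) k k := by
  set M := Pᵀ * hessian (inducedMetric u) φ x * P with hM
  have h1 : (P * U)ᵀ * hessian (inducedMetric u) φ x * (P * U) = Uᵀ * M * U := by
    rw [hM, transpose_mul]; simp only [Matrix.mul_assoc]
  have h2 : ∀ k, (Uᵀ * M * U) k k = ∑ i, ∑ j, U i k * U j k * M i j := by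
    intro k
    simp only [mul_apply, transpose_apply, Finset.sum_mul]
    rw [Finset.sum_comm]
    exact Finset.sum_congr rfl fun i _ => Finset.sum_congr rfl fun j _ => by ring
  simp only [linearizedOp, hf.spectralPartial_eq hκ hU hA, h1, h2, ← hM, Finset.sum_mul,
    Finset.mul_sum]
  rw [Finset.sum_comm_cycle]
  exact Finset.sum_congr rfl fun k _ => Finset.sum_congr rfl fun i _ =>
    Finset.sum_congr rfl fun j _ => by ring

/-- `F^{ij} ∇_{ij}` of the function `1/u` and of `(σ - ν^{n+1}) / u`, in a principal frame. -/
theorem IsSolution.sum_fPartial_mul_hessian {f : (Fin n → ℝ) → ℝ} {σ : ℝ}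
    {Ω : Set (EuclideanSpace ℝ (Fin n))} (hf : IsCurvatureFunction f) (h : IsSolution f σ Ω u)
    (hΩ : IsOpen Ω) (hx : x ∈ Ω) {Q : Matrix (Fin n) (Fin n) ℝ} {κ : Fin n → ℝ}
    (hκ : IsPrincipalCurvatures u x κ) (hQ : IsPrincipalFrame u x Q κ) :
    ∑ k, fPartial f k κ * (Qᵀ * hessian (inducedMetric u) (fun y => (u y)⁻¹) x * Q) k k =
        -(u x)⁻¹ * ∑ k, fPartial f k κ + σ * nuQuot u x ∧
      ∑ k, fPartial f k κ * (Qᵀ * hessian (inducedMetric u) (angleQuotient σ u) x * Q) k k =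
        σ / u x * (1 - ∑ i, fPartial f i κ) +
          nuVert u x / u x * (σ ^ 2 - ∑ i, fPartial f i κ * κ i ^ 2) := by
  have hr := h.regularNear hΩ hx
  obtain ⟨hκ0, hκσ⟩ := h.curvature_of_isPrincipalCurvatures hf hx hκ
  have hE : ∑ k, fPartial f k κ * κ k = σ := by rw [hf.sum_fPartial_mul_self hκ0, hκσ]
  have h1 : ∑ k, fPartial f k κ * (Qᵀ * hessian (inducedMetric u) (fun y => (u y)⁻¹) x * Q) k k =
      -(u x)⁻¹ * ∑ k, fPartial f k κ + σ * nuQuot u x := by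
    have h2 : ∀ k, fPartial f k κ *
        (Qᵀ * hessian (inducedMetric u) (fun y => (u y)⁻¹) x * Q) k k =
        -(u x)⁻¹ * fPartial f k κ + fPartial f k κ * κ k * nuQuot u x := by
      intro k
      rw [hr.hessian_inv, Matrix.mul_add, Matrix.add_mul, Matrix.mul_smul, Matrix.smul_mul,
        Matrix.mul_smul, Matrix.smul_mul, hQ.orthonormal, hQ.diagonal, Matrix.add_apply,
        Matrix.smul_apply, Matrix.smul_apply, one_apply_eq, diagonal_apply_eq, smul_eq_mul,
        smul_eq_mul]
      ring
    simp only [h2, Finset.sum_add_distrib, ← Finset.mul_sum, ← Finset.sum_mul, hE]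
  refine ⟨h1, ?_⟩
  have h3 : ∑ k, fPartial f k κ * (Qᵀ * hessian (inducedMetric u) (nuQuot u) x * Q) k k =
      -(u x)⁻¹ * σ + nuQuot u x * ∑ k, fPartial f k κ * κ k ^ 2 := by
    set E : Fin n → Fin n → ℝ := fun l k =>
      ∑ i, ∑ j, Q i k * pd l (fun y => secondFundForm u y i j) x * Q j k -
            κ k * ∑ i, ∑ j, Q i k * pd l (fun y => inducedMetric u y i j) x * Q j k with hEdef
    -- Here the equation f(κ) = σ enters in differentiated form and removes all third derivatives.
    have hE0 : ∀ l, ∑ k, fPartial f k κ * E l k = 0 :=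
      fun l => h.sum_fPartial_mul_pd hf hΩ hx hκ hQ l
    have h4 : ∀ k, fPartial f k κ * (Qᵀ * hessian (inducedMetric u) (nuQuot u) x * Q) k k =
        -(u x)⁻¹ * (fPartial f k κ * κ k) + nuQuot u x * (fPartial f k κ * κ k ^ 2) -
        nuQuot u x ^ 2 * u x * ∑ l, halfSqGrad u x l * (fPartial f k κ * E l k) := by
      intro k
      have : ∑ l, halfSqGrad u x l * (fPartial f k κ * E l k) =
          fPartial f k κ * ∑ l, halfSqGrad u x l * E l k := by
        rw [Finset.mul_sum]
        exact Finset.sum_congr rfl fun l _ => by ring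
      rw [this, hr.hessian_nuQuot_principal hQ]; ring
    simp only [h4, Finset.sum_sub_distrib, Finset.sum_add_distrib, ← Finset.mul_sum, hE]
    rw [Finset.sum_comm]
    simp only [← Finset.mul_sum, hE0]
    simp
  have h5 : hessian (inducedMetric u) (angleQuotient σ u) x =
      σ • hessian (inducedMetric u) (fun y => (u y)⁻¹) x -
        (1 : ℝ) • hessian (inducedMetric u) (nuQuot u) x := by
    rw [← hessian_const_mul_sub σ 1 (hr.eventually.mono fun y hy => hy.contDiffAt_inv)
      (hr.eventually.mono fun y hy => hy.contDiffAt_nuQuot)]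
    congr 1
    ext y
    rw [angleQuotient_eq, one_mul]
  have h6 : ∀ k, fPartial f k κ *
      (Qᵀ * hessian (inducedMetric u) (angleQuotient σ u) x * Q) k k =
      σ * (fPartial f k κ * (Qᵀ * hessian (inducedMetric u) (fun y => (u y)⁻¹) x * Q) k k) -
        fPartial f k κ * (Qᵀ * hessian (inducedMetric u) (nuQuot u) x * Q) k k := by
    intro k
    rw [h5, one_smul, Matrix.mul_sub, Matrix.sub_mul, Matrix.mul_smul, Matrix.smul_mul,
      Matrix.sub_apply, Matrix.smul_apply, smul_eq_mul]
    ring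
  simp only [h6, Finset.sum_sub_distrib, ← Finset.mul_sum, h1, h3]
  rw [nuQuot]
  ring

theorem IsSolution.linearizedOp_angleQuotient {f : (Fin n → ℝ) → ℝ} {σ : ℝ}
    {Ω : Set (EuclideanSpace ℝ (Fin n))} (hf : IsCurvatureFunction f) (hσ : 1 < σ)
    (h : IsSolution f σ Ω u) (hΩ : IsOpen Ω) (hx : x ∈ Ω) {P : Matrix (Fin n) (Fin n) ℝ}
    {κ : Fin n → ℝ} (hP : IsOrthonormalFrame u x P) (hκ : IsPrincipalCurvatures u x κ) :
    linearizedOp f u P (angleQuotient σ u) x =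
        σ / u x * (1 - ∑ i, fPartial f i κ) +
          nuVert u x / u x * (σ ^ 2 - ∑ i, fPartial f i κ * κ i ^ 2) ∧
      linearizedOp f u P (angleQuotient σ u) x ≤ 0 := by
  have hr := h.regularNear hΩ hx
  obtain ⟨hκ0, hκσ⟩ := h.curvature_of_isPrincipalCurvatures hf hx hκ
  obtain ⟨U, hU, hA⟩ := hr.exists_orthogonal_diagonalization hP hκ
  have h1 := (h.sum_fPartial_mul_hessian hf hΩ hx hκ (isPrincipalFrame_mul hP hU hA)).2
  rw [linearizedOp_eq_sum hf hκ0 hU hA, h1]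
  refine ⟨rfl, ?_⟩
  have h2 := hf.one_le_sum_fPartial hκ0
  have h3 := hf.sq_le_sum_fPartial_mul_sq hκ0
  rw [hκσ] at h3
  have hu := hr.pos_self
  have h4 : 0 < nuVert u x / u x := hr.nuQuot_pos
  have h5 : 0 < σ / u x := div_pos (by linarith) hu
  exact add_nonpos (mul_nonpos_of_nonneg_of_nonpos h5.le (by linarith))
    (mul_nonpos_of_nonneg_of_nonpos h4.le (by linarith))

end LinearizedOperator


/-! ### The minimum principle -/

section SecondDerivative

/-- The second derivative of `φ` at `x` in the direction `ξ`. -/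
noncomputable def secondDeriv {E : Type*} [NormedAddCommGroup E] [NormedSpace ℝ E] (φ : E → ℝ)
    (x ξ : E) : ℝ := fderiv ℝ (fun y => fderiv ℝ φ y ξ) x ξ

variable {E : Type*} [NormedAddCommGroup E] [NormedSpace ℝ E] {φ : E → ℝ} {x : E}

theorem secondDeriv_nonneg_of_isLocalMin (hφ : ContDiffAt ℝ ∞ φ x) (h : IsLocalMin φ x) (ξ : E) :
    0 ≤ secondDeriv φ x ξ := by
  set g : ℝ → ℝ := fun t => φ (x + t • ξ) with hg
  have hline : ∀ t : ℝ, HasDerivAt (fun t : ℝ => x + t • ξ) ξ t := fun t => by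
    simpa using ((hasDerivAt_id t).smul_const ξ).const_add x
  have htend : Filter.Tendsto (fun t : ℝ => x + t • ξ) (nhds 0) (nhds x) := by
    simpa using (hline 0).continuousAt.tendsto
  have hd : ∀ᶠ y in nhds x, DifferentiableAt ℝ φ y :=
    ((hφ.of_le (m := 1) (by simp)).eventually (by simp)).mono fun y hy =>
      hy.differentiableAt (by simp)
  have hg1 : deriv g =ᶠ[nhds 0] fun t => fderiv ℝ φ (x + t • ξ) ξ := by
    filter_upwards [htend.eventually hd] with t ht
    exact (ht.hasFDerivAt.comp_hasDerivAt t (hline t)).deriv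
  have hφ' : DifferentiableAt ℝ (fun y => fderiv ℝ φ y ξ) x :=
    ((hφ.fderiv_right (m := ∞) (by simp)).clm_apply contDiffAt_const).differentiableAt (by simp)
  have hg2 : deriv (deriv g) 0 = secondDeriv φ x ξ := by
    rw [hg1.deriv_eq]
    have h1 : HasFDerivAt (fun y => fderiv ℝ φ y ξ)
        (fderiv ℝ (fun y => fderiv ℝ φ y ξ) x) (x + (0 : ℝ) • ξ) := by
      simpa using hφ'.hasFDerivAt
    exact (h1.comp_hasDerivAt (0 : ℝ) (hline 0)).deriv
  have hmin : IsLocalMin g 0 := by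
    have : ∀ᶠ t in nhds (0 : ℝ), φ x ≤ φ (x + t • ξ) := htend.eventually h
    filter_upwards [this] with t ht
    simpa [hg] using ht
  have hcont : ContinuousAt g 0 := by
    have h1 : ContinuousAt φ (x + (0 : ℝ) • ξ) := by simpa using hφ.continuousAt
    exact ContinuousAt.comp (g := φ) (f := fun t : ℝ => x + t • ξ) h1 (hline 0).continuousAt
  -- A negative second derivative at the critical point would make it a local maximum as well; the
  -- function would be locally constant and its second derivative 0.
  by_contra hneg
  rw [← hg2, not_le] at hneg
  have hmax := isLocalMax_of_deriv_deriv_neg hneg hmin.deriv_eq_zero hcont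
  have hconst : g =ᶠ[nhds 0] fun _ => g 0 := by
    filter_upwards [hmin, hmax] with t h1 h2 using le_antisymm h2 h1
  have h0 : deriv (deriv g) 0 = 0 := by
    rw [hconst.deriv.deriv_eq]
    simp
  rw [h0] at hneg
  exact lt_irrefl _ hneg

theorem secondDeriv_neg (φ : E → ℝ) (x ξ : E) :
    secondDeriv (fun y => -φ y) x ξ = -secondDeriv φ x ξ := by
  simp [secondDeriv, fderiv_fun_neg]

theorem secondDeriv_nonpos_of_isLocalMax (hφ : ContDiffAt ℝ ∞ φ x) (h : IsLocalMax φ x) (ξ : E) :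
    secondDeriv φ x ξ ≤ 0 := by
  have := secondDeriv_nonneg_of_isLocalMin hφ.neg h.neg ξ
  rw [secondDeriv_neg] at this
  linarith

theorem secondDeriv_eq_sum {n : ℕ} {φ : EuclideanSpace ℝ (Fin n) → ℝ}
    {x : EuclideanSpace ℝ (Fin n)} (hφ : ContDiffAt ℝ ∞ φ x) (ξ : EuclideanSpace ℝ (Fin n)) :
    secondDeriv φ x ξ = ∑ i, ∑ j, ξ i * pd i (pd j φ) x * ξ j := by
  have h1 : (fun y => fderiv ℝ φ y ξ) = fun y => ∑ j, ξ j * pd j φ y :=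
    funext fun y => fderiv_eq_sum_pd φ y ξ
  have hd : ∀ j, DifferentiableAt ℝ (pd j φ) x := fun j =>
    (contDiffAt_pd hφ).differentiableAt (by simp)
  rw [secondDeriv, h1, fderiv_eq_sum_pd]
  refine Finset.sum_congr rfl fun i _ => ?_
  rw [pd_sum fun j _ => (hd j).const_mul _, Finset.mul_sum]
  refine Finset.sum_congr rfl fun j _ => ?_
  rw [pd_const_mul _ (hd j)]
  ring

end SecondDerivative

section MinimumPrinciple

variable {n : ℕ} {u : EuclideanSpace ℝ (Fin n) → ℝ} {x : EuclideanSpace ℝ (Fin n)}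

/-- At a critical point the Christoffel terms drop out, so the covariant Hessian is the coordinate
Hessian whatever G is. -/
theorem sum_mul_hessian_nonneg_of_isLocalMin {G : EuclideanSpace ℝ (Fin n) → Matrix (Fin n) (Fin n) ℝ}
    {φ : EuclideanSpace ℝ (Fin n) → ℝ} (hφ : ContDiffAt ℝ ∞ φ x) (h : IsLocalMin φ x)
    {c : Fin n → ℝ} (hc : ∀ k, 0 ≤ c k) (Q : Matrix (Fin n) (Fin n) ℝ) :
    0 ≤ ∑ k, c k * (Qᵀ * hessian G φ x * Q) k k := by
  refine Finset.sum_nonneg fun k _ => mul_nonneg (hc k) ?_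
  have h0 : ∀ l, pd l φ x = 0 := fun l => by rw [pd, h.fderiv_eq_zero]; rfl
  have h1 := secondDeriv_nonneg_of_isLocalMin hφ h (WithLp.toLp 2 fun i => Q i k)
  rw [secondDeriv_eq_sum hφ] at h1
  refine h1.trans (le_of_eq ?_)
  rw [transpose_mul_mul_apply]
  simp only [dotProduct, mulVec, hessian, of_apply, h0, mul_zero, Finset.sum_const_zero, sub_zero,
    Finset.mul_sum]
  exact Finset.sum_congr rfl fun i _ => Finset.sum_congr rfl fun j _ => by ring

theorem one_le_nuVert (h : gradSq u x < 1) : 1 ≤ nuVert u x := by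
  have h0 : 0 ≤ gradSq u x := Finset.sum_nonneg fun i _ => sq_nonneg _
  have h1 : 0 < Real.sqrt (1 - gradSq u x) := Real.sqrt_pos.2 (by linarith)
  rw [nuVert_eq, le_div_iff₀ h1, one_mul]
  exact Real.sqrt_le_one.2 (by linarith)

/-- Subtracting a small multiple of `1/u` makes `(σ - ν^{n+1}) / u` a strict supersolution. -/
theorem IsSolution.not_isLocalMin {f : (Fin n → ℝ) → ℝ} {σ ε : ℝ}
    {Ω : Set (EuclideanSpace ℝ (Fin n))} (hf : IsCurvatureFunction f) (hσ : 1 < σ)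
    (h : IsSolution f σ Ω u) (hΩ : IsOpen Ω) (hx : x ∈ Ω) (hε : 0 < ε) (hεσ : ε < σ) :
    ¬ IsLocalMin (fun y => 1 * angleQuotient σ u y - ε * (u y)⁻¹) x := by
  intro hmin
  have hr := h.regularNear hΩ hx
  obtain ⟨κ, hκ, -⟩ := h.curvature x hx
  obtain ⟨hκ0, hκσ⟩ := h.curvature_of_isPrincipalCurvatures hf hx hκ
  obtain ⟨Q, hQ⟩ := hr.exists_isPrincipalFrame hκ
  obtain ⟨h1, h2⟩ := h.sum_fPartial_mul_hessian hf hΩ hx hκ hQ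
  have hsm : ∀ y, RegularNear u y → ContDiffAt ℝ ∞ (angleQuotient σ u) y := fun y hy =>
    (contDiffAt_const.sub hy.contDiffAt_nuVert).div hy.contDiffAt hy.pos_self.ne'
  have h3 := sum_mul_hessian_nonneg_of_isLocalMin (G := inducedMetric u)
    ((contDiffAt_const.mul (hsm x hr)).sub (contDiffAt_const.mul hr.contDiffAt_inv)) hmin
    (fun k => (hf.partial_pos κ hκ0 k).le) Q
  rw [hessian_const_mul_sub _ _ (hr.eventually.mono hsm)
    (hr.eventually.mono fun y hy => hy.contDiffAt_inv)] at h3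
  simp only [one_smul, Matrix.sub_mul, Matrix.mul_smul, Matrix.smul_mul,
    Matrix.sub_apply, Matrix.smul_apply, smul_eq_mul, mul_sub, Finset.sum_sub_distrib,
    mul_left_comm _ ε] at h3
  rw [← Finset.mul_sum, h1, h2] at h3
  have hS := hf.one_le_sum_fPartial hκ0
  have hR := hf.sq_le_sum_fPartial_mul_sq hκ0
  rw [hκσ] at hR
  have hu := inv_pos.2 hr.pos_self
  have hN : (u x)⁻¹ ≤ nuQuot u x := by
    rw [nuQuot, div_eq_mul_inv]
    exact le_mul_of_one_le_left hu.le (one_le_nuVert hr.spacelike_self)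
  rw [show nuVert u x / u x = nuQuot u x from rfl, div_eq_mul_inv] at h3
  set S := ∑ k, fPartial f k κ
  set R := ∑ k, fPartial f k κ * κ k ^ 2
  set ψ := (u x)⁻¹
  -- The operator applied to the modified function is minus the sum of these four terms. The last is
  -- strictly positive because σ > 1, and the third uses ν^{n+1} ≥ 1.
  have e1 : 0 ≤ (σ - ε) * ψ * (S - 1) :=
    mul_nonneg (mul_nonneg (by linarith) hu.le) (by linarith)
  have e2 : 0 ≤ nuQuot u x * (R - σ ^ 2) := mul_nonneg (hu.le.trans hN) (by linarith)
  have e3 : 0 ≤ ε * σ * (nuQuot u x - ψ) := mul_nonneg (by positivity) (by linarith)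
  have e4 : 0 < ε * ψ * (σ - 1) := mul_pos (mul_pos hε hu) (by linarith)
  nlinarith

theorem frontier_nonempty (hn : 1 ≤ n) {Ω : Set (EuclideanSpace ℝ (Fin n))}
    (hne : Ω.Nonempty) (hb : Bornology.IsBounded Ω) : (frontier Ω).Nonempty := by
  have : Nonempty (Fin n) := ⟨⟨0, hn⟩⟩
  by_contra hf
  rw [Set.not_nonempty_iff_eq_empty, frontier_eq_empty_iff] at hf
  rcases hf with hf | hf
  · exact hne.ne_empty hf
  · rw [hf] at hb
    exact NormedSpace.unbounded_univ ℝ _ hb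

theorem isCompact_closure_of_isBounded {Ω : Set (EuclideanSpace ℝ (Fin n))}
    (hb : Bornology.IsBounded Ω) : IsCompact (closure Ω) :=
  Metric.isCompact_of_isClosed_isBounded isClosed_closure hb.closure

theorem isCompact_frontier_of_isBounded {Ω : Set (EuclideanSpace ℝ (Fin n))}
    (hb : Bornology.IsBounded Ω) : IsCompact (frontier Ω) :=
  (isCompact_closure_of_isBounded hb).of_isClosed_subset isClosed_frontier frontier_subset_closure

theorem continuousAt_nuVert (hu : ContDiffAt ℝ ∞ u x) (hs : gradSq u x < 1) :
    ContinuousAt (nuVert u) x := by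
  have : nuVert u = fun y => 1 / Real.sqrt (1 - gradSq u y) := funext (nuVert_eq u)
  rw [this]
  have h1 : ContinuousAt (gradSq u) x := by
    unfold gradSq
    exact (ContDiffAt.sum fun i _ => (contDiffAt_pd (i := i) hu).pow 2).continuousAt
  exact continuousAt_const.div ((continuousAt_const.sub h1).sqrt)
    (Real.sqrt_pos.2 (sub_pos.2 hs)).ne'

theorem IsSolutionUpToBoundary.exists_min_frontier {f : (Fin n → ℝ) → ℝ} {σ : ℝ}
    {Ω : Set (EuclideanSpace ℝ (Fin n))} (hn : 1 ≤ n) (hf : IsCurvatureFunction f) (hσ : 1 < σ)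
    (h : IsSolutionUpToBoundary f σ Ω u) (hΩ : IsOpen Ω) (hne : Ω.Nonempty)
    (hb : Bornology.IsBounded Ω) :
    ∃ y ∈ frontier Ω,
        angleQuotient σ u y = sInf (angleQuotient σ u '' frontier Ω) ∧
          ∀ x ∈ closure Ω, angleQuotient σ u y ≤ angleQuotient σ u x := by
  have hcK := isCompact_closure_of_isBounded hb
  have hfK := isCompact_frontier_of_isBounded hb
  have hψ : ContinuousOn (fun y => (u y)⁻¹) (closure Ω) := fun y hy =>
    ((h.smooth_closure y hy).continuousAt.inv₀ (h.pos_closure y hy).ne').continuousWithinAt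
  have hφ : ContinuousOn (angleQuotient σ u) (closure Ω) := fun y hy =>
    ((continuousAt_const.sub (continuousAt_nuVert (h.smooth_closure y hy)
      (h.spacelike_closure y hy))).div (h.smooth_closure y hy).continuousAt
      (h.pos_closure y hy).ne').continuousWithinAt
  obtain ⟨y, hy, hymin⟩ := hfK.exists_isMinOn (frontier_nonempty hn hne hb)
    (hφ.mono frontier_subset_closure)
  obtain ⟨z, hz, hzmax⟩ := hcK.exists_isMaxOn hne.closure hψ
  have hmain : ∀ x ∈ closure Ω, angleQuotient σ u y ≤ angleQuotient σ u x := by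
    intro x hx
    have hM : 0 < (u z)⁻¹ := inv_pos.2 (h.pos_closure z hz)
    refine le_of_forall_pos_le_add fun δ hδ => ?_
    -- Small enough that ε/u is at most δ on the whole closure, and below σ as the strict
    -- supersolution requires.
    set ε := min (σ / 2) (δ / (u z)⁻¹) with hεdef
    have hε : 0 < ε := lt_min (by linarith) (div_pos hδ hM)
    have hεσ : ε < σ := (min_le_left _ _).trans_lt (by linarith)
    have hεδ : ε * (u z)⁻¹ ≤ δ := by
      rw [← le_div_iff₀ hM]; exact min_le_right _ _
    obtain ⟨q, hq, hqmin⟩ := hcK.exists_isMinOn hne.closure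
      ((continuousOn_const (c := (1 : ℝ)).mul hφ).sub (continuousOn_const (c := ε).mul hψ))
    have hqf : q ∈ frontier Ω := by
      rw [hΩ.frontier_eq]
      refine ⟨hq, fun hqΩ => h.not_isLocalMin hf hσ hΩ hqΩ hε hεσ ?_⟩
      filter_upwards [hΩ.mem_nhds hqΩ] with p hp using hqmin (subset_closure hp)
    have h1 : 1 * angleQuotient σ u q - ε * (u q)⁻¹ ≤ 1 * angleQuotient σ u x - ε * (u x)⁻¹ :=
      hqmin hx
    have h2 : angleQuotient σ u y ≤ angleQuotient σ u q := hymin hqf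
    have h3 : (u q)⁻¹ ≤ (u z)⁻¹ := hzmax hq
    have h4 : 0 < (u x)⁻¹ := inv_pos.2 (h.pos_closure x hx)
    have h5 := mul_le_mul_of_nonneg_left h3 hε.le
    have h6 := mul_pos hε h4
    linarith
  refine ⟨y, hy, ?_, hmain⟩
  have : IsLeast (angleQuotient σ u '' frontier Ω) (angleQuotient σ u y) :=
    ⟨Set.mem_image_of_mem _ hy, by rintro _ ⟨x, hx, rfl⟩; exact hymin hx⟩
  exact this.csInf_eq.symm

end MinimumPrinciple


/-! ### Interior and exterior spheres -/

section Spheres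

/-- Expanding the square turns membership in a ball through y into a quadratic inequality that can
be compared with Taylor remainders and half spaces. -/
theorem add_smul_mem_ball_iff {F : Type*} [NormedAddCommGroup F] [InnerProductSpace ℝ F]
    {y a z : F} {r : ℝ} (hr : 0 < r) (ha : ‖a‖ = r) :
    z ∈ Metric.ball (y + a) r ↔ ‖z - y‖ ^ 2 < 2 * inner ℝ a (z - y) := by
  rw [mem_ball_iff_norm, ← sub_sub, ← sq_lt_sq₀ (norm_nonneg _) hr.le, norm_sub_sq_real, ha,
    real_inner_comm]
  constructor <;> intro h <;> linarith

theorem norm_sub_sub_fderiv_le {F : Type*} [NormedAddCommGroup F] [NormedSpace ℝ F] {ρ : F → ℝ}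
    {s : Set F} (hs : Convex ℝ s) {K : NNReal} (hK : LipschitzOnWith K (fderiv ℝ ρ) s)
    (hd : ∀ y ∈ s, DifferentiableAt ℝ ρ y) {y z : F} (hy : y ∈ s) (hz : z ∈ s) :
    |ρ z - ρ y - fderiv ℝ ρ y (z - y)| ≤ K * ‖z - y‖ ^ 2 := by
  have hseg : segment ℝ y z ⊆ s := hs.segment_subset hy hz
  have h := (convex_segment y z).norm_image_sub_le_of_norm_hasFDerivWithin_le' (f := ρ)
    (f' := fderiv ℝ ρ) (φ := fderiv ℝ ρ y) (C := K * ‖z - y‖)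
    (fun w hw => (hd w (hseg hw)).hasFDerivAt.hasFDerivWithinAt) (fun w hw => by
      refine (hK.norm_sub_le (hseg hw) hy).trans ?_
      gcongr
      exact norm_sub_le_of_mem_segment hw)
    (left_mem_segment ℝ y z) (right_mem_segment ℝ y z)
  rw [Real.norm_eq_abs] at h
  refine h.trans (le_of_eq (by ring))

variable {n : ℕ} {Ω : Set (EuclideanSpace ℝ (Fin n))}

/-- A defining function is linear at y up to an error K|z - y|², by the Lipschitz bound on its
derivative. In a small ball tangent at y on the side of ∓∇ρ, the linear term dominates this error
and fixes the sign of ρ. -/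
theorem exists_spheres_nhds (hΩ : IsOpen Ω) (hs : HasSmoothBoundary Ω)
    {x : EuclideanSpace ℝ (Fin n)} (hx : x ∈ frontier Ω) :
    ∃ V ∈ nhds x, ∃ r₀ > 0, ∀ y ∈ V ∩ frontier Ω, ∀ r, 0 < r → r ≤ r₀ →
      (∃ c, dist y c = r ∧ Metric.ball c r ⊆ Ω) ∧
      (∃ c, dist y c = r ∧ Metric.ball c r ⊆ Ωᶜ) := by
  obtain ⟨U, ρ, hU, hxU, hρ, hgrad, hΩU⟩ := hs x hx
  have hρx : ContDiffAt ℝ ∞ ρ x := hρ.contDiffAt (hU.mem_nhds hxU)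
  have hmem : ∀ z ∈ U, (z ∈ Ω ↔ ρ z < 0) := fun z hz => by
    have := Set.ext_iff.1 hΩU z
    constructor
    · intro h; exact (this.1 ⟨h, hz⟩).2
    · intro h; exact (this.2 ⟨hz, h⟩).1
  have hfd : ContDiffAt ℝ 1 (fderiv ℝ ρ) x := hρx.fderiv_right (m := 1) (by
    exact WithTop.coe_le_coe.2 (le_top (a := (1 + 1 : ℕ∞))))
  obtain ⟨K, t, ht, hK⟩ := hfd.exists_lipschitzOnWith
  set m := ‖fderiv ℝ ρ x‖ / 2 with hm
  have hm0 : 0 < m := half_pos (norm_pos_iff.2 (hgrad x hxU))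
  have hbig : ∀ᶠ y in nhds x, m < ‖fderiv ℝ ρ y‖ :=
    hfd.continuousAt.norm.eventually_const_lt (half_lt_self (norm_pos_iff.2 (hgrad x hxU)))
  obtain ⟨δ, hδ, hball⟩ := Metric.mem_nhds_iff.1
    (Filter.inter_mem (Filter.inter_mem ht (hU.mem_nhds hxU)) hbig)
  refine ⟨Metric.ball x (δ / 2), Metric.ball_mem_nhds x (half_pos hδ),
    min (δ / 4) (m / (2 * (K + 1))), by positivity, ?_⟩
  rintro y ⟨hy, hyf⟩ r hr hrr
  have hyδ : y ∈ Metric.ball x δ := Metric.ball_subset_ball (by linarith) hy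
  have hyU : y ∈ U := (hball hyδ).1.2
  have hcont : ContinuousAt ρ y := (hρ.contDiffAt (hU.mem_nhds hyU)).continuousAt
  have hρy : ρ y = 0 := by
    refine le_antisymm ?_ ?_
    · by_contra hpos
      have h1 : ∀ᶠ z in nhds y, z ∈ U ∧ 0 < ρ z :=
        (hU.eventually_mem hyU).and (hcont.eventually_const_lt (not_le.1 hpos))
      obtain ⟨z, hz, hzΩ⟩ := mem_closure_iff_nhds.1 (frontier_subset_closure hyf) _ h1
      exact lt_asymm hz.2 ((hmem z hz.1).1 hzΩ)
    · by_contra hneg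
      rw [hΩ.frontier_eq] at hyf
      exact hyf.2 ((hmem y hyU).2 (not_le.1 hneg))
  set g := (InnerProductSpace.toDual ℝ (EuclideanSpace ℝ (Fin n))).symm (fderiv ℝ ρ y) with hg
  have hgi : ∀ v, inner ℝ g v = fderiv ℝ ρ y v := fun v => by
    rw [hg, InnerProductSpace.toDual_symm_apply]
  have hgm : m < ‖g‖ := by
    rw [hg, LinearIsometryEquiv.norm_map]; exact (hball hyδ).2
  have hg0 : 0 < ‖g‖ := hm0.trans hgm
  have hr1 : r ≤ δ / 4 := hrr.trans (min_le_left _ _)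
  have hr2 : r * (2 * (K + 1)) ≤ m := by
    rw [← le_div_iff₀ (by positivity)]; exact hrr.trans (min_le_right _ _)
  -- The bound on r is chosen for this: the bending of the sphere, scaled by the gradient, exceeds
  -- the Taylor constant K.
  have hKr : K < ‖g‖ / (2 * r) := by
    rw [lt_div_iff₀ (by positivity)]
    have : (K : ℝ) * (2 * r) < r * (2 * (K + 1)) := by linarith
    linarith
  have hest : ∀ z, ‖z - y‖ < 2 * r →
      z ∈ U ∧ |ρ z - inner ℝ g (z - y)| ≤ K * ‖z - y‖ ^ 2 := by
    intro z hz
    have hzδ : z ∈ Metric.ball x δ := by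
      rw [Metric.mem_ball] at hy ⊢
      have := dist_triangle z y x
      rw [dist_eq_norm z y] at this
      linarith
    refine ⟨(hball hzδ).1.2, ?_⟩
    have := norm_sub_sub_fderiv_le (convex_ball x δ)
      (hK.mono fun w hw => (hball hw).1.1)
      (fun w hw => (hρ.contDiffAt (hU.mem_nhds (hball hw).1.2)).differentiableAt (by simp))
      hyδ hzδ
    rwa [hρy, sub_zero, ← hgi] at this
  have hnorm : ∀ s : ℝ, |s| = 1 → ‖(s * (r / ‖g‖)) • g‖ = r := by
    intro s hs
    rw [norm_smul, Real.norm_eq_abs, abs_mul, hs, one_mul, abs_of_pos (div_pos hr hg0),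
      div_mul_cancel₀ _ hg0.ne']
  have hkey : ∀ s : ℝ, |s| = 1 → ∀ z ∈ Metric.ball (y + (s * (r / ‖g‖)) • g) r,
      ‖z - y‖ < 2 * r ∧ ‖g‖ / (2 * r) * ‖z - y‖ ^ 2 < s * inner ℝ g (z - y) ∧ 0 < ‖z - y‖ := by
    intro s hs z hz
    have h1 := (add_smul_mem_ball_iff hr (hnorm s hs)).1 hz
    have h4 : 0 < ‖z - y‖ := by
      rw [norm_pos_iff]
      intro h0
      rw [h0] at h1
      simp at h1
    rw [real_inner_smul_left] at h1
    refine ⟨?_, ?_, h4⟩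
    · rw [mem_ball_iff_norm] at hz
      calc ‖z - y‖ = ‖(z - (y + (s * (r / ‖g‖)) • g)) + (s * (r / ‖g‖)) • g‖ := by
            congr 1; abel
        _ ≤ ‖z - (y + (s * (r / ‖g‖)) • g)‖ + ‖(s * (r / ‖g‖)) • g‖ := norm_add_le _ _
        _ < 2 * r := by rw [hnorm s hs]; linarith
    · have h2 : s * inner ℝ g (z - y) =
          ‖g‖ / (2 * r) * (2 * (s * (r / ‖g‖) * inner ℝ g (z - y))) := by field_simp
      rw [h2]
      exact mul_lt_mul_of_pos_left h1 (by positivity)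
  refine ⟨⟨y + ((-1) * (r / ‖g‖)) • g, ?_, fun z hz => ?_⟩,
    ⟨y + (1 * (r / ‖g‖)) • g, ?_, fun z hz => ?_⟩⟩
  · rw [dist_self_add_right, hnorm _ (by simp)]
  · obtain ⟨h1, h2, h3⟩ := hkey (-1) (by simp) z hz
    obtain ⟨h4, h5⟩ := hest z h1
    rw [hmem z h4]
    have h6 := (abs_le.1 h5).2
    have h7 := mul_lt_mul_of_pos_right hKr (pow_pos h3 2)
    linarith
  · rw [dist_self_add_right, hnorm _ (by simp)]
  · obtain ⟨h1, h2, h3⟩ := hkey 1 (by simp) z hz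
    obtain ⟨h4, h5⟩ := hest z h1
    rw [Set.mem_compl_iff, hmem z h4]
    have h6 := (abs_le.1 h5).1
    have h7 := mul_lt_mul_of_pos_right hKr (pow_pos h3 2)
    linarith

theorem mem_exteriorRadii_iff {r : ℝ} : r ∈ exteriorRadii Ω ↔
    0 < r ∧ ∀ x ∈ frontier Ω, ∃ c, dist x c = r ∧ Metric.ball c r ⊆ Ωᶜ := by
  simp only [exteriorRadii, Set.mem_ofPred_eq, Set.subset_compl_iff_disjoint_right]

/-- Compactness of the boundary. The local property is stated for every radius up to r₀, so that two
neighbourhoods combine by taking the smaller bound. The same r serves both sides. -/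
theorem exists_mem_radii (hΩ : IsOpen Ω) (hb : Bornology.IsBounded Ω) (hs : HasSmoothBoundary Ω) :
    ∃ r, r ∈ interiorRadii Ω ∧ r ∈ exteriorRadii Ω := by
  have h : ∃ r₀ > 0, ∀ y ∈ frontier Ω ∩ frontier Ω, ∀ r, 0 < r → r ≤ r₀ →
      (∃ c, dist y c = r ∧ Metric.ball c r ⊆ Ω) ∧
      (∃ c, dist y c = r ∧ Metric.ball c r ⊆ Ωᶜ) := by
    refine (isCompact_frontier_of_isBounded hb).induction_on
      (p := fun V => ∃ r₀ > 0, ∀ y ∈ V ∩ frontier Ω, ∀ r, 0 < r → r ≤ r₀ →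
        (∃ c, dist y c = r ∧ Metric.ball c r ⊆ Ω) ∧
        (∃ c, dist y c = r ∧ Metric.ball c r ⊆ Ωᶜ)) ?_ ?_ ?_ ?_
    · exact ⟨1, one_pos, fun y hy => absurd hy.1 (Set.notMem_empty y)⟩
    · rintro s t hst ⟨r₀, hr₀, h⟩
      exact ⟨r₀, hr₀, fun y hy => h y ⟨hst hy.1, hy.2⟩⟩
    · rintro s t ⟨r₀, hr₀, h⟩ ⟨r₁, hr₁, h'⟩
      refine ⟨min r₀ r₁, lt_min hr₀ hr₁, fun y hy r hr hrr => ?_⟩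
      rcases hy.1 with hy1 | hy1
      · exact h y ⟨hy1, hy.2⟩ r hr (hrr.trans (min_le_left _ _))
      · exact h' y ⟨hy1, hy.2⟩ r hr (hrr.trans (min_le_right _ _))
    · intro x hx
      obtain ⟨V, hV, h⟩ := exists_spheres_nhds hΩ hs hx
      exact ⟨V, mem_nhdsWithin_of_mem_nhds hV, h⟩
  obtain ⟨r, hr, h⟩ := h
  exact ⟨r, ⟨hr, fun x hx => (h x ⟨hx, hx⟩ r hr le_rfl).1⟩,
    mem_exteriorRadii_iff.2 ⟨hr, fun x hx => (h x ⟨hx, hx⟩ r hr le_rfl).2⟩⟩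

/-- Choose admissible radii converging to the supremum; their centres subconverge, and a point of
the open limit ball lies in one of the approximating balls. Taking T to be Ω or its complement
covers both kinds of spheres. -/
theorem exists_isGreatest_radii {A T : Set (EuclideanSpace ℝ (Fin n))}
    (hne : {r | 0 < r ∧ ∀ x ∈ A, ∃ c, dist x c = r ∧ Metric.ball c r ⊆ T}.Nonempty)
    (hbdd : BddAbove {r | 0 < r ∧ ∀ x ∈ A, ∃ c, dist x c = r ∧ Metric.ball c r ⊆ T}) :
    ∃ r, IsGreatest {r | 0 < r ∧ ∀ x ∈ A, ∃ c, dist x c = r ∧ Metric.ball c r ⊆ T} r := by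
  set S := {r | 0 < r ∧ ∀ x ∈ A, ∃ c, dist x c = r ∧ Metric.ball c r ⊆ T} with hS
  refine ⟨sSup S, ⟨?_, fun x hx => ?_⟩, fun r hr => le_csSup hbdd hr⟩
  · obtain ⟨r, hr⟩ := hne
    exact hr.1.trans_le (le_csSup hbdd hr)
  obtain ⟨r, -, hrt, hrS⟩ := exists_seq_tendsto_sSup hne hbdd
  choose c hc hcT using fun k => (hrS k).2 x hx
  have hcb : ∀ k, c k ∈ Metric.closedBall x (sSup S) := fun k => by
    rw [Metric.mem_closedBall, dist_comm, hc k]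
    exact le_csSup hbdd (hrS k)
  obtain ⟨a, -, φ, hφ, hca⟩ := (isCompact_closedBall x (sSup S)).tendsto_subseq hcb
  have hrφ : Filter.Tendsto (fun k => r (φ k)) Filter.atTop (nhds (sSup S)) :=
    hrt.comp hφ.tendsto_atTop
  refine ⟨a, ?_, fun z hz => ?_⟩
  · have h1 : Filter.Tendsto (fun k => dist x (c (φ k))) Filter.atTop (nhds (dist x a)) :=
      tendsto_const_nhds.dist hca
    simp only [hc] at h1
    exact tendsto_nhds_unique h1 hrφ
  · have h1 : Filter.Tendsto (fun k => dist z (c (φ k))) Filter.atTop (nhds (dist z a)) :=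
      tendsto_const_nhds.dist hca
    obtain ⟨k, hk⟩ := (h1.eventually_lt hrφ hz).exists
    exact hcT _ hk

theorem bddAbove_interiorRadii (hn : 1 ≤ n) (hne : Ω.Nonempty) (hb : Bornology.IsBounded Ω) :
    BddAbove (interiorRadii Ω) := by
  obtain ⟨x, hx⟩ := frontier_nonempty hn hne hb
  refine ⟨Metric.diam Ω, fun r hr => ?_⟩
  obtain ⟨c, -, hcb⟩ := hr.2 x hx
  have hr0 := hr.1
  set e : EuclideanSpace ℝ (Fin n) := EuclideanSpace.single ⟨0, hn⟩ 1 with he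
  have hen : ‖e‖ = 1 := by simp [he]
  have h1 : ∀ s : ℝ, |s| = 1 → c + (s * (r / 2)) • e ∈ Ω := fun s hs => by
    refine hcb ?_
    rw [mem_ball_iff_norm, add_sub_cancel_left, norm_smul, hen, Real.norm_eq_abs, abs_mul, hs,
      abs_of_pos (half_pos hr0)]
    linarith
  have h2 := Metric.dist_le_diam_of_mem hb (h1 1 (by simp)) (h1 (-1) (by simp))
  refine le_trans (le_of_eq ?_) h2
  rw [dist_eq_norm, add_sub_add_left_eq_sub, ← sub_smul, norm_smul, hen, Real.norm_eq_abs,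
    abs_of_pos (by linarith)]
  ring

theorem exists_isGreatest_interiorRadii (hn : 1 ≤ n) (hΩ : IsOpen Ω) (hne : Ω.Nonempty)
    (hb : Bornology.IsBounded Ω) (hs : HasSmoothBoundary Ω) :
    ∃ r, IsGreatest (interiorRadii Ω) r := by
  obtain ⟨r, hr, -⟩ := exists_mem_radii hΩ hb hs
  exact exists_isGreatest_radii ⟨r, hr⟩ (bddAbove_interiorRadii hn hne hb)

theorem exists_isGreatest_exteriorRadii (hΩ : IsOpen Ω)
    (hb : Bornology.IsBounded Ω) (hs : HasSmoothBoundary Ω) (hbdd : BddAbove (exteriorRadii Ω)) :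
    ∃ r, IsGreatest (exteriorRadii Ω) r := by
  obtain ⟨r, -, hr⟩ := exists_mem_radii hΩ hb hs
  have h : exteriorRadii Ω =
      {r | 0 < r ∧ ∀ x ∈ frontier Ω, ∃ c, dist x c = r ∧ Metric.ball c r ⊆ Ωᶜ} :=
    Set.ext fun r => mem_exteriorRadii_iff
  rw [h] at hbdd hr ⊢
  exact exists_isGreatest_radii ⟨r, hr⟩ hbdd

/-- An interior and an exterior sphere at the same boundary point are tangent. -/
theorem sub_eq_neg_smul_of_balls {x c c' : EuclideanSpace ℝ (Fin n)} {r r' : ℝ} (hr : 0 < r)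
    (hr' : 0 < r') (hc : dist x c = r) (hc' : dist x c' = r') (h : Metric.ball c r ⊆ Ω)
    (h' : Metric.ball c' r' ⊆ Ωᶜ) : c' - x = -(r' / r) • (c - x) := by
  have hdis : Disjoint (Metric.ball c r) (Metric.ball c' r') :=
    (Set.subset_compl_iff_disjoint_right.1 h').symm.mono_left h
  rw [disjoint_ball_ball_iff hr hr', dist_eq_norm] at hdis
  have ha : ‖c - x‖ = r := by rw [← dist_eq_norm, dist_comm, hc]
  have hb : ‖c' - x‖ = r' := by rw [← dist_eq_norm, dist_comm, hc']
  set a := c - x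
  set b := c' - x
  have hab : c - c' = a - b := by simp [a, b]
  rw [hab] at hdis
  have h1 : (r + r') ^ 2 ≤ ‖a - b‖ ^ 2 := by gcongr
  rw [norm_sub_sq_real, ha, hb] at h1
  -- The equality case of the triangle inequality: disjointness gives |a - b| ≥ r + r' = |a| + |b|,
  -- so a and b are opposite.
  have h2 : ‖r • b + r' • a‖ ^ 2 ≤ 0 := by
    rw [norm_add_sq_real, norm_smul, norm_smul, real_inner_smul_left, real_inner_smul_right, ha, hb,
      Real.norm_of_nonneg hr.le, Real.norm_of_nonneg hr'.le, real_inner_comm]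
    have h3 : inner ℝ a b ≤ -(r * r') := by nlinarith
    nlinarith [mul_le_mul_of_nonneg_left h3 (mul_pos hr hr').le]
  have h3 : r • b + r' • a = 0 := by
    rw [← norm_eq_zero]
    exact pow_eq_zero_iff (two_ne_zero) |>.1 (le_antisymm h2 (sq_nonneg _))
  have h4 : b = r⁻¹ • (r • b) := by rw [smul_smul, inv_mul_cancel₀ hr.ne', one_smul]
  rw [h4, eq_neg_of_add_eq_zero_left h3, smul_neg, smul_smul, neg_smul]
  congr 2
  ring

/-- A function that attains its minimum over a ball at a boundary point has its gradient there
pointing to the centre. -/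
theorem fderiv_eq_of_ball {F : Type*} [NormedAddCommGroup F] [InnerProductSpace ℝ F] {u : F → ℝ}
    {x a : F} (ha : a ≠ 0) (hu : DifferentiableAt ℝ u x)
    (h : ∀ z ∈ Metric.ball (x + a) ‖a‖, u x ≤ u z) :
    0 ≤ fderiv ℝ u x a ∧ ∀ ξ, fderiv ℝ u x ξ = fderiv ℝ u x a / ‖a‖ ^ 2 * inner ℝ a ξ := by
  have hr := norm_pos_iff.2 ha
  have hpos : ∀ ξ, 0 < inner ℝ a ξ → 0 ≤ fderiv ℝ u x ξ := by
    intro ξ hξ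
    have h1 : HasDerivAt (fun t : ℝ => u (x + t • ξ)) (fderiv ℝ u x ξ) 0 := by
      have h2 : HasDerivAt (fun t : ℝ => x + t • ξ) ξ 0 := by
        simpa using ((hasDerivAt_id (0 : ℝ)).smul_const ξ).const_add x
      have h3 : HasFDerivAt u (fderiv ℝ u x) (x + (0 : ℝ) • ξ) := by simpa using hu.hasFDerivAt
      exact h3.comp_hasDerivAt (0 : ℝ) h2
    refine ge_of_tendsto h1.tendsto_slope_zero_right ?_
    have h4 : Set.Ioo (0 : ℝ) (2 * inner ℝ a ξ / (‖ξ‖ ^ 2 + 1)) ∈ nhdsWithin 0 (Set.Ioi 0) :=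
      Ioo_mem_nhdsGT (by positivity)
    filter_upwards [h4] with t ht
    have h5 : x + t • ξ ∈ Metric.ball (x + a) ‖a‖ := by
      rw [add_smul_mem_ball_iff hr rfl, add_sub_cancel_left, norm_smul, mul_pow,
        real_inner_smul_right, Real.norm_eq_abs, sq_abs]
      have h6 := (lt_div_iff₀ (by positivity)).1 ht.2
      have h7 : t * ‖ξ‖ ^ 2 < 2 * inner ℝ a ξ := by nlinarith [ht.1]
      nlinarith [mul_lt_mul_of_pos_left h7 ht.1]
    have h6 := h _ h5
    simp only [zero_add, zero_smul, add_zero, smul_eq_mul]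
    exact mul_nonneg (inv_nonneg.2 ht.1.le) (by linarith)
  have haa : 0 < inner ℝ a a := by rw [real_inner_self_eq_norm_sq]; positivity
  -- Tangential directions are limits of directions entering the ball. Applied to ±η this kills the
  -- tangential derivative.
  have horth : ∀ ξ, inner ℝ a ξ = 0 → 0 ≤ fderiv ℝ u x ξ := by
    intro ξ hξ
    refine le_of_forall_pos_le_add fun δ hδ => ?_
    have h1 := hpos (ξ + (δ / (fderiv ℝ u x a + 1)) • a) (by
      rw [inner_add_right, hξ, real_inner_smul_right, zero_add]
      have := hpos a haa
      positivity)
    have h2 := hpos a haa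
    rw [map_add, map_smul, smul_eq_mul] at h1
    have h3 : δ / (fderiv ℝ u x a + 1) * fderiv ℝ u x a ≤ δ := by
      rw [div_mul_eq_mul_div, div_le_iff₀ (by positivity)]
      nlinarith
    linarith
  refine ⟨hpos a haa, fun ξ => ?_⟩
  set η := ξ - (inner ℝ a ξ / ‖a‖ ^ 2) • a with hη
  have h0 : inner ℝ a η = 0 := by
    rw [hη, inner_sub_right, real_inner_smul_right, real_inner_self_eq_norm_sq]
    field_simp
    ring
  have h1 : fderiv ℝ u x η = 0 := by
    refine le_antisymm ?_ (horth η h0)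
    have := horth (-η) (by rw [inner_neg_right, h0, neg_zero])
    rw [map_neg] at this
    linarith
  have h2 : ξ = η + (inner ℝ a ξ / ‖a‖ ^ 2) • a := by rw [hη]; abel
  conv_lhs => rw [h2, map_add, h1, map_smul, smul_eq_mul]
  ring

end Spheres


/-! ### Barriers -/

section Barriers

variable {n : ℕ} {u : EuclideanSpace ℝ (Fin n) → ℝ} {x : EuclideanSpace ℝ (Fin n)}
  {f : (Fin n → ℝ) → ℝ} {σ : ℝ} {Ω : Set (EuclideanSpace ℝ (Fin n))}

theorem norm_sq_eq_dotProduct (ξ : EuclideanSpace ℝ (Fin n)) :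
    ‖ξ‖ ^ 2 = ξ.ofLp ⬝ᵥ ξ.ofLp := by
  rw [EuclideanSpace.real_norm_sq_eq, dotProduct]
  exact Finset.sum_congr rfl fun i _ => by ring

theorem sq_fderiv_le (u : EuclideanSpace ℝ (Fin n) → ℝ) (x ξ : EuclideanSpace ℝ (Fin n)) :
    fderiv ℝ u x ξ ^ 2 ≤ gradSq u x * ‖ξ‖ ^ 2 := by
  rw [fderiv_eq_sum_pd, EuclideanSpace.real_norm_sq_eq, mul_comm]
  exact Finset.sum_mul_sq_le_sq_mul_sq _ _ _

theorem gradSq_eq_of_fderiv_eq {a : EuclideanSpace ℝ (Fin n)} {k : ℝ}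
    (h : ∀ ξ, fderiv ℝ u x ξ = k * inner ℝ a ξ) : gradSq u x = k ^ 2 * ‖a‖ ^ 2 := by
  have h1 : ∀ i, pd i u x = k * a i := fun i => by
    rw [pd, h, EuclideanSpace.inner_single_right]
    simp
  simp only [gradSq, h1, EuclideanSpace.real_norm_sq_eq, Finset.mul_sum, mul_pow]

/-- A principal frame, in terms of the derivatives of `u`. -/
theorem IsSolution.exists_frame (hf : IsCurvatureFunction f) (h : IsSolution f σ Ω u)
    (hΩ : IsOpen Ω) (hx : x ∈ Ω) :
    ∃ (ξ : Fin n → EuclideanSpace ℝ (Fin n)) (κ : Fin n → ℝ), κ ∈ posCone n ∧ f κ = σ ∧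
      (∀ k, ‖ξ k‖ ^ 2 - fderiv ℝ u x (ξ k) ^ 2 = u x ^ 2) ∧
      (∀ k, secondDeriv u x (ξ k) = u x * (1 - κ k * Real.sqrt (1 - gradSq u x))) ∧
      ∀ η, u x ^ 2 * ‖η‖ ^ 2 ≤ ∑ k, inner ℝ (ξ k) η ^ 2 := by
  have hr := h.regularNear hΩ hx
  obtain ⟨κ, hκ, -⟩ := h.curvature x hx
  obtain ⟨hκ0, hκσ⟩ := h.curvature_of_isPrincipalCurvatures hf hx hκ
  obtain ⟨Q, hQ⟩ := hr.exists_isPrincipalFrame hκ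
  have hu := hr.pos_self
  have hp : ∀ ξ : EuclideanSpace ℝ (Fin n), halfSqGrad u x ⬝ᵥ ξ.ofLp = u x * fderiv ℝ u x ξ := by
    intro ξ
    rw [fderiv_eq_sum_pd, Finset.mul_sum, dotProduct]
    exact Finset.sum_congr rfl fun i _ => by rw [hr.halfSqGrad_eq]; ring
  have hg : ∀ k, ‖WithLp.toLp 2 fun i => Q i k‖ ^ 2 -
      fderiv ℝ u x (WithLp.toLp 2 fun i => Q i k) ^ 2 = u x ^ 2 := by
    intro k
    have h1 := congrFun (congrFun hQ.orthonormal k) k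
    rw [transpose_mul_mul_apply, hr.inducedMetric_eq, one_apply_eq, sub_mulVec, smul_mulVec,
      smul_mulVec, one_mulVec, dotProduct_sub, dotProduct_smul, dotProduct_smul,
      dotProduct_vecMulVec_mulVec, hp (WithLp.toLp 2 fun i => Q i k), smul_eq_mul, smul_eq_mul]
      at h1
    rw [norm_sq_eq_dotProduct]
    field_simp at h1
    linarith
  refine ⟨fun k => WithLp.toLp 2 fun i => Q i k, κ, hκ0, hκσ, hg, fun k => ?_, fun η => ?_⟩
  · have h1 := congrFun (congrFun hQ.diagonal k) k
    rw [transpose_mul_mul_apply, diagonal_apply_eq] at h1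
    have h2 : secondFundForm u x = (u x ^ 2 * Real.sqrt (1 - gradSq u x))⁻¹ •
        ((1 : Matrix (Fin n) (Fin n) ℝ) - vecMulVec (fun i => pd i u x) (fun i => pd i u x) -
          u x • Matrix.of fun i j => pd i (pd j u) x) := by
      ext i j
      rw [hr.secondFundForm_apply]
      simp only [Matrix.smul_apply, Matrix.sub_apply, one_apply, vecMulVec_apply, of_apply,
        smul_eq_mul]
      rw [div_eq_inv_mul]
    have h3 : secondDeriv u x (WithLp.toLp 2 fun i => Q i k) =
        (fun i => Q i k) ⬝ᵥ ((Matrix.of fun i j => pd i (pd j u) x) *ᵥ fun i => Q i k) := by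
      rw [secondDeriv_eq_sum hr.contDiffAt]
      simp only [dotProduct, mulVec, of_apply, Finset.mul_sum]
      exact Finset.sum_congr rfl fun i _ => Finset.sum_congr rfl fun j _ => by ring
    have h4 : (fun i => pd i u x) ⬝ᵥ (fun i => Q i k) =
        fderiv ℝ u x (WithLp.toLp 2 fun i => Q i k) := by
      rw [fderiv_eq_sum_pd, dotProduct]
      exact Finset.sum_congr rfl fun i _ => by ring
    rw [h2] at h1
    simp only [smul_mulVec, sub_mulVec, one_mulVec, dotProduct_smul, dotProduct_sub,
      dotProduct_vecMulVec_mulVec, h4, ← h3, smul_eq_mul] at h1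
    have h5 := hg k
    rw [norm_sq_eq_dotProduct] at h5
    have hw := hr.sqrt_pos
    have h6 : (fun i => Q i k) ⬝ᵥ (fun i => Q i k) -
        fderiv ℝ u x (WithLp.toLp 2 fun i => Q i k) * fderiv ℝ u x (WithLp.toLp 2 fun i => Q i k) =
        u x ^ 2 := by rw [← h5]; simp [pow_two]
    rw [h6, inv_mul_eq_iff_eq_mul₀ (by positivity)] at h1
    have h7 : u x * secondDeriv u x (WithLp.toLp 2 fun i => Q i k) =
        u x * (u x * (1 - κ k * Real.sqrt (1 - gradSq u x))) := by linarith
    exact mul_left_cancel₀ hu.ne' h7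
  -- The sum of squares is g⁻¹(η, η), and g⁻¹ is u² times the identity plus a nonnegative rank one
  -- term.
  · have hinv : (inducedMetric u x)⁻¹ = Q * Qᵀ := by
      refine inv_eq_left_inv ?_
      rw [Matrix.mul_assoc]
      exact mul_eq_one_comm.1 hQ.orthonormal
    have h1 : ∑ k, inner ℝ (WithLp.toLp 2 fun i => Q i k) η ^ 2 =
        η.ofLp ⬝ᵥ ((Q * Qᵀ) *ᵥ η.ofLp) := by
      rw [← mulVec_mulVec, dotProduct_mulVec, ← mulVec_transpose, dotProduct]
      refine Finset.sum_congr rfl fun k _ => ?_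
      have : inner ℝ (WithLp.toLp 2 fun i => Q i k) η = (Qᵀ *ᵥ η.ofLp) k := by
        simp [PiLp.inner_apply, mulVec, dotProduct, mul_comm]
      rw [this]; ring
    rw [h1, ← hinv, hr.inducedMetric_inv, smul_mulVec, add_mulVec, one_mulVec, smul_mulVec,
      dotProduct_smul, dotProduct_add, dotProduct_smul, dotProduct_vecMulVec_mulVec,
      norm_sq_eq_dotProduct, smul_eq_mul, smul_eq_mul]
    have h2 : 0 ≤ nuQuot u x ^ 2 *
        (halfSqGrad u x ⬝ᵥ η.ofLp * halfSqGrad u x ⬝ᵥ η.ofLp) :=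
      mul_nonneg (sq_nonneg _) (mul_self_nonneg _)
    nlinarith [mul_nonneg (sq_nonneg (u x)) h2]

/-- Touching an umbilic hyperboloid from above (`s = 1`) or below (`s = -1`). -/
theorem principalCurvature_le_of_touching {ξ c : EuclideanSpace ℝ (Fin n)} {R τ s κ : ℝ}
    (hu : ContDiffAt ℝ ∞ u x) (hpos : 0 < u x) (hs : s ^ 2 = 1) (hR : 0 < R)
    (hA : 0 < τ * R - s * u x)
    (heq : (τ * R - s * u x) ^ 2 = R ^ 2 + ‖x - c‖ ^ 2)
    (hmax : IsLocalMax (fun z => (τ * R - s * u z) ^ 2 - ‖z - c‖ ^ 2) x)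
    (hg : ‖ξ‖ ^ 2 - fderiv ℝ u x ξ ^ 2 = u x ^ 2)
    (hh : secondDeriv u x ξ = u x * (1 - κ * Real.sqrt (1 - gradSq u x))) :
    s * κ ≤ s * τ := by
  set A := τ * R - s * u x with hAdef
  set Ψ : EuclideanSpace ℝ (Fin n) → ℝ := fun z => (τ * R - s * u z) ^ 2 - ‖z - c‖ ^ 2 with hΨ
  have hud : ∀ᶠ z in nhds x, DifferentiableAt ℝ u z :=
    ((hu.of_le (m := 1) (by simp)).eventually (by simp)).mono fun y hy =>
      hy.differentiableAt (by simp)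
  have hΨsm : ContDiffAt ℝ ∞ Ψ x :=
    ((contDiffAt_const.sub (contDiffAt_const.mul hu)).pow 2).sub
      ((contDiffAt_id.sub contDiffAt_const).norm_sq ℝ)
  have hfd : ∀ᶠ z in nhds x, ∀ η, fderiv ℝ Ψ z η =
      -2 * s * (τ * R - s * u z) * fderiv ℝ u z η - 2 * inner ℝ (z - c) η := by
    filter_upwards [hud] with z hz η
    have h1 : HasFDerivAt Ψ _ z :=
      (((hz.hasFDerivAt.const_mul s).const_sub (τ * R)).pow 2).sub
        ((hasFDerivAt_id z).sub_const c).norm_sq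
    rw [h1.fderiv]
    simp [inner_sub_left]
    ring
  have hgrad : ∀ η, -2 * s * A * fderiv ℝ u x η - 2 * inner ℝ (x - c) η = 0 := fun η => by
    rw [← hfd.self_of_nhds η, hmax.fderiv_eq_zero]; rfl
  have hDu : ∀ η, fderiv ℝ u x η = (-s / A) * inner ℝ (x - c) η := fun η => by
    have h1 := hgrad η
    have h2 : inner ℝ (x - c) η = -s * A * fderiv ℝ u x η := by linarith
    rw [h2]
    field_simp
    rw [hs, mul_one]
  have hgs := gradSq_eq_of_fderiv_eq hDu
  have hgA : A ^ 2 * gradSq u x = ‖x - c‖ ^ 2 := by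
    rw [hgs, div_pow, neg_sq, hs]
    field_simp
  -- At the contact point the gradients of u and of the hyperboloid agree, so the factor √(1 -
  -- |∇u|²) is that of the hyperboloid.
  have hAw : A * Real.sqrt (1 - gradSq u x) = R := by
    have h1 : 1 - gradSq u x = (R / A) ^ 2 := by
      rw [div_pow, eq_div_iff (by positivity)]
      linarith
    rw [h1, Real.sqrt_sq (by positivity)]
    field_simp
  have hsec := secondDeriv_nonpos_of_isLocalMax hΨsm hmax ξ
  have hsd : secondDeriv Ψ x ξ =
      2 * fderiv ℝ u x ξ ^ 2 - 2 * s * A * secondDeriv u x ξ - 2 * ‖ξ‖ ^ 2 := by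
    have h1 : (fun z => fderiv ℝ Ψ z ξ) =ᶠ[nhds x] fun z =>
        -2 * s * (τ * R - s * u z) * fderiv ℝ u z ξ - 2 * inner ℝ (z - c) ξ :=
      hfd.mono fun z hz => hz ξ
    have h2 : HasFDerivAt (fun z => fderiv ℝ u z ξ) (fderiv ℝ (fun z => fderiv ℝ u z ξ) x) x :=
      (((hu.fderiv_right (m := ∞) (by simp)).clm_apply contDiffAt_const).differentiableAt
        (by simp)).hasFDerivAt
    have h3 := ((((hud.self_of_nhds.hasFDerivAt.const_mul s).const_sub (τ * R)).const_mul
      (-2 * s)).mul h2).sub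
      ((((hasFDerivAt_id x).sub_const c).inner ℝ (hasFDerivAt_const ξ x)).const_mul 2)
    have h4 := h3.congr_of_eventuallyEq h1
    rw [secondDeriv, h4.fderiv]
    simp [secondDeriv]
    linear_combination (2 * fderiv ℝ u x ξ ^ 2) * hs
  rw [hsd, hh] at hsec
  have h1 : -(s * A) * (1 - κ * Real.sqrt (1 - gradSq u x)) ≤ u x := by
    have h2 : u x * (-(s * A) * (1 - κ * Real.sqrt (1 - gradSq u x))) ≤ u x * u x := by
      nlinarith
    exact le_of_mul_le_mul_left h2 hpos
  have h2 : s * κ * R ≤ s * τ * R := by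
    have h3 : -(s * A) * (1 - κ * Real.sqrt (1 - gradSq u x)) =
        s * κ * (A * Real.sqrt (1 - gradSq u x)) - s * A := by ring
    rw [h3, hAw, hAdef] at h1
    have h4 : s * (τ * R - s * u x) = s * τ * R - u x := by
      linear_combination (-u x) * hs
    linarith
  exact le_of_mul_le_mul_right h2 hR

/-- The radius `R` for which `t = τ R - √(R² + ρ²)`. -/
noncomputable def coneRadius (τ t ρ : ℝ) : ℝ :=
  (τ * t + Real.sqrt (t ^ 2 + (τ ^ 2 - 1) * ρ ^ 2)) / (τ ^ 2 - 1)

/-- Squaring gives a quadratic for R, of which `coneRadius` is the larger root. Since τ > 1, it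
satisfies τR - t ≥ 0, so the positive branch of the square root is the right one. -/
theorem coneRadius_spec {τ : ℝ} (hτ : 1 < τ) (t ρ : ℝ) :
    τ * coneRadius τ t ρ - Real.sqrt (coneRadius τ t ρ ^ 2 + ρ ^ 2) = t := by
  have h1 : 0 < τ ^ 2 - 1 := by nlinarith
  have h0 : 0 ≤ t ^ 2 + (τ ^ 2 - 1) * ρ ^ 2 := by positivity
  set S := Real.sqrt (t ^ 2 + (τ ^ 2 - 1) * ρ ^ 2) with hS
  have hS2 : S ^ 2 = t ^ 2 + (τ ^ 2 - 1) * ρ ^ 2 := Real.sq_sqrt h0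
  have hSt : |t| ≤ S := by
    rw [hS]
    refine Real.le_sqrt_of_sq_le ?_
    rw [sq_abs]
    nlinarith [mul_nonneg h1.le (sq_nonneg ρ)]
  have hR : coneRadius τ t ρ = (τ * t + S) / (τ ^ 2 - 1) := rfl
  have h2 : τ * coneRadius τ t ρ - t = (t + τ * S) / (τ ^ 2 - 1) := by
    rw [hR]; field_simp; ring
  have h3 : 0 ≤ τ * coneRadius τ t ρ - t := by
    rw [h2]
    refine div_nonneg ?_ h1.le
    have := neg_abs_le t
    have h4 : S ≤ τ * S := le_mul_of_one_le_left (abs_nonneg t |>.trans hSt) hτ.le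
    linarith
  have h4 : coneRadius τ t ρ ^ 2 + ρ ^ 2 = (τ * coneRadius τ t ρ - t) ^ 2 := by
    rw [h2, hR]
    field_simp
    have : ρ ^ 2 * (τ ^ 2 - 1) = S ^ 2 - t ^ 2 := by linarith
    linear_combination (τ ^ 2 - 1) * this
  rw [h4, Real.sqrt_sq h3]
  ring

theorem sqrt_sub_sqrt_le {R R' : ℝ} (h : R ≤ R') (ρ : ℝ) :
    Real.sqrt (R' ^ 2 + ρ ^ 2) ≤ R' - R + Real.sqrt (R ^ 2 + ρ ^ 2) := by
  have h1 : R ≤ Real.sqrt (R ^ 2 + ρ ^ 2) :=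
    Real.le_sqrt_of_sq_le (by nlinarith [sq_nonneg ρ])
  have h2 := Real.sq_sqrt (show 0 ≤ R ^ 2 + ρ ^ 2 by positivity)
  rw [Real.sqrt_le_iff]
  refine ⟨add_nonneg (by linarith) (Real.sqrt_nonneg _), ?_⟩
  nlinarith [mul_nonneg (sub_nonneg.2 h) (sub_nonneg.2 h1)]

/-- The map R ↦ √(R² + ρ²) grows with slope at most 1 < τ. So the hyperboloids of fixed τ are
ordered by R, and comparing heights amounts to comparing radii. -/
theorem cone_mono {τ R R' : ℝ} (hτ : 1 < τ) (h : R ≤ R') (ρ : ℝ) :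
    τ * R - Real.sqrt (R ^ 2 + ρ ^ 2) ≤ τ * R' - Real.sqrt (R' ^ 2 + ρ ^ 2) := by
  have := sqrt_sub_sqrt_le h ρ
  nlinarith

theorem cone_strictMono {τ R R' : ℝ} (hτ : 1 < τ) (h : R < R') (ρ : ℝ) :
    τ * R - Real.sqrt (R ^ 2 + ρ ^ 2) < τ * R' - Real.sqrt (R' ^ 2 + ρ ^ 2) := by
  have := sqrt_sub_sqrt_le h.le ρ
  nlinarith

theorem le_of_cone_le {τ R R' ρ : ℝ} (hτ : 1 < τ)
    (h : τ * R - Real.sqrt (R ^ 2 + ρ ^ 2) ≤ τ * R' - Real.sqrt (R' ^ 2 + ρ ^ 2)) : R ≤ R' := by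
  by_contra hlt
  exact absurd (cone_strictMono hτ (not_le.1 hlt) ρ) (not_lt.2 h)

theorem continuousAt_coneRadius {g : EuclideanSpace ℝ (Fin n) → ℝ} (τ : ℝ)
    (c : EuclideanSpace ℝ (Fin n)) (hg : ContinuousAt g x) :
    ContinuousAt (fun z => coneRadius τ (g z) ‖z - c‖) x := by
  unfold coneRadius
  refine ContinuousAt.div_const ?_ _
  refine (continuousAt_const.mul hg).add (ContinuousAt.sqrt ?_)
  exact (hg.pow 2).add (continuousAt_const.mul
    ((continuousAt_id.sub continuousAt_const).norm.pow 2))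

/-- At a local minimum of the radius function the hyperboloid touches the graph. -/
theorem isLocalMax_of_isLocalMin_coneRadius {τ s : ℝ} {c : EuclideanSpace ℝ (Fin n)}
    (hτ : 1 < τ) (hu : ContinuousAt u x)
    (hR : 0 < coneRadius τ (s * u x) ‖x - c‖)
    (hmin : IsLocalMin (fun z => coneRadius τ (s * u z) ‖z - c‖) x) :
    0 < τ * coneRadius τ (s * u x) ‖x - c‖ - s * u x ∧
    (τ * coneRadius τ (s * u x) ‖x - c‖ - s * u x) ^ 2 =
      coneRadius τ (s * u x) ‖x - c‖ ^ 2 + ‖x - c‖ ^ 2 ∧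
    IsLocalMax (fun z => (τ * coneRadius τ (s * u x) ‖x - c‖ - s * u z) ^ 2 - ‖z - c‖ ^ 2) x := by
  have hspec := coneRadius_spec hτ (s * u x) ‖x - c‖
  set R := coneRadius τ (s * u x) ‖x - c‖ with hRdef
  have hsq : 0 < R ^ 2 + ‖x - c‖ ^ 2 := by positivity
  have h1 : τ * R - s * u x = Real.sqrt (R ^ 2 + ‖x - c‖ ^ 2) := by linarith
  have hA : 0 < τ * R - s * u x := by rw [h1]; exact Real.sqrt_pos.2 hsq
  have hA2 : (τ * R - s * u x) ^ 2 = R ^ 2 + ‖x - c‖ ^ 2 := by rw [h1, Real.sq_sqrt hsq.le]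
  refine ⟨hA, hA2, ?_⟩
  have hev : ∀ᶠ z in nhds x, 0 < τ * R - s * u z :=
    (continuousAt_const.sub (continuousAt_const.mul hu)).eventually_const_lt hA
  filter_upwards [hev, hmin] with z hz hzR
  have h2 := cone_mono hτ hzR ‖z - c‖
  rw [coneRadius_spec hτ] at h2
  have h3 : τ * R - s * u z ≤ Real.sqrt (R ^ 2 + ‖z - c‖ ^ 2) := by linarith
  have h4 : (τ * R - s * u z) ^ 2 ≤ R ^ 2 + ‖z - c‖ ^ 2 := by
    rw [← Real.sq_sqrt (show 0 ≤ R ^ 2 + ‖z - c‖ ^ 2 by positivity)]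
    gcongr
  rw [hA2]
  linarith

theorem IsCurvatureFunction.le_of_forall_ge (hf : IsCurvatureFunction f) {l : Fin n → ℝ}
    (hl : l ∈ posCone n) {t : ℝ} (ht : 0 < t) (h : ∀ i, t ≤ l i) : t ≤ f l := by
  rw [← hf.sum_fPartial_mul_self hl]
  calc t ≤ (∑ i, fPartial f i l) * t := le_mul_of_one_le_left ht.le (hf.one_le_sum_fPartial hl)
    _ = ∑ i, fPartial f i l * t := Finset.sum_mul _ _ _
    _ ≤ _ := Finset.sum_le_sum fun i _ =>
      mul_le_mul_of_nonneg_left (h i) (hf.partial_pos l hl i).le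

/-- At such a minimum the graph touches a cap from above, so every principal curvature is at most τ;
monotonicity of f concludes. -/
theorem IsSolution.le_of_isLocalMin_coneRadius (hf : IsCurvatureFunction f)
    (h : IsSolution f σ Ω u) (hΩ : IsOpen Ω) (hx : x ∈ Ω) {τ : ℝ} {c : EuclideanSpace ℝ (Fin n)}
    (hτ : 1 < τ) (hmin : IsLocalMin (fun z => coneRadius τ (1 * u z) ‖z - c‖) x) : σ ≤ τ := by
  obtain ⟨ξ, κ, hκ, hκσ, hg, hh, -⟩ := h.exists_frame hf hΩ hx
  have hr := h.regularNear hΩ hx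
  have hu := hr.pos_self
  have hR : 0 < coneRadius τ (1 * u x) ‖x - c‖ := by
    have h1 : 0 < τ ^ 2 - 1 := by nlinarith
    unfold coneRadius
    have := Real.sqrt_nonneg ((1 * u x) ^ 2 + (τ ^ 2 - 1) * ‖x - c‖ ^ 2)
    have : 0 < τ * (1 * u x) := by positivity
    positivity
  obtain ⟨h1, h2, h3⟩ :=
    isLocalMax_of_isLocalMin_coneRadius hτ hr.contDiffAt.continuousAt hR hmin
  rw [← hκσ]
  refine hf.le_of_forall_le hκ (by linarith) fun k => ?_
  have := principalCurvature_le_of_touching hr.contDiffAt hu (by norm_num) hR h1 h2 h3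
    (hg k) (hh k)
  linarith

/-- The mirror case s = -1: the graph touches from below and every principal curvature is at least
τ. Positivity of the radius is no longer automatic and is a hypothesis. -/
theorem IsSolution.ge_of_isLocalMin_coneRadius (hf : IsCurvatureFunction f)
    (h : IsSolution f σ Ω u) (hΩ : IsOpen Ω) (hx : x ∈ Ω) {τ : ℝ} {c : EuclideanSpace ℝ (Fin n)}
    (hτ : 1 < τ) (hR : 0 < coneRadius τ (-1 * u x) ‖x - c‖)
    (hmin : IsLocalMin (fun z => coneRadius τ (-1 * u z) ‖z - c‖) x) : τ ≤ σ := by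
  obtain ⟨ξ, κ, hκ, hκσ, hg, hh, -⟩ := h.exists_frame hf hΩ hx
  have hr := h.regularNear hΩ hx
  obtain ⟨h1, h2, h3⟩ :=
    isLocalMax_of_isLocalMin_coneRadius hτ hr.contDiffAt.continuousAt hR hmin
  rw [← hκσ]
  refine hf.le_of_forall_ge hκ (by linarith) fun k => ?_
  have := principalCurvature_le_of_touching hr.contDiffAt hr.pos_self (by norm_num) hR h1 h2 h3
    (hg k) (hh k)
  linarith

namespace IsSolutionUpToBoundary

variable {ε : ℝ} (h : IsSolutionUpToBoundary f σ Ω u)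

include h

theorem continuousOn_closure : ContinuousOn u (closure Ω) := fun y hy =>
  (h.smooth_closure y hy).continuousAt.continuousWithinAt

/-- At an interior minimum of u the gradient vanishes and the Hessian is nonnegative, so all κ_k ≤ 1
and σ = f(κ) ≤ 1. -/
theorem boundary_le (hf : IsCurvatureFunction f) (hσ : 1 < σ) (hΩ : IsOpen Ω)
    (hb : Bornology.IsBounded Ω) (hε : ∀ x ∈ frontier Ω, u x = ε)
    {z : EuclideanSpace ℝ (Fin n)} (hz : z ∈ closure Ω) : ε ≤ u z := by
  obtain ⟨y, hy, hymin⟩ := (isCompact_closure_of_isBounded hb).exists_isMinOn ⟨z, hz⟩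
    h.continuousOn_closure
  suffices hyf : y ∈ frontier Ω by
    rw [← hε y hyf]; exact hymin hz
  rw [hΩ.frontier_eq]
  refine ⟨hy, fun hyΩ => ?_⟩
  have hloc : IsLocalMin u y := by
    filter_upwards [hΩ.mem_nhds hyΩ] with p hp using hymin (subset_closure hp)
  obtain ⟨ξ, κ, hκ, hκσ, hg, hh, -⟩ := h.exists_frame hf hΩ hyΩ
  have hg0 : gradSq u y = 0 := by simp [gradSq, pd, hloc.fderiv_eq_zero]
  have hle : ∀ k, κ k ≤ 1 := fun k => by
    have h1 := secondDeriv_nonneg_of_isLocalMin (h.smooth_closure y hy) hloc (ξ k)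
    rw [hh k, hg0, sub_zero, Real.sqrt_one, mul_one] at h1
    have := (mul_nonneg_iff_of_pos_left (h.pos y hyΩ)).1 h1
    linarith
  have := hf.le_of_forall_le hκ one_pos hle
  rw [hκσ] at this
  linarith

/-- The graph lies above the caps of curvature less than `σ` over balls in `Ω`. -/
theorem cap_le (hf : IsCurvatureFunction f) (hΩ : IsOpen Ω) (hσ : 1 < σ)
    (hb : Bornology.IsBounded Ω) (hε : ∀ x ∈ frontier Ω, u x = ε) {c : EuclideanSpace ℝ (Fin n)}
    {r τ R : ℝ} (hr : 0 < r) (hball : Metric.ball c r ⊆ Ω) (hτ : 1 < τ) (hτσ : τ < σ)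
    (hR : τ * R - Real.sqrt (R ^ 2 + r ^ 2) = ε) {z : EuclideanSpace ℝ (Fin n)}
    (hz : z ∈ Metric.closedBall c r) : τ * R - Real.sqrt (R ^ 2 + ‖z - c‖ ^ 2) ≤ u z := by
  have hcl : Metric.closedBall c r ⊆ closure Ω := by
    rw [← closure_ball c hr.ne']; exact closure_mono hball
  have hcont : ContinuousOn (fun z => coneRadius τ (1 * u z) ‖z - c‖) (Metric.closedBall c r) :=
    fun y hy => (continuousAt_coneRadius τ c (continuousAt_const.mul
      (h.smooth_closure y (hcl hy)).continuousAt)).continuousWithinAt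
  obtain ⟨y, hy, hymin⟩ := (isCompact_closedBall c r).exists_isMinOn ⟨z, hz⟩ hcont
  -- The smallest radius cannot occur inside the ball, where it would force σ ≤ τ. On the sphere, u
  -- ≥ ε bounds the radius below by R.
  have hyr : ‖y - c‖ = r := by
    refine le_antisymm (by simpa [dist_eq_norm] using hy) ?_
    by_contra hlt
    have hyb : y ∈ Metric.ball c r := by
      rw [mem_ball_iff_norm]; exact not_le.1 hlt
    refine absurd (h.le_of_isLocalMin_coneRadius hf hΩ (hball hyb) (c := c) hτ ?_) (not_le.2 hτσ)
    filter_upwards [Metric.isOpen_ball.mem_nhds hyb] with p hp using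
      hymin (Metric.ball_subset_closedBall hp)
  have h1 : R ≤ coneRadius τ (1 * u y) ‖y - c‖ := by
    refine le_of_cone_le hτ (ρ := r) ?_
    have h2 := coneRadius_spec hτ (1 * u y) ‖y - c‖
    rw [hyr] at h2 ⊢
    rw [h2, hR, one_mul]
    exact h.boundary_le hf hσ hΩ hb hε (hcl hy)
  have h2 := cone_mono hτ (h1.trans (hymin hz)) ‖z - c‖
  rw [coneRadius_spec hτ, one_mul] at h2
  exact h2

/-- Since |∇u| < 1, the function u - |z - c| has no interior maximum: its derivative along the ray
from c is negative. On the boundary it is ε - |z - c| < 0. This makes the radius of the lower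
hyperboloids positive in `le_cup`. -/
theorem lt_norm_sub (hΩ : IsOpen Ω) (hb : Bornology.IsBounded Ω)
    (hε : ∀ x ∈ frontier Ω, u x = ε) {c : EuclideanSpace ℝ (Fin n)} {r : ℝ} (hr : ε < r)
    (hr0 : 0 < r) (hball : Metric.ball c r ⊆ Ωᶜ) {z : EuclideanSpace ℝ (Fin n)}
    (hz : z ∈ closure Ω) :
    r ≤ ‖z - c‖ ∧ u z < ‖z - c‖ := by
  have hfar : ∀ y ∈ closure Ω, r ≤ ‖y - c‖ := fun y hy => by
    by_contra hlt
    have h1 : Metric.ball c r ∈ nhds y :=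
      Metric.isOpen_ball.mem_nhds (by rw [mem_ball_iff_norm]; exact not_le.1 hlt)
    obtain ⟨p, hp, hpΩ⟩ := mem_closure_iff_nhds.1 hy _ h1
    exact hball hp hpΩ
  refine ⟨hfar z hz, ?_⟩
  obtain ⟨y, hy, hymax⟩ := (isCompact_closure_of_isBounded hb).exists_isMaxOn ⟨z, hz⟩
    (h.continuousOn_closure.sub (continuous_id.sub continuous_const).norm.continuousOn
      (f := u) (g := fun w : EuclideanSpace ℝ (Fin n) => ‖w - c‖))
  have hz' : u z - ‖z - c‖ ≤ u y - ‖y - c‖ := hymax hz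
  by_cases hyΩ : y ∈ Ω
  · exfalso
    have hρ : 0 < ‖y - c‖ := hr0.trans_le (hfar y hy)
    set e := (‖y - c‖)⁻¹ • (y - c) with he
    have hen : ‖e‖ = 1 := by rw [he, norm_smul, norm_inv, norm_norm, inv_mul_cancel₀ hρ.ne']
    have hye : y - c = ‖y - c‖ • e := by rw [he, smul_smul, mul_inv_cancel₀ hρ.ne', one_smul]
    have hline : HasDerivAt (fun t : ℝ => y + t • e) e 0 := by
      simpa using ((hasDerivAt_id (0 : ℝ)).smul_const e).const_add y
    have hud : HasFDerivAt u (fderiv ℝ u y) (y + (0 : ℝ) • e) := by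
      simpa using ((h.smooth_closure y hy).differentiableAt (by simp)).hasFDerivAt
    have hg : HasDerivAt (fun t : ℝ => u (y + t • e) - (‖y - c‖ + t)) (fderiv ℝ u y e - 1) 0 :=
      (hud.comp_hasDerivAt (0 : ℝ) hline).sub ((hasDerivAt_id (0 : ℝ)).const_add _)
    have hmax : IsLocalMax (fun t : ℝ => u (y + t • e) - (‖y - c‖ + t)) 0 := by
      have h1 : ∀ᶠ t in nhds (0 : ℝ), y + t • e ∈ Ω :=
        hline.continuousAt.eventually_mem (hΩ.mem_nhds (by simpa using hyΩ))
      filter_upwards [h1, lt_mem_nhds (neg_lt_zero.2 hρ)] with t ht ht'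
      have h2 : u (y + t • e) - ‖y + t • e - c‖ ≤ u y - ‖y - c‖ := hymax (subset_closure ht)
      have h3 : ‖y + t • e - c‖ = ‖y - c‖ + t := by
        have h4 : y + t • e - c = (‖y - c‖ + t) • e := by
          rw [add_smul, ← hye]; abel
        rw [h4, norm_smul, hen, mul_one, Real.norm_of_nonneg (by linarith)]
      rw [h3] at h2
      simpa using h2
    have h0 := hmax.hasDerivAt_eq_zero hg
    have h1 := sq_fderiv_le u y e
    rw [hen, sub_eq_zero.1 h0] at h1
    have := h.spacelike y hyΩ
    linarith
  · have hyf : y ∈ frontier Ω := by rw [hΩ.frontier_eq]; exact ⟨hy, hyΩ⟩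
    rw [hε y hyf] at hz'
    have := hfar y hy
    linarith

/-- The graph lies below the hyperboloids of curvature more than `σ` over exterior balls. -/
theorem le_cup (hf : IsCurvatureFunction f) (hΩ : IsOpen Ω) (hσ : 1 < σ)
    (hb : Bornology.IsBounded Ω) (hε : ∀ x ∈ frontier Ω, u x = ε) {c : EuclideanSpace ℝ (Fin n)}
    {r τ R : ℝ} (hr : 0 < r) (hεr : ε < r) (hball : Metric.ball c r ⊆ Ωᶜ) (hτσ : σ < τ)
    (hR : τ * R - Real.sqrt (R ^ 2 + r ^ 2) = -ε) {z : EuclideanSpace ℝ (Fin n)}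
    (hz : z ∈ closure Ω) : u z ≤ Real.sqrt (R ^ 2 + ‖z - c‖ ^ 2) - τ * R := by
  have hτ : 1 < τ := hσ.trans hτσ
  have hcont : ContinuousOn (fun z => coneRadius τ (-1 * u z) ‖z - c‖) (closure Ω) :=
    fun y hy => (continuousAt_coneRadius τ c (continuousAt_const.mul
      (h.smooth_closure y hy).continuousAt)).continuousWithinAt
  obtain ⟨y, hy, hymin⟩ := (isCompact_closure_of_isBounded hb).exists_isMinOn ⟨z, hz⟩ hcont
  obtain ⟨hyr, hylt⟩ := h.lt_norm_sub hΩ hb hε hεr hr hball hy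
  -- A radius R ≤ 0 would, by monotonicity up to the cone R = 0, give u(y) ≥ |y - c|.
  have hRy : 0 < coneRadius τ (-1 * u y) ‖y - c‖ := by
    by_contra hle
    have h1 := cone_mono hτ (not_lt.1 hle) ‖y - c‖
    rw [coneRadius_spec hτ] at h1
    have h2 : Real.sqrt ((0 : ℝ) ^ 2 + ‖y - c‖ ^ 2) = ‖y - c‖ := by
      rw [zero_pow two_ne_zero, zero_add, Real.sqrt_sq (norm_nonneg _)]
    rw [h2] at h1
    linarith
  have hyf : y ∈ frontier Ω := by
    rw [hΩ.frontier_eq]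
    refine ⟨hy, fun hyΩ => ?_⟩
    refine absurd (h.ge_of_isLocalMin_coneRadius hf hΩ hyΩ (c := c) hτ hRy ?_) (not_le.2 hτσ)
    filter_upwards [hΩ.mem_nhds hyΩ] with p hp using hymin (subset_closure hp)
  have h1 : R ≤ coneRadius τ (-1 * u y) ‖y - c‖ := by
    refine le_of_cone_le hτ (ρ := ‖y - c‖) ?_
    rw [coneRadius_spec hτ, hε y hyf]
    have h3 : Real.sqrt (R ^ 2 + r ^ 2) ≤ Real.sqrt (R ^ 2 + ‖y - c‖ ^ 2) :=
      Real.sqrt_le_sqrt (by gcongr)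
    linarith
  have h2 := cone_mono hτ (h1.trans (hymin hz)) ‖z - c‖
  rw [coneRadius_spec hτ] at h2
  linarith

end IsSolutionUpToBoundary

end Barriers


/-! ### Boundary estimates -/

section BoundaryEstimates

variable {n : ℕ} {u : EuclideanSpace ℝ (Fin n) → ℝ} {x : EuclideanSpace ℝ (Fin n)}
  {f : (Fin n → ℝ) → ℝ} {σ : ℝ} {Ω : Set (EuclideanSpace ℝ (Fin n))}

theorem nonneg_of_hasDerivAt_of_le {g : ℝ → ℝ} {g' r : ℝ} (hg : HasDerivAt g g' 0) (hr : 0 < r)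
    (h : ∀ t ∈ Set.Ioo 0 r, g 0 ≤ g t) : 0 ≤ g' := by
  refine ge_of_tendsto hg.tendsto_slope_zero_right ?_
  filter_upwards [Ioo_mem_nhdsGT hr] with t ht
  rw [zero_add, smul_eq_mul]
  exact mul_nonneg (inv_nonneg.2 ht.1.le) (sub_nonneg.2 (h t ht))

theorem hasDerivAt_line {E : Type*} [NormedAddCommGroup E] [NormedSpace ℝ E] {φ : E → ℝ} {x : E}
    (hφ : DifferentiableAt ℝ φ x) (e : E) :
    HasDerivAt (fun t : ℝ => φ (x + t • e)) (fderiv ℝ φ x e) 0 := by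
  have h2 : HasDerivAt (fun t : ℝ => x + t • e) e 0 := by
    simpa using ((hasDerivAt_id (0 : ℝ)).smul_const e).const_add x
  have h3 : HasFDerivAt φ (fderiv ℝ φ x) (x + (0 : ℝ) • e) := by simpa using hφ.hasFDerivAt
  exact h3.comp_hasDerivAt (0 : ℝ) h2

theorem hasDerivAt_sqrt_sq_add_sq {R : ℝ} (hR : 0 < R) (ρ s : ℝ) :
    HasDerivAt (fun t : ℝ => Real.sqrt (R ^ 2 + (ρ + s * t) ^ 2))
      (s * ρ / Real.sqrt (R ^ 2 + ρ ^ 2)) 0 := by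
  have h1 : HasDerivAt (fun t : ℝ => R ^ 2 + (ρ + s * t) ^ 2) (2 * (s * ρ)) 0 := by
    have := ((((hasDerivAt_id (0 : ℝ)).const_mul s).const_add ρ).pow 2).const_add (R ^ 2)
    refine this.congr_deriv ?_
    simp
    ring
  have h2 := h1.sqrt (by positivity)
  refine h2.congr_deriv ?_
  rw [mul_zero, add_zero, mul_div_mul_left _ _ two_ne_zero]

/-- At distance ρ the hyperboloid of radius R has slope ρ/√(R² + ρ²) and vertical normal component
√(R² + ρ²)/R, and ν^{n+1} increases with the slope. -/
theorem sqrt_le_nuVert_mul {R ρ k : ℝ} (hR : 0 < R) (hk : gradSq u x = k ^ 2)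
    (hs : gradSq u x < 1) (h : ρ / Real.sqrt (R ^ 2 + ρ ^ 2) ≤ k) (hρ : 0 ≤ ρ) :
    Real.sqrt (R ^ 2 + ρ ^ 2) ≤ nuVert u x * R := by
  have hS : 0 < Real.sqrt (R ^ 2 + ρ ^ 2) := Real.sqrt_pos.2 (by positivity)
  have hw : 0 < Real.sqrt (1 - gradSq u x) := Real.sqrt_pos.2 (by linarith)
  rw [div_le_iff₀ hS] at h
  have h1 : ρ ^ 2 ≤ k ^ 2 * (R ^ 2 + ρ ^ 2) := by
    rw [← Real.sq_sqrt (show 0 ≤ R ^ 2 + ρ ^ 2 by positivity), ← mul_pow]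
    exact pow_le_pow_left₀ hρ h 2
  rw [nuVert_eq, one_div_mul_eq_div, le_div_iff₀ hw, ← Real.sqrt_mul (by positivity)]
  refine Real.sqrt_le_iff.2 ⟨hR.le, ?_⟩
  rw [hk]
  linarith

theorem nuVert_mul_le_sqrt {R ρ k : ℝ} (hR : 0 < R) (hk0 : 0 ≤ k) (hk : gradSq u x = k ^ 2)
    (hs : gradSq u x < 1) (h : k ≤ ρ / Real.sqrt (R ^ 2 + ρ ^ 2)) :
    nuVert u x * R ≤ Real.sqrt (R ^ 2 + ρ ^ 2) := by
  have hS : 0 < Real.sqrt (R ^ 2 + ρ ^ 2) := Real.sqrt_pos.2 (by positivity)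
  have hw : 0 < Real.sqrt (1 - gradSq u x) := Real.sqrt_pos.2 (by linarith)
  rw [le_div_iff₀ hS] at h
  have h1 : k ^ 2 * (R ^ 2 + ρ ^ 2) ≤ ρ ^ 2 := by
    have := pow_le_pow_left₀ (by positivity) h 2
    rwa [mul_pow, Real.sq_sqrt (show 0 ≤ R ^ 2 + ρ ^ 2 by positivity)] at this
  rw [nuVert_eq, one_div_mul_eq_div, div_le_iff₀ hw, ← Real.sqrt_mul (by positivity)]
  refine Real.le_sqrt_of_sq_le ?_
  rw [hk]
  linarith

theorem coneRadius_pos {τ t ρ : ℝ} (hτ : 1 < τ) (ht : |t| < ρ) : 0 < coneRadius τ t ρ := by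
  have h0 : 0 < ρ := (abs_nonneg t).trans_lt ht
  by_contra hle
  have h1 := cone_mono hτ (not_lt.1 hle) ρ
  rw [coneRadius_spec hτ, mul_zero, zero_pow two_ne_zero, zero_add, Real.sqrt_sq h0.le] at h1
  linarith [neg_abs_le t]

/-- Rationalizing, 1/R = (S - τt)/(ρ² - t²) with S the root in `coneRadius`. Strictness comes from
√(a² + b²) < a + b for positive a, b. -/
theorem coneRadius_inv_lt {τ t ρ : ℝ} (hτ : 1 < τ) (ht0 : t ≠ 0) (ht : |t| < ρ) :
    (coneRadius τ t ρ)⁻¹ <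
      (ρ * Real.sqrt (τ ^ 2 - 1) + |t| - τ * t) / (ρ ^ 2 - t ^ 2) := by
  have h0 : 0 < ρ := (abs_nonneg t).trans_lt ht
  have h1 : 0 < τ ^ 2 - 1 := by nlinarith
  have hd : 0 < ρ ^ 2 - t ^ 2 := by
    have := sq_lt_sq' (by linarith [abs_nonneg t]) ht
    rw [sq_abs] at this
    linarith
  have ha := abs_pos.2 ht0
  have hR := coneRadius_pos hτ ht
  set S := Real.sqrt (t ^ 2 + (τ ^ 2 - 1) * ρ ^ 2) with hS
  set q := Real.sqrt (τ ^ 2 - 1) with hq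
  have hq0 : 0 < q := Real.sqrt_pos.2 h1
  have hq2 : q ^ 2 = τ ^ 2 - 1 := Real.sq_sqrt h1.le
  have hS2 : S ^ 2 = t ^ 2 + (τ ^ 2 - 1) * ρ ^ 2 := Real.sq_sqrt (by positivity)
  have hSlt : S < ρ * q + |t| := by
    refine Real.sqrt_lt' (by positivity) |>.2 ?_
    rw [add_sq, sq_abs, mul_pow, hq2]
    have : 0 < 2 * (ρ * q) * |t| := by positivity
    linarith
  have hprod : coneRadius τ t ρ * (S - τ * t) = ρ ^ 2 - t ^ 2 := by
    rw [coneRadius, ← hS]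
    field_simp
    linear_combination hS2
  rw [lt_div_iff₀ hd, ← hprod, inv_mul_cancel_left₀ hR.ne']
  linarith

namespace IsSolutionUpToBoundary

variable {ε : ℝ} (h : IsSolutionUpToBoundary f σ Ω u)

include h

/-- At a boundary point the gradient is a nonnegative multiple of the inner unit normal. -/
theorem exists_normal (hf : IsCurvatureFunction f) (hσ : 1 < σ) (hΩ : IsOpen Ω)
    (hb : Bornology.IsBounded Ω) (hε : ∀ y ∈ frontier Ω, u y = ε) (hx : x ∈ frontier Ω) {r : ℝ}
    (hr : r ∈ interiorRadii Ω) :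
    ∃ e : EuclideanSpace ℝ (Fin n), ‖e‖ = 1 ∧ Metric.ball (x + r • e) r ⊆ Ω ∧
      0 ≤ fderiv ℝ u x e ∧ gradSq u x = fderiv ℝ u x e ^ 2 := by
  obtain ⟨hr0, hr'⟩ := hr
  obtain ⟨c, hc, hball⟩ := hr' x hx
  have hxc := frontier_subset_closure hx
  have hrn : ‖c - x‖ = r := by rw [← hc, dist_comm, dist_eq_norm]
  set e := r⁻¹ • (c - x) with he
  have hen : ‖e‖ = 1 := by
    rw [he, norm_smul, hrn, norm_inv, Real.norm_of_nonneg hr0.le, inv_mul_cancel₀ hr0.ne']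
  have hce : x + r • e = c := by rw [he, smul_inv_smul₀ hr0.ne', add_sub_cancel]
  have hne : c - x ≠ 0 := norm_pos_iff.1 (by rw [hrn]; exact hr0)
  obtain ⟨h1, h2⟩ := fderiv_eq_of_ball hne ((h.smooth_closure x hxc).differentiableAt (by simp))
    (fun z hz => by
      rw [hε x hx]
      rw [add_sub_cancel, hrn] at hz
      exact h.boundary_le hf hσ hΩ hb hε (subset_closure (hball hz)))
  have h3 : fderiv ℝ u x e = r⁻¹ * fderiv ℝ u x (c - x) := by rw [he, map_smul, smul_eq_mul]
  refine ⟨e, hen, by rwa [hce], by rw [h3]; positivity, ?_⟩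
  rw [gradSq_eq_of_fderiv_eq h2, hrn, h3]
  field_simp

/-- The cap over the interior ball touches the graph at x and lies below it, so its inward slope is
at most that of u. -/
theorem sqrt_le_of_interior (hf : IsCurvatureFunction f) (hσ : 1 < σ) (hΩ : IsOpen Ω)
    (hb : Bornology.IsBounded Ω) (hε0 : 0 < ε) (hε : ∀ y ∈ frontier Ω, u y = ε)
    (hx : x ∈ frontier Ω) {r R : ℝ} (hr : r ∈ interiorRadii Ω) (hR : 0 < R)
    (hlt : ε + Real.sqrt (R ^ 2 + r ^ 2) < σ * R) :
    Real.sqrt (R ^ 2 + r ^ 2) ≤ nuVert u x * R := by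
  obtain ⟨e, he, hball, -, hk⟩ := h.exists_normal hf hσ hΩ hb hε hx hr
  have hr0 := hr.1
  have hxc := frontier_subset_closure hx
  refine sqrt_le_nuVert_mul hR hk (h.spacelike_closure x hxc) ?_ hr0.le
  -- The curvature for which the cap of radius R has height ε on the boundary of the ball; the
  -- hypothesis on R says precisely τ < σ.
  set τ := (ε + Real.sqrt (R ^ 2 + r ^ 2)) / R with hτ
  have hτR : τ * R = ε + Real.sqrt (R ^ 2 + r ^ 2) := div_mul_cancel₀ _ hR.ne'
  have hRS : R ≤ Real.sqrt (R ^ 2 + r ^ 2) := Real.le_sqrt_of_sq_le (by nlinarith)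
  have h1τ : 1 < τ := by rw [hτ, one_lt_div hR]; linarith
  have hτσ : τ < σ := by rw [hτ, div_lt_iff₀ hR]; exact hlt
  have hd := (hasDerivAt_line ((h.smooth_closure x hxc).differentiableAt (by simp)) e).sub
    ((hasDerivAt_sqrt_sq_add_sq hR r (-1)).const_sub (τ * R))
  have hle := nonneg_of_hasDerivAt_of_le hd hr0 (fun t ht => ?_)
  · rw [neg_one_mul, neg_div, neg_neg] at hle
    linarith
  · have hn : ‖x + t • e - (x + r • e)‖ = r - t := by
      rw [add_sub_add_left_eq_sub, ← sub_smul, norm_smul, he, mul_one, norm_sub_rev,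
        Real.norm_of_nonneg (by linarith [ht.2])]
    have h1 := h.cap_le hf hΩ hσ hb hε hr0 hball h1τ hτσ (by rw [hτR]; ring)
      (z := x + t • e) (by rw [mem_closedBall_iff_norm, hn]; linarith [ht.1])
    rw [hn] at h1
    simp only [Pi.sub_apply, zero_smul, add_zero, mul_zero, hε x hx, hτR]
    rw [hτR] at h1
    rw [show r + -1 * t = r - t by ring]
    linarith

/-- The hyperboloid attached to the exterior ball touches the graph at x and lies above it. An
interior ball at the same point makes the exterior centre lie on the line of the inner normal. -/
theorem le_sqrt_of_exterior (hf : IsCurvatureFunction f) (hσ : 1 < σ) (hΩ : IsOpen Ω)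
    (hb : Bornology.IsBounded Ω) (hε0 : 0 < ε) (hε : ∀ y ∈ frontier Ω, u y = ε)
    (hx : x ∈ frontier Ω) {r r' R : ℝ} (hr : r ∈ interiorRadii Ω) (hr' : r' ∈ exteriorRadii Ω)
    (hεr : ε < r') (hR : 0 < R) (hlt : σ * R < Real.sqrt (R ^ 2 + r' ^ 2) - ε) :
    nuVert u x * R ≤ Real.sqrt (R ^ 2 + r' ^ 2) := by
  obtain ⟨e, he, hball, hk0, hk⟩ := h.exists_normal hf hσ hΩ hb hε hx hr
  have hr0 := hr.1
  obtain ⟨hr'0, hr'x⟩ := mem_exteriorRadii_iff.1 hr'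
  obtain ⟨c, hc, hball'⟩ := hr'x x hx
  have hxc := frontier_subset_closure hx
  have hcx := sub_eq_neg_smul_of_balls hr0 hr'0
    (by rw [dist_self_add_right, norm_smul, he, mul_one, Real.norm_of_nonneg hr0.le])
    hc hball hball'
  rw [add_sub_cancel_left, smul_smul, neg_mul, div_mul_cancel₀ _ hr0.ne'] at hcx
  refine nuVert_mul_le_sqrt hR hk0 hk (h.spacelike_closure x hxc) ?_
  set τ := (Real.sqrt (R ^ 2 + r' ^ 2) - ε) / R with hτ
  have hτR : τ * R = Real.sqrt (R ^ 2 + r' ^ 2) - ε := div_mul_cancel₀ _ hR.ne'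
  have hτσ : σ < τ := by rw [hτ, lt_div_iff₀ hR]; exact hlt
  have hd := ((hasDerivAt_sqrt_sq_add_sq hR r' 1).sub_const (τ * R)).sub
    (hasDerivAt_line ((h.smooth_closure x hxc).differentiableAt (by simp)) e)
  have hle := nonneg_of_hasDerivAt_of_le hd hr0 (fun t ht => ?_)
  · rw [one_mul] at hle
    linarith
  · have hn : ‖x + t • e - c‖ = r' + t := by
      have h2 : x + t • e - c = (r' + t) • e := by
        have h3 : x - c = r' • e := by rw [← neg_sub, hcx, neg_smul, neg_neg]
        rw [add_smul, ← h3]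
        abel
      rw [h2, norm_smul, he, mul_one, Real.norm_of_nonneg (by linarith [ht.1])]
    have hz : x + t • e ∈ closure Ω := by
      refine subset_closure (hball ?_)
      rw [mem_ball_iff_norm, add_sub_add_left_eq_sub, ← sub_smul, norm_smul, he, mul_one,
        norm_sub_rev, Real.norm_of_nonneg (by linarith [ht.2])]
      linarith [ht.1]
    have h1 := h.le_cup hf hΩ hσ hb hε hr'0 hεr hball' hτσ (by rw [hτR]; ring) hz
    rw [hn] at h1
    simp only [Pi.sub_apply, zero_smul, add_zero, hε x hx, hτR, one_mul]
    rw [hτR] at h1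
    linarith

/-- The boundary estimate from interior spheres. -/
theorem angleQuotient_le_of_interior (hf : IsCurvatureFunction f) (hσ : 1 < σ) (hΩ : IsOpen Ω)
    (hb : Bornology.IsBounded Ω) (hε0 : 0 < ε) (hε : ∀ y ∈ frontier Ω, u y = ε)
    (hx : x ∈ frontier Ω) {r : ℝ} (hr : r ∈ interiorRadii Ω) (hεr : ε < r) :
    angleQuotient σ u x <
      r * Real.sqrt (σ ^ 2 - 1) / (r ^ 2 - ε ^ 2) + ε * (σ - 1) / (r ^ 2 - ε ^ 2) := by
  have habs : |ε| < r := by rwa [abs_of_pos hε0]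
  have hR0 := coneRadius_pos hσ habs
  have hspec := coneRadius_spec hσ ε r
  have hinv := coneRadius_inv_lt hσ hε0.ne' habs
  rw [abs_of_pos hε0] at hinv
  set R := coneRadius σ ε r
  have hν : 0 < nuVert u x :=
    one_pos.trans_le (one_le_nuVert (h.spacelike_closure x (frontier_subset_closure hx)))
  -- The barrier with curvature exactly σ is not admissible. Radii R' > R give curvature below σ,
  -- and R' tends to R.
  have h1 : Real.sqrt (R ^ 2 + r ^ 2) / nuVert u x ≤ R := by
    refine le_of_forall_gt_imp_ge_of_dense fun R' hR' => ?_
    rw [div_le_iff₀ hν, mul_comm]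
    have h2 := cone_strictMono hσ hR' r
    refine le_trans (Real.sqrt_le_sqrt ?_)
      (h.sqrt_le_of_interior hf hσ hΩ hb hε0 hε hx hr (hR0.trans hR') (by linarith))
    gcongr
  rw [div_le_iff₀ hν] at h1
  have hd : 0 < r ^ 2 - ε ^ 2 := by nlinarith
  calc angleQuotient σ u x = (σ - nuVert u x) / ε := by rw [angleQuotient, hε x hx]
    _ ≤ R⁻¹ := by
      rw [div_le_iff₀ hε0, inv_mul_eq_div, le_div_iff₀ hR0]
      linarith
    _ < _ := hinv
    -- The barrier yields -ε(σ - 1) in the numerator; only the weaker sign is claimed.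
    _ ≤ _ := by
      rw [← add_div]
      gcongr
      nlinarith

/-- The boundary estimate from exterior spheres. -/
theorem le_angleQuotient_of_exterior (hf : IsCurvatureFunction f) (hσ : 1 < σ) (hΩ : IsOpen Ω)
    (hb : Bornology.IsBounded Ω) (hε0 : 0 < ε) (hε : ∀ y ∈ frontier Ω, u y = ε)
    (hx : x ∈ frontier Ω) {r r' : ℝ} (hr : r ∈ interiorRadii Ω) (hr' : r' ∈ exteriorRadii Ω)
    (hεr : ε < r') :
    -(r' * Real.sqrt (σ ^ 2 - 1) / (r' ^ 2 - ε ^ 2)) - ε * (1 + σ) / (r' ^ 2 - ε ^ 2) <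
      angleQuotient σ u x := by
  have habs : |-ε| < r' := by rwa [abs_neg, abs_of_pos hε0]
  have hR0 := coneRadius_pos hσ habs
  have hspec := coneRadius_spec hσ (-ε) r'
  have hinv := coneRadius_inv_lt hσ (neg_ne_zero.2 hε0.ne') habs
  rw [abs_neg, abs_of_pos hε0, neg_sq] at hinv
  set R := coneRadius σ (-ε) r'
  have hν : 0 < nuVert u x :=
    one_pos.trans_le (one_le_nuVert (h.spacelike_closure x (frontier_subset_closure hx)))
  -- Smaller radii R' < R correspond to curvature above σ. Nonpositive R' satisfy the inequality
  -- trivially.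
  have h1 : R ≤ Real.sqrt (R ^ 2 + r' ^ 2) / nuVert u x := by
    refine le_of_forall_lt_imp_le_of_dense fun R' hR' => ?_
    rw [le_div_iff₀ hν, mul_comm]
    rcases le_or_gt R' 0 with h0 | h0
    · exact (mul_nonpos_of_nonneg_of_nonpos hν.le h0).trans (Real.sqrt_nonneg _)
    have h2 := cone_strictMono hσ hR' r'
    refine (h.le_sqrt_of_exterior hf hσ hΩ hb hε0 hε hx hr hr' hεr h0 (by linarith)).trans
      (Real.sqrt_le_sqrt ?_)
    gcongr
  rw [le_div_iff₀ hν] at h1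
  calc -(r' * Real.sqrt (σ ^ 2 - 1) / (r' ^ 2 - ε ^ 2)) - ε * (1 + σ) / (r' ^ 2 - ε ^ 2)
      = -((r' * Real.sqrt (σ ^ 2 - 1) + ε - σ * -ε) / (r' ^ 2 - ε ^ 2)) := by ring
    _ < -R⁻¹ := neg_lt_neg hinv
    _ ≤ (σ - nuVert u x) / ε := by
      have h3 : (nuVert u x - σ) * R ≤ ε := by linarith
      have h4 := (le_div_iff₀ hR0).2 h3
      rw [le_div_iff₀ hε0, neg_mul, inv_mul_eq_div]
      linarith
    _ = angleQuotient σ u x := by rw [angleQuotient, hε x hx]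

/-- Both boundary bounds hold for every admissible radius, so one common r suffices. Multiplying by
ε, with r² - ε² ≥ 3r²/4, leaves an error of order ε. -/
theorem abs_nuVert_sub_lt (hf : IsCurvatureFunction f) (hσ : 1 < σ) (hΩ : IsOpen Ω)
    (hb : Bornology.IsBounded Ω) (hε0 : 0 < ε) (hε : ∀ y ∈ frontier Ω, u y = ε)
    (hx : x ∈ frontier Ω) {r η : ℝ} (hr : r ∈ interiorRadii Ω) (hr' : r ∈ exteriorRadii Ω)
    (hεr : ε < r / 2)
    (hεη : ε < η * (3 / 4 * r ^ 2) / (r * Real.sqrt (σ ^ 2 - 1) + r * (1 + σ))) :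
    |nuVert u x - σ| < η := by
  have hr0 := hr.1
  have h1 := h.angleQuotient_le_of_interior hf hσ hΩ hb hε0 hε hx hr (by linarith)
  have h2 := h.le_angleQuotient_of_exterior hf hσ hΩ hb hε0 hε hx hr hr' (by linarith)
  rw [← add_div] at h1
  rw [← neg_div, ← sub_div] at h2
  rw [angleQuotient, hε x hx] at h1 h2
  have hq := Real.sqrt_nonneg (σ ^ 2 - 1)
  set q := Real.sqrt (σ ^ 2 - 1)
  have hA : 0 < r * q + r * (1 + σ) := by positivity
  rw [lt_div_iff₀ hA] at hεη
  have hd : 3 / 4 * r ^ 2 ≤ r ^ 2 - ε ^ 2 := by nlinarith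
  have hd0 : 0 < r ^ 2 - ε ^ 2 := lt_of_lt_of_le (by positivity) hd
  rw [div_lt_div_iff₀ hε0 hd0] at h1
  rw [div_lt_div_iff₀ hd0 hε0] at h2
  have hη : 0 < η := by
    by_contra hle
    have : 0 < ε * (r * q + r * (1 + σ)) := by positivity
    nlinarith [sq_nonneg r]
  have h3 : ε * (1 + σ) ≤ r * (1 + σ) := by gcongr; linarith
  have h4 : η * (3 / 4 * r ^ 2) ≤ η * (r ^ 2 - ε ^ 2) := by gcongr
  rw [abs_lt]
  constructor
  · by_contra hle
    have h5 : η * (r ^ 2 - ε ^ 2) ≤ (σ - nuVert u x) * (r ^ 2 - ε ^ 2) := by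
      gcongr; linarith
    have h6 : (r * q + ε * (σ - 1)) * ε ≤ (r * q + r * (1 + σ)) * ε := by
      gcongr ?_ * ε
      nlinarith
    linarith
  · by_contra hle
    have h5 : η * (r ^ 2 - ε ^ 2) ≤ (nuVert u x - σ) * (r ^ 2 - ε ^ 2) := by
      gcongr; linarith
    have h6 : (r * q + ε * (1 + σ)) * ε ≤ (r * q + r * (1 + σ)) * ε := by
      gcongr
    linarith

end IsSolutionUpToBoundary

end BoundaryEstimates


/-! ### Domains with arbitrarily large exterior spheres -/

section LargeExteriorSpheres

variable {n : ℕ} {u : EuclideanSpace ℝ (Fin n) → ℝ} {x : EuclideanSpace ℝ (Fin n)}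
  {f : (Fin n → ℝ) → ℝ} {σ : ℝ} {Ω : Set (EuclideanSpace ℝ (Fin n))}

/-- If all radii of exterior spheres are possible, `Ω` lies on one side of each tangent plane. -/
theorem inner_nonneg_of_not_bddAbove (hbdd : ¬ BddAbove (exteriorRadii Ω))
    (hx : x ∈ frontier Ω) {r : ℝ} (hr : 0 < r) {e : EuclideanSpace ℝ (Fin n)} (he : ‖e‖ = 1)
    (hball : Metric.ball (x + r • e) r ⊆ Ω) {z : EuclideanSpace ℝ (Fin n)} (hz : z ∈ closure Ω) :
    0 ≤ inner ℝ e (z - x) := by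
  refine closure_minimal (s := Ω) (t := {z | 0 ≤ inner ℝ e (z - x)}) (fun p hp => ?_)
    (isClosed_le continuous_const (by fun_prop)) hz
  by_contra hlt
  have hlt' : inner ℝ e (p - x) < 0 := not_le.1 hlt
  rw [not_bddAbove_iff] at hbdd
  -- Beyond this threshold the exterior ball at x would contain p.
  obtain ⟨r', hr', hlarge⟩ := hbdd (‖p - x‖ ^ 2 / (-2 * inner ℝ e (p - x)))
  obtain ⟨hr'0, hr'x⟩ := mem_exteriorRadii_iff.1 hr'
  obtain ⟨c, hc, hball'⟩ := hr'x x hx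
  have hcx := sub_eq_neg_smul_of_balls hr hr'0
    (by rw [dist_self_add_right, norm_smul, he, mul_one, Real.norm_of_nonneg hr.le])
    hc hball hball'
  rw [add_sub_cancel_left, smul_smul, neg_mul, div_mul_cancel₀ _ hr.ne'] at hcx
  rw [div_lt_iff₀ (by linarith)] at hlarge
  have hc' : c = x + (-r') • e := by rw [← hcx, add_sub_cancel]
  refine hball' ?_ hp
  rw [hc', add_smul_mem_ball_iff hr'0
    (by rw [norm_smul, he, mul_one, norm_neg, Real.norm_of_nonneg hr'0.le]),
    real_inner_smul_left]
  linarith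

/-- The linearized equation is uniformly elliptic where the principal curvatures are bounded. -/
theorem IsCurvatureFunction.exists_le_fPartial (hf : IsCurvatureFunction f) (hσ : 0 < σ) (C : ℝ) :
    ∃ θ > 0, ∀ l ∈ posCone n, f l = σ → (∀ i, l i ≤ C) → ∀ i, θ ≤ fPartial f i l := by
  set S : Set (Fin n → ℝ) := closure (posCone n) ∩ f ⁻¹' {σ} ∩ Set.Icc 0 fun _ => C with hS
  have hclosed : IsClosed (closure (posCone n) ∩ f ⁻¹' {σ}) :=
    hf.continuousOn.preimage_isClosed_of_isClosed isClosed_closure isClosed_singleton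
  have hcomp : IsCompact S := isCompact_Icc.inter_left hclosed
  -- Because f vanishes on the boundary of the cone and σ > 0, the level set with bounded entries is
  -- compact inside the open cone, where the partial derivatives are continuous and positive.
  have hSK : S ⊆ posCone n := fun l hl => by
    by_contra hlK
    have : l ∈ frontier (posCone n) := by
      rw [isOpen_posCone.frontier_eq]; exact ⟨hl.1.1, hlK⟩
    have h1 : f l = σ := hl.1.2
    rw [hf.zero_boundary l this] at h1
    exact hσ.ne h1
  have hcont : ∀ i, ContinuousOn (fPartial f i) S := fun i =>
    ((hf.contDiffOn.continuousOn_fderiv_of_isOpen isOpen_posCone le_rfl).mono hSK).clm_apply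
      continuousOn_const
  have hex : ∀ i, ∃ θ > 0, ∀ l ∈ S, θ ≤ fPartial f i l := fun i => by
    rcases S.eq_empty_or_nonempty with hemp | hne
    · exact ⟨1, one_pos, fun l hl => by rw [hemp] at hl; exact hl.elim⟩
    · obtain ⟨l, hl, hmin⟩ := hcomp.exists_isMinOn hne (hcont i)
      exact ⟨_, hf.partial_pos l (hSK hl) i, fun m hm => hmin hm⟩
  choose θ hθ hθle using hex
  obtain ⟨θ₀, hθ₀, hθ₀le⟩ := exists_pos_forall_le hθ
  exact ⟨θ₀, hθ₀, fun l hl hlσ hlC i => (hθ₀le i).trans (hθle i l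
    ⟨⟨subset_closure hl, hlσ⟩, fun j => (hl j).le, hlC⟩)⟩

/-- The operator norm of the second derivative. -/
noncomputable def secondDerivNorm {E : Type*} [NormedAddCommGroup E] [NormedSpace ℝ E] (φ : E → ℝ)
    (x : E) : ℝ :=
  ‖fderiv ℝ (fderiv ℝ φ) x‖

theorem secondDerivNorm_nonneg {E : Type*} [NormedAddCommGroup E] [NormedSpace ℝ E] (φ : E → ℝ)
    (x : E) : 0 ≤ secondDerivNorm φ x :=
  norm_nonneg (fderiv ℝ (fderiv ℝ φ) x)

theorem continuousAt_secondDerivNorm {E : Type*} [NormedAddCommGroup E] [NormedSpace ℝ E]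
    {φ : E → ℝ} {x : E} (hφ : ContDiffAt ℝ ∞ φ x) : ContinuousAt (secondDerivNorm φ) x :=
  ((hφ.fderiv_right (m := ∞) (by simp)).fderiv_right (m := ∞) (by simp)).continuousAt.norm

theorem neg_le_secondDeriv {E : Type*} [NormedAddCommGroup E] [NormedSpace ℝ E]
    {φ : E → ℝ} {x : E} (hφ : ContDiffAt ℝ ∞ φ x) (ξ : E) :
    -(secondDerivNorm φ x * ‖ξ‖ ^ 2) ≤ secondDeriv φ x ξ := by
  have hsd : secondDeriv φ x ξ = fderiv ℝ (fderiv ℝ φ) x ξ ξ := by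
    have h1 := (hφ.fderiv_right (m := ∞) (by simp)).differentiableAt (by simp)
    rw [secondDeriv, fderiv_clm_apply h1 (by fun_prop)]
    simp
  have h1 := (fderiv ℝ (fderiv ℝ φ) x).le_opNorm₂ ξ ξ
  rw [← hsd, Real.norm_eq_abs] at h1
  have := neg_abs_le (secondDeriv φ x ξ)
  rw [secondDerivNorm]
  linarith

namespace IsSolutionUpToBoundary

variable {ε : ℝ} (h : IsSolutionUpToBoundary f σ Ω u)

include h

/-- In a principal direction uκw = u - D²u(ξ,ξ) with w = √(1 - |∇u|²), while |ξ|² ≤ u²/w². Hence κ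
is bounded by a continuous function on the compact closure. -/
theorem exists_principalCurvature_le (hb : Bornology.IsBounded Ω) :
    ∃ C, ∀ y ∈ Ω, ∀ (ξ : EuclideanSpace ℝ (Fin n)) (κ : ℝ),
      ‖ξ‖ ^ 2 - fderiv ℝ u y ξ ^ 2 = u y ^ 2 →
      secondDeriv u y ξ = u y * (1 - κ * Real.sqrt (1 - gradSq u y)) → κ ≤ C := by
  have hcont : ContinuousOn
      (fun y => (1 + secondDerivNorm u y * u y * nuVert u y ^ 2) * nuVert u y)
      (closure Ω) := fun y hy => by
    have hu := h.smooth_closure y hy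
    have h2 := continuousAt_nuVert hu (h.spacelike_closure y hy)
    exact ((continuousAt_const.add (((continuousAt_secondDerivNorm hu).mul hu.continuousAt).mul (h2.pow 2))).mul
      h2).continuousWithinAt
  obtain ⟨C, hC⟩ := (isCompact_closure_of_isBounded hb).exists_bound_of_continuousOn hcont
  refine ⟨C, fun y hy ξ κ hg hh => le_trans ?_ ((le_abs_self _).trans (hC y (subset_closure hy)))⟩
  have hpos := h.pos y hy
  have hw : 0 < Real.sqrt (1 - gradSq u y) :=
    Real.sqrt_pos.2 (by linarith [h.spacelike y hy])
  have hw2 : Real.sqrt (1 - gradSq u y) ^ 2 = 1 - gradSq u y :=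
    Real.sq_sqrt (by linarith [h.spacelike y hy])
  have hlow := neg_le_secondDeriv (h.smooth_closure y (subset_closure hy)) ξ
  rw [nuVert_eq]
  set w := Real.sqrt (1 - gradSq u y)
  set B := secondDerivNorm u y
  have hB : 0 ≤ B := secondDerivNorm_nonneg u y
  have hξ : ‖ξ‖ ^ 2 * w ^ 2 ≤ u y ^ 2 := by
    rw [hw2, ← hg]
    have := sq_fderiv_le u y ξ
    linarith
  have hξ' : ‖ξ‖ ^ 2 ≤ u y ^ 2 * (1 / w) ^ 2 := by
    rw [one_div, inv_pow, ← div_eq_mul_inv, le_div_iff₀ (by positivity)]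
    exact hξ
  have h1 : u y * (κ * w) ≤ u y * (1 + B * u y * (1 / w) ^ 2) := by
    have := mul_le_mul_of_nonneg_left hξ' hB
    rw [hh] at hlow
    linarith
  have h2 := le_of_mul_le_mul_left h1 hpos
  rw [mul_one_div, le_div_iff₀ hw]
  exact h2

/-- If all radii of exterior spheres are possible, then `ν^{n+1} < σ` on the boundary. -/
theorem nuVert_lt (hf : IsCurvatureFunction f) (hσ : 1 < σ) (hΩ : IsOpen Ω)
    (hb : Bornology.IsBounded Ω) (hε0 : 0 < ε) (hε : ∀ y ∈ frontier Ω, u y = ε)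
    (hx : x ∈ frontier Ω) {r : ℝ} (hr : r ∈ interiorRadii Ω)
    (hbdd : ¬ BddAbove (exteriorRadii Ω)) : nuVert u x < σ := by
  obtain ⟨e, he, hball, hk0, hk⟩ := h.exists_normal hf hσ hΩ hb hε hx hr
  have hxc := frontier_subset_closure hx
  have hcomp := isCompact_closure_of_isBounded hb
  have hside : ∀ z ∈ closure Ω, 0 ≤ inner ℝ e (z - x) := fun z hz =>
    inner_nonneg_of_not_bddAbove hbdd hx hr.1 he hball hz
  set d : EuclideanSpace ℝ (Fin n) → ℝ := fun z => inner ℝ e (z - x) with hd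
  have hdc : Continuous d := by fun_prop
  have hdd : ∀ z, HasFDerivAt d (innerSL ℝ e) z := fun z => by
    have h1 : d = fun z => innerSL ℝ e z - inner ℝ e x := by
      ext z; simp [hd, inner_sub_right]
    rw [h1]
    exact (innerSL ℝ e).hasFDerivAt.sub_const _
  have hdsm : ContDiff ℝ ∞ d := contDiff_const.inner ℝ (contDiff_id.sub contDiff_const)
  obtain ⟨D, hD⟩ := hcomp.exists_bound_of_continuousOn hdc.continuousOn
  obtain ⟨C, hC⟩ := h.exists_principalCurvature_le hb
  obtain ⟨θ, hθ, hθle⟩ := hf.exists_le_fPartial (zero_lt_one.trans hσ) C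
  set α := Real.sqrt (1 - 1 / σ ^ 2) with hα
  have hσ2 : 1 / σ ^ 2 < 1 := by
    rw [div_lt_one (by positivity)]
    nlinarith
  have hα0 : 0 < α := Real.sqrt_pos.2 (by linarith)
  have hα2 : α ^ 2 = 1 - 1 / σ ^ 2 := Real.sq_sqrt (by linarith)
  have hα1 : α ≤ 1 := Real.sqrt_le_one.2 (by linarith [show 0 ≤ 1 / σ ^ 2 by positivity])
  -- Large enough that the exponential bending, weighted by the ellipticity θ and by u ≥ ε, beats
  -- the first order change σ²β caused by the reduced slope.
  set K := σ ^ 2 / (θ * ε) + 1 with hK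
  have hK0 : 0 < K := by positivity
  have hKθ : σ ^ 2 < K * (θ * ε) := by
    rw [hK, add_mul, div_mul_cancel₀ _ (by positivity)]
    linarith [mul_pos hθ hε0]
  -- Small enough that the bent plane stays at or above ε on the closure, hence above u on the
  -- boundary; its slope at x is α - δ.
  set δ := α * Real.exp (-(K * D)) with hδ
  have hδ0 : 0 < δ := by positivity
  set G : ℝ → ℝ := fun t => ε + α * t - δ / K * (Real.exp (K * t) - 1) with hG
  have hGd : ∀ t, HasDerivAt G (α - δ * Real.exp (K * t)) t := fun t => by
    have h1 := ((hasDerivAt_id t).const_mul K).exp.sub_const 1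
    have h2 := (((hasDerivAt_id t).const_mul α).const_add ε).sub (h1.const_mul (δ / K))
    refine h2.congr_deriv ?_
    simp only [id, mul_one]
    field_simp
  have hG0 : G 0 = ε := by simp [hG]
  have hGε : ∀ z ∈ closure Ω, ε ≤ G (d z) := fun z hz => by
    have h1 : 0 ≤ d z := hside z hz
    have h2 : d z ≤ D := (le_abs_self _).trans (hD z hz)
    have h3 : Real.exp (K * d z) - 1 ≤ K * d z * Real.exp (K * d z) := by
      have h4 := Real.add_one_le_exp (-(K * d z))
      have h5 := mul_le_mul_of_nonneg_right h4 (Real.exp_pos (K * d z)).le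
      rw [← Real.exp_add, neg_add_cancel, Real.exp_zero] at h5
      linarith
    have h4 : Real.exp (K * d z) ≤ Real.exp (K * D) := by gcongr
    have h5 : δ / K * (Real.exp (K * d z) - 1) ≤ α * d z := by
      calc δ / K * (Real.exp (K * d z) - 1) ≤ δ / K * (K * d z * Real.exp (K * D)) := by
            gcongr
            exact h3.trans (by gcongr)
        _ = α * d z * (Real.exp (-(K * D)) * Real.exp (K * D)) := by
            rw [hδ]; field_simp
        _ = α * d z := by rw [← Real.exp_add, neg_add_cancel, Real.exp_zero, mul_one]
    simp only [hG]
    linarith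
  have hGc : Continuous fun z => G (d z) := by fun_prop
  have hle : ∀ z ∈ closure Ω, u z ≤ G (d z) := by
    obtain ⟨y, hy, hymax⟩ := hcomp.exists_isMaxOn ⟨x, hxc⟩
      (h.continuousOn_closure.sub hGc.continuousOn)
    have hymax' : ∀ z ∈ closure Ω, u z - G (d z) ≤ u y - G (d y) := fun z hz => hymax hz
    by_cases hyΩ : y ∈ Ω
    swap
    · intro z hz
      have hyf : y ∈ frontier Ω := by rw [hΩ.frontier_eq]; exact ⟨hy, hyΩ⟩
      have h1 := hymax' z hz
      rw [hε y hyf] at h1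
      linarith [hGε y hy]
    exfalso
    obtain ⟨ξ, κ, hκ, hκσ, hg, hh, hξ⟩ := h.exists_frame hf hΩ hyΩ
    have huy := h.smooth_closure y hy
    have hloc : IsLocalMax (fun z => u z - G (d z)) y := by
      filter_upwards [hΩ.mem_nhds hyΩ] with z hz using hymax' z (subset_closure hz)
    have hφ : ∀ z, HasFDerivAt (fun z => G (d z)) ((α - δ * Real.exp (K * d z)) • innerSL ℝ e) z :=
      fun z => (hGd (d z)).comp_hasFDerivAt z (hdd z)
    have hsm : ContDiffAt ℝ ∞ (fun z => u z - G (d z)) y := by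
      refine huy.sub ?_
      simp only [hG]
      fun_prop
    have hev : ∀ᶠ z in nhds y, ∀ η, fderiv ℝ (fun z => u z - G (d z)) z η =
        fderiv ℝ u z η - (α - δ * Real.exp (K * d z)) * inner ℝ e η := by
      have h1 : ∀ᶠ z in nhds y, DifferentiableAt ℝ u z :=
        ((huy.of_le (m := 1) (by simp)).eventually (by simp)).mono fun z hz =>
          hz.differentiableAt (by simp)
      filter_upwards [h1] with z hz η
      have h2 : HasFDerivAt (fun z => u z - G (d z)) _ z := hz.hasFDerivAt.sub (hφ z)
      rw [h2.fderiv]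
      simp
    set β := δ * Real.exp (K * d y) with hβ
    have hβ0 : 0 < β := by positivity
    have hDu : ∀ η, fderiv ℝ u y η = (α - β) * inner ℝ e η := fun η => by
      have h1 := hev.self_of_nhds η
      rw [hloc.fderiv_eq_zero] at h1
      simp only [_root_.zero_apply] at h1
      linarith
    have hgs : gradSq u y = (α - β) ^ 2 := by
      rw [gradSq_eq_of_fderiv_eq hDu, he, one_pow, mul_one]
    have hsd : ∀ k, secondDeriv u y (ξ k) ≤ -(K * β * inner ℝ (ξ k) e ^ 2) := fun k => by
      have h1 := secondDeriv_nonpos_of_isLocalMax hsm hloc (ξ k)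
      have h2 : secondDeriv (fun z => u z - G (d z)) y (ξ k) =
          secondDeriv u y (ξ k) + K * β * inner ℝ (ξ k) e ^ 2 := by
        have h3 : HasFDerivAt (fun z => fderiv ℝ u z (ξ k))
            (fderiv ℝ (fun z => fderiv ℝ u z (ξ k)) y) y :=
          (((huy.fderiv_right (m := ∞) (by simp)).clm_apply
            contDiffAt_const).differentiableAt (by simp)).hasFDerivAt
        have h4 : HasFDerivAt (fun z => (α - δ * Real.exp (K * d z)) * inner ℝ e (ξ k)) _ y :=
          (((((hdd y).const_mul K).exp).const_mul δ).const_sub α).mul_const (inner ℝ e (ξ k))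
        have h5 := (h3.sub h4).congr_of_eventuallyEq (hev.mono fun z hz => hz (ξ k))
        rw [secondDeriv, h5.fderiv, real_inner_comm e (ξ k)]
        simp [secondDeriv, hβ]
        ring
      linarith
    have huε : ε ≤ u y := h.boundary_le hf hσ hΩ hb hε hy
    have huy0 : 0 < u y := h.pos y hyΩ
    have hc := hf.partial_pos κ hκ
    set w := Real.sqrt (1 - gradSq u y) with hw
    have hw0 : 0 < w := Real.sqrt_pos.2 (by linarith [h.spacelike y hyΩ])
    have hw2 : w ^ 2 = 1 - (α - β) ^ 2 := by
      rw [hw, Real.sq_sqrt (by linarith [h.spacelike y hyΩ]), hgs]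
    -- At an interior maximum of u - G(d), the Hessian of u is at most -Kβ e ⊗ e, which pushes all
    -- curvatures up.
    have hkey : ∀ k, 1 + K * β / u y * inner ℝ (ξ k) e ^ 2 ≤ κ k * w := fun k => by
      have h1 := hsd k
      rw [hh k] at h1
      have h2 : u y * (1 + K * β / u y * inner ℝ (ξ k) e ^ 2) ≤ u y * (κ k * w) := by
        have h3 : u y * (1 + K * β / u y * inner ℝ (ξ k) e ^ 2) =
            u y + K * β * inner ℝ (ξ k) e ^ 2 := by field_simp
        rw [h3]
        linarith
      exact le_of_mul_le_mul_left h2 huy0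
    have hsum : 1 + K * β * (θ * ε) ≤ σ * w := by
      have h1 : ∑ k, fPartial f k κ * (1 + K * β / u y * inner ℝ (ξ k) e ^ 2) ≤ σ * w := by
        rw [← hκσ, ← hf.sum_fPartial_mul_self hκ, Finset.sum_mul]
        refine Finset.sum_le_sum fun k _ => ?_
        rw [mul_assoc]
        exact mul_le_mul_of_nonneg_left (hkey k) (hc k).le
      have h2 : θ * (u y ^ 2 * 1) ≤ ∑ k, fPartial f k κ * inner ℝ (ξ k) e ^ 2 := by
        have h3 := hξ e
        rw [he, one_pow] at h3
        calc θ * (u y ^ 2 * 1) ≤ θ * ∑ k, inner ℝ (ξ k) e ^ 2 := by gcongr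
          _ = ∑ k, θ * inner ℝ (ξ k) e ^ 2 := Finset.mul_sum _ _ _
          _ ≤ _ := Finset.sum_le_sum fun k _ => mul_le_mul_of_nonneg_right
            (hθle κ hκ hκσ (fun i => hC y hyΩ _ _ (hg i) (hh i)) k) (sq_nonneg _)
      have h3 : ∑ k, fPartial f k κ * (1 + K * β / u y * inner ℝ (ξ k) e ^ 2) =
          (∑ k, fPartial f k κ) + K * β / u y * ∑ k, fPartial f k κ * inner ℝ (ξ k) e ^ 2 := by
        rw [Finset.mul_sum, ← Finset.sum_add_distrib]
        exact Finset.sum_congr rfl fun k _ => by ring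
      have h4 : K * β / u y * (θ * (u y ^ 2 * 1)) ≤
          K * β / u y * ∑ k, fPartial f k κ * inner ℝ (ξ k) e ^ 2 := by gcongr
      have h5 : K * β * (θ * ε) ≤ K * β / u y * (θ * (u y ^ 2 * 1)) := by
        have h6 : K * β / u y * (θ * (u y ^ 2 * 1)) = K * β * (θ * u y) := by field_simp
        rw [h6]
        gcongr
      have := hf.one_le_sum_fPartial hκ
      linarith
    -- Slope α would give σw = 1; lowering it by β raises σw by at most σ²β. Together with the lower
    -- bound 1 + Kβθε this contradicts the choice of K.
    have hσw : σ * w ≤ 1 + σ ^ 2 * β := by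
      refine abs_le_of_sq_le_sq' ?_ (by positivity) |>.2
      have h1 : σ ^ 2 * α ^ 2 = σ ^ 2 - 1 := by rw [hα2]; field_simp
      rw [mul_pow, hw2]
      nlinarith [sq_nonneg (σ * β), sq_nonneg (σ ^ 2 * β),
        mul_le_mul_of_nonneg_left hα1 (show 0 ≤ 2 * σ ^ 2 * β by positivity)]
    nlinarith [mul_lt_mul_of_pos_left hKθ hβ0]
  have hdx : d x = 0 := by simp [hd]
  have hGx : HasFDerivAt (fun z => G (d z)) _ x := (hGd (d x)).comp_hasFDerivAt x (hdd x)
  have hk1 : fderiv ℝ u x e ≤ α - δ := by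
    have h1 := nonneg_of_hasDerivAt_of_le ((hasDerivAt_line hGx.differentiableAt e).sub
      (hasDerivAt_line ((h.smooth_closure x hxc).differentiableAt (by simp)) e)) hr.1
      (fun t ht => ?_)
    · rw [hGx.fderiv] at h1
      simp only [_root_.smul_apply, innerSL_apply_apply, smul_eq_mul, hdx,
        real_inner_self_eq_norm_sq, he, mul_zero, Real.exp_zero] at h1
      linarith
    · have hz : x + t • e ∈ closure Ω := by
        refine subset_closure (hball ?_)
        rw [mem_ball_iff_norm, add_sub_add_left_eq_sub, ← sub_smul, norm_smul, he, mul_one,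
          norm_sub_rev, Real.norm_of_nonneg (by linarith [ht.2])]
        linarith [ht.1]
      have h1 := hle _ hz
      simp only [Pi.sub_apply, zero_smul, add_zero, hdx, hG0, hε x hx]
      linarith
  have hgs : gradSq u x < 1 - 1 / σ ^ 2 := by
    rw [hk, ← hα2]
    exact pow_lt_pow_left₀ (by linarith) hk0 two_ne_zero
  have h1 : 1 / σ < Real.sqrt (1 - gradSq u x) := by
    refine Real.lt_sqrt_of_sq_lt ?_
    rw [div_pow, one_pow]
    linarith
  rw [nuVert_eq]
  rwa [one_div_lt (by linarith [show 0 < 1 / σ by positivity]) (by positivity)]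

end IsSolutionUpToBoundary

end LargeExteriorSpheres

end SteadyState

/-! ### Assembly of the three statements. -/

theorem theorem4 {n : ℕ} (hn : 1 ≤ n) (Ω : Set (EuclideanSpace ℝ (Fin n)))
    (hΩ : IsOpen Ω) (hne : Ω.Nonempty) :
    -- the differential inequality
    (∀ (f : (Fin n → ℝ) → ℝ) (σ : ℝ) (u : EuclideanSpace ℝ (Fin n) → ℝ),
      SteadyState.IsCurvatureFunction f → 1 < σ → SteadyState.IsSolution f σ Ω u →
      ∀ x ∈ Ω, ∀ (P : Matrix (Fin n) (Fin n) ℝ) (κ : Fin n → ℝ),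
        SteadyState.IsOrthonormalFrame u x P → SteadyState.IsPrincipalCurvatures u x κ →
        SteadyState.linearizedOp f u P (SteadyState.angleQuotient σ u) x =
            σ / u x * (1 - ∑ i, SteadyState.fPartial f i κ) +
              SteadyState.nuVert u x / u x *
                (σ ^ 2 - ∑ i, SteadyState.fPartial f i κ * κ i ^ 2) ∧
          SteadyState.linearizedOp f u P (SteadyState.angleQuotient σ u) x ≤ 0) ∧
    -- the minimum principle
    (Bornology.IsBounded Ω →
      ∀ (f : (Fin n → ℝ) → ℝ) (σ : ℝ) (u : EuclideanSpace ℝ (Fin n) → ℝ),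
      SteadyState.IsCurvatureFunction f → 1 < σ → SteadyState.IsSolutionUpToBoundary f σ Ω u →
      ∃ y ∈ frontier Ω,
        SteadyState.angleQuotient σ u y =
            sInf (SteadyState.angleQuotient σ u '' frontier Ω) ∧
          ∀ x ∈ closure Ω, SteadyState.angleQuotient σ u y ≤ SteadyState.angleQuotient σ u x) ∧
    -- the boundary estimate and the limit
    (Bornology.IsBounded Ω → SteadyState.HasSmoothBoundary Ω →
      (∃ r₁ : ℝ, IsGreatest (SteadyState.interiorRadii Ω) r₁) ∧
      (SteadyState.exteriorRadii Ω).Nonempty ∧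
      (BddAbove (SteadyState.exteriorRadii Ω) →
        ∃ r₂ : ℝ, IsGreatest (SteadyState.exteriorRadii Ω) r₂) ∧
      (∃ ε₀ : ℝ, 0 < ε₀ ∧
        (∀ r₁ : ℝ, IsGreatest (SteadyState.interiorRadii Ω) r₁ → ε₀ < r₁) ∧
        (∀ r₂ : ℝ, IsGreatest (SteadyState.exteriorRadii Ω) r₂ → ε₀ < r₂) ∧
        ∀ (f : (Fin n → ℝ) → ℝ) (σ ε : ℝ) (u : EuclideanSpace ℝ (Fin n) → ℝ),
          SteadyState.IsCurvatureFunction f → 1 < σ → 0 < ε → ε ≤ ε₀ →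
          SteadyState.IsSolutionUpToBoundary f σ Ω u → (∀ x ∈ frontier Ω, u x = ε) →
          ∀ x ∈ frontier Ω,
            (∀ r₁ : ℝ, IsGreatest (SteadyState.interiorRadii Ω) r₁ →
              SteadyState.angleQuotient σ u x <
                r₁ * Real.sqrt (σ ^ 2 - 1) / (r₁ ^ 2 - ε ^ 2) +
                  ε * (σ - 1) / (r₁ ^ 2 - ε ^ 2)) ∧
            (∀ r₂ : ℝ, IsGreatest (SteadyState.exteriorRadii Ω) r₂ →
              -(r₂ * Real.sqrt (σ ^ 2 - 1) / (r₂ ^ 2 - ε ^ 2)) -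
                  ε * (1 + σ) / (r₂ ^ 2 - ε ^ 2) <
                SteadyState.angleQuotient σ u x) ∧
            (¬ BddAbove (SteadyState.exteriorRadii Ω) →
              0 < SteadyState.angleQuotient σ u x)) ∧
      (∀ σ : ℝ, 1 < σ → ∀ η : ℝ, 0 < η → ∃ δ : ℝ, 0 < δ ∧
        ∀ (f : (Fin n → ℝ) → ℝ) (ε : ℝ) (u : EuclideanSpace ℝ (Fin n) → ℝ),
          SteadyState.IsCurvatureFunction f → 0 < ε → ε < δ →
          SteadyState.IsSolutionUpToBoundary f σ Ω u → (∀ x ∈ frontier Ω, u x = ε) →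
          ∀ x ∈ frontier Ω, |SteadyState.nuVert u x - σ| < η)) := by
  refine ⟨fun f σ u hf hσ h x hx P κ hP hκ => h.linearizedOp_angleQuotient hf hσ hΩ hx hP hκ,
    fun hb f σ u hf hσ h => h.exists_min_frontier hn hf hσ hΩ hne hb, fun hb hs => ?_⟩
  obtain ⟨r, hri, hre⟩ := SteadyState.exists_mem_radii hΩ hb hs
  have hr := hri.1
  refine ⟨SteadyState.exists_isGreatest_interiorRadii hn hΩ hne hb hs, ⟨r, hre⟩,
    SteadyState.exists_isGreatest_exteriorRadii hΩ hb hs,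
    -- Half of a radius admissible on both sides: it depends only on Ω and is below every greatest
    -- radius.
    ⟨r / 2, half_pos hr, fun r₁ h₁ => (half_lt_self hr).trans_le (h₁.2 hri),
      fun r₂ h₂ => (half_lt_self hr).trans_le (h₂.2 hre), ?_⟩, ?_⟩
  · intro f σ ε u hf hσ hε0 hε h hu x hx
    have hεr : ε < r := hε.trans_lt (half_lt_self hr)
    refine ⟨fun r₁ h₁ => ?_, fun r₂ h₂ => ?_, fun hbdd => ?_⟩
    · exact h.angleQuotient_le_of_interior hf hσ hΩ hb hε0 hu hx h₁.1 (hεr.trans_le (h₁.2 hri))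
    · exact h.le_angleQuotient_of_exterior hf hσ hΩ hb hε0 hu hx hri h₂.1
        (hεr.trans_le (h₂.2 hre))
    · refine div_pos (sub_pos.2 (h.nuVert_lt hf hσ hΩ hb hε0 hu hx hri hbdd)) ?_
      rw [hu x hx]
      exact hε0
  · intro σ hσ η hη
    refine ⟨min (r / 2) (η * (3 / 4 * r ^ 2) / (r * Real.sqrt (σ ^ 2 - 1) + r * (1 + σ))),
      by positivity, fun f ε u hf hε0 hε h hu x hx => ?_⟩
    exact h.abs_nuVert_sub_lt hf hσ hΩ hb hε0 hu hx hri hre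
      (hε.trans_le (min_le_left _ _)) (hε.trans_le (min_le_right _ _))
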